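/- Let $\Omega\subseteq\mathbb{R}^d$ be open, $p,q\in[1,\infty]$, and fix $\phi\in\mathcal{S}(\mathbb{R}^d)$ with $\int\phi=1$ and $\int x^\alpha\phi(x)\,dx=0$ for all multi-indices $\alpha\ne0$. Put $\phi_\varepsilon=\varepsilon^{-d}\phi(\cdot/\varepsilon)$. Below, integrals $\left(\int_0^1(\cdot)^q\frac{d\varepsilon}{\varepsilon}\right)^{1/q}$ are replaced by suprema over $(0,1)$ if $q=\infty$; $\omega\Subset\Omega$ means that $\omega$ is open with compact closure contained in $\Omega$; and $\|u\|_{W^{k,p}(\omega)}=\max_{|\alpha|\le k}\|u^{(\alpha)}\|_{L^p(\omega)}$. *Generalized functions.* $\mathcal{E}_q(\Omega)$ (resp. $\mathcal{N}_q(\Omega)$) is the space of nets $(f_\varepsilon)_{\varepsilon\in(0,1)}$ in $C^\infty(\Omega)$, depending continuously on $\varepsilon$ (that is, $\varepsilon\mapsto f_\varepsilon$ is continuous from $(0,1)$ to $C^\infty(\Omega)$), such that for all $k\in\mathbb{N}_0$ and $\omega\Subset\Omega$ the quantity $$\left(\int_0^1\varepsilon^{qs}\|f_\varepsilon\|^q_{W^{k,p}(\omega)}\frac{d\varepsilon}{\varepsilon}\right)^{1/q}\qquad(*)$$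 is finite for some $s\in\mathbb{R}$ (resp. for all $s\in\mathbb{R}$), and $\mathcal{G}_q(\Omega)=\mathcal{E}_q(\Omega)/\mathcal{N}_q(\Omega)$. For $k\in\mathbb{N}_0$ and $s\in\mathbb{R}$, $\mathcal{G}^{k,-s}_{q,p}(\Omega)$ is the set of all $f\in\mathcal{G}_q(\Omega)$ that have a representative $(f_\varepsilon)_\varepsilon\in\mathcal{E}_q(\Omega)$ for which $(*)$ is finite, with these $k,s$, for all $\omega\Subset\Omega$. *Embedding.* $\iota:\mathcal{D}'(\Omega)\to\mathcal{G}_q(\Omega)$ is the sheaf embedding that extends $T\mapsto[((T*\phi_\varepsilon)|_\Omega)_\varepsilon]$ from compactly supported distributions. Explicitly, $\iota(T)=\left[\left(\sum_n\chi_n\,\big((\tilde\chi_nT)*\phi_\varepsilon\big)\right)_\varepsilon\right]$, where $(\chi_n)_n$ is a locally finite smooth partition of unity on $\Omega$ by compactly supported functions and $\tilde\chi_n\in\mathcal{D}(\Omega)$ equals $1$ near $\operatorname{supp}\chi_n$. *Besov spaces.* For $r\in\mathbb{R}$, a Littlewood–Paley pair of order $r$ is a pair $\varphi,\psi\in\mathcal{S}(\mathbb{R}^d)$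 such that for some $\sigma>0$ and $\eta\in(0,1)$ one has $\hat\varphi(\xi)\neq0$ for $|\xi|\le\sigma$ and $\hat\psi(\xi)\ne0$ for $\eta\sigma\le|\xi|\le\sigma$, and such that $\int t^\alpha\psi(t)\,dt=0$ for $|\alpha|\le\lfloor r\rfloor$ (an empty condition if $r<0$). Let such a pair be given, and put $\psi_y=y^{-d}\psi(\cdot/y)$. Then $B^r_{p,q}(\mathbb{R}^d)$ is the space of all $T\in\mathcal{S}'(\mathbb{R}^d)$ with $$\|T*\varphi\|_{L^p(\mathbb{R}^d)}+\left(\int_0^1y^{-qr}\|T*\psi_y\|^q_{L^p(\mathbb{R}^d)}\frac{dy}{y}\right)^{1/q}<\infty,$$ and $B^r_{p,q,loc}(\Omega)=\{T\in\mathcal{D}'(\Omega):\chi T\in B^r_{p,q}(\mathbb{R}^d)\text{ for all }\chi\in\mathcal{D}(\Omega)\}$. **Statement.** Let $r\in\mathbb{R}$, and let $k$ be any non-negative integer with $k>r$. Then, for every choice of the Littlewood–Paley pair $(\varphi,\psi)$ of order $r$ in the definition of $B^r_{p,q}(\mathbb{R}^d)$, $$\iota\big(B^r_{p,q,loc}(\Omega)\big)=\mathcal{G}^{k,r-k}_{q,p}(\Omega)\cap\iota\big(\mathcal{D}'(\Omega)\big).$$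 -/

import Mathlib

open MeasureTheory Set TopologicalSpace Filter Topology
open scoped ENNReal SchwartzMap Distributions

noncomputable section

namespace BesovColombeau

/-- The space `ℝ^d` with the Euclidean norm. -/
abbrev Eucl (d : ℕ) : Type := EuclideanSpace ℝ (Fin d)

variable {d : ℕ}

/-! ### Schwartz functions, convolution, mollifiers -/

/-- The function `z ↦ ψ (x - z)`. -/
def reflectAt (x : Eucl d) (ψ : 𝓢(Eucl d, ℂ)) : 𝓢(Eucl d, ℂ) :=
  SchwartzMap.compCLMOfAntilipschitz ℂ (g := fun z : Eucl d ↦ x - z) (K := 1) (by fun_prop)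
    (AntilipschitzWith.of_le_mul_dist fun a b ↦ by simp [dist_eq_norm, norm_sub_rev]) ψ

theorem reflectAt_apply (x : Eucl d) (ψ : 𝓢(Eucl d, ℂ)) (z : Eucl d) :
    reflectAt x ψ z = ψ (x - z) := rfl

/-- The convolution of a tempered distribution with a Schwartz function, as a function:
`(u * ψ) (x) = ⟨u, ψ (x - ·)⟩`. -/
def conv (u : 𝓢'(Eucl d, ℂ)) (ψ : 𝓢(Eucl d, ℂ)) (x : Eucl d) : ℂ := u (reflectAt x ψ)

open Classical in
/-- The dilate `ψ_y = y^{-d} ψ (· / y)`; it is used for `y > 0` only. -/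
def dilate (y : ℝ) (ψ : 𝓢(Eucl d, ℂ)) : 𝓢(Eucl d, ℂ) :=
  if hy : y = 0 then 0 else
    ((y ^ d)⁻¹ : ℝ) • SchwartzMap.compCLMOfContinuousLinearEquiv ℂ
      (ContinuousLinearEquiv.smulLeft (Units.mk0 y⁻¹ (inv_ne_zero hy)) : Eucl d ≃L[ℝ] Eucl d) ψ

theorem dilate_apply {y : ℝ} (hy : y ≠ 0) (ψ : 𝓢(Eucl d, ℂ)) (x : Eucl d) :
    dilate y ψ x = ((y ^ d)⁻¹ : ℝ) • ψ (y⁻¹ • x) := by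
  simp [dilate, hy]

/-- The moment `∫ x^α ψ(x) dx`. -/
def moment (ψ : 𝓢(Eucl d, ℂ)) (α : Fin d → ℕ) : ℂ :=
  ∫ x : Eucl d, ((∏ i, x i ^ α i : ℝ) : ℂ) * ψ x

/-- `∫ φ = 1`, and all moments of positive order of `φ` vanish. -/
structure IsMollifier (φ : 𝓢(Eucl d, ℂ)) : Prop where
  integral_eq_one : ∫ x, φ x = 1
  moment_eq_zero : ∀ α : Fin d → ℕ, α ≠ 0 → moment φ α = 0

/-- The measure `dy / y` on the interval `(0, 1)`. -/
def logMeasure : Measure ℝ :=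
  (volume.restrict (Ioo (0 : ℝ) 1)).withDensity fun y ↦ ENNReal.ofReal y⁻¹

/-! ### Besov spaces through generalized Littlewood-Paley pairs -/

/-- `(φ, ψ)` is a Littlewood-Paley pair of order `s`. -/
structure IsLPPair (s : ℝ) (φ ψ : 𝓢(Eucl d, ℂ)) : Prop where
  nonvanishing : ∃ σ : ℝ, 0 < σ ∧ ∃ η ∈ Ioo (0 : ℝ) 1,
    (∀ ξ : Eucl d, ‖ξ‖ ≤ σ → 0 < ‖FourierTransform.fourier φ ξ‖) ∧
    (∀ ξ : Eucl d, η * σ ≤ ‖ξ‖ → ‖ξ‖ ≤ σ → 0 < ‖FourierTransform.fourier ψ ξ‖)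
  moment_eq_zero : ∀ α : Fin d → ℕ, ((∑ i, α i : ℕ) : ℤ) ≤ ⌊s⌋ → moment ψ α = 0

/-- The Besov norm
`‖u * φ‖_{L^p} + (∫_0^1 y^{-qs} ‖u * ψ_y‖_{L^p}^q dy/y)^{1/q}`, with the supremum over
`0 < y < 1` in place of the integral if `q = ∞` (the essential supremum is the supremum, because
`y ↦ ‖u * ψ_y‖_{L^p}` is lower semicontinuous). -/
def besovNorm (p q : ℝ≥0∞) (s : ℝ) (φ ψ : 𝓢(Eucl d, ℂ)) (u : 𝓢'(Eucl d, ℂ)) : ℝ≥0∞ :=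
  eLpNorm (conv u φ) p volume +
    eLpNorm (fun y : ℝ ↦ ENNReal.ofReal (y ^ (-s)) * eLpNorm (conv u (dilate y ψ)) p volume)
      q logMeasure

/-- The Besov space `B^s_{p,q}(ℝ^d)`, defined by means of the Littlewood-Paley pair `(φ, ψ)`. -/
def besov (p q : ℝ≥0∞) (s : ℝ) (φ ψ : 𝓢(Eucl d, ℂ)) : Set 𝓢'(Eucl d, ℂ) :=
  {u | besovNorm p q s φ ψ u < ∞}

/-! ### Localization of distributions -/

variable {Ω : Opens (Eucl d)}

/-- The complex-linear extension of a distribution to complex-valued test functions. -/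
def evalC (T : 𝓓'(Ω, ℂ)) (f : 𝓓(Ω, ℂ)) : ℂ :=
  T (TestFunction.postcompCLM Complex.reCLM f) +
    Complex.I * T (TestFunction.postcompCLM Complex.imCLM f)

/-- The support of a test function, as a compact set. -/
def compactSupport (χ : 𝓓(Ω, ℂ)) : Compacts (Eucl d) := ⟨tsupport χ, χ.hasCompactSupport.isCompact⟩

/-- The product `χ g` of a test function `χ` and a Schwartz function `g`, as a test function
supported in the support of `χ`. -/
def mulSupportedLM (χ : 𝓓(Ω, ℂ)) : 𝓢(Eucl d, ℂ) →ₗ[ℝ] 𝓓_{compactSupport χ}(Eucl d, ℂ) where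
  toFun g := .of_support_subset (f := fun x ↦ χ x * g x) (χ.contDiff.mul (g.smooth ⊤))
    ((Function.support_mul_subset_left _ _).trans subset_closure)
  map_add' f g := by ext x; exact mul_add (χ x) (f x) (g x)
  map_smul' c g := by ext x; exact mul_smul_comm c (χ x) (g x)

theorem continuous_mulSupportedLM (χ : 𝓓(Ω, ℂ)) : Continuous (mulSupportedLM χ) := by
  have hχ : Function.HasTemperateGrowth (χ : Eucl d → ℂ) :=
    χ.hasCompactSupport.hasTemperateGrowth χ.contDiff
  refine WithSeminorms.continuous_of_isBounded (schwartz_withSeminorms ℝ (Eucl d) ℂ)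
    (ContDiffMapSupportedIn.withSeminorms ℝ _ _ _ _) _ (.of_real fun i ↦ ?_)
  let A : 𝓢(Eucl d, ℂ) →L[ℝ] 𝓢(Eucl d, ℂ) :=
    (SchwartzMap.smulLeftCLM ℂ (χ : Eucl d → ℂ)).restrictScalars ℝ
  have hcont : Continuous ((SchwartzMap.seminorm ℝ 0 i).comp A.toLinearMap) :=
    ((schwartz_withSeminorms ℝ (Eucl d) ℂ).continuous_seminorm (0, i)).comp A.continuous
  obtain ⟨s, C, -, h⟩ := Seminorm.bound_of_continuous (schwartz_withSeminorms ℝ (Eucl d) ℂ) _ hcont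
  refine ⟨s, C, fun g ↦ ?_⟩
  have hg : SchwartzMap.seminorm ℝ 0 i (A g) ≤ C * (s.sup (schwartzSeminormFamily ℝ (Eucl d) ℂ)) g :=
    h g
  refine ((mulSupportedLM χ g).seminorm_le_iff ℝ ((apply_nonneg _ _).trans hg) i).2
    fun _ x _ ↦ ?_
  refine le_trans ?_ hg
  have hfun : (mulSupportedLM χ g : Eucl d → ℂ) = A g := by
    ext x
    exact (SchwartzMap.smulLeftCLM_apply_apply hχ g x).symm
  rw [hfun]
  exact SchwartzMap.norm_iteratedFDeriv_le_seminorm ℝ (A g) i x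

/-- The product `χ g` as a test function on `Ω`. -/
def mulTest (χ : 𝓓(Ω, ℂ)) : 𝓢(Eucl d, ℂ) →L[ℝ] 𝓓(Ω, ℂ) :=
  TestFunction.ofSupportedInCLM ℝ (K := compactSupport χ) χ.tsupport_subset ∘L
    { toLinearMap := mulSupportedLM χ, cont := continuous_mulSupportedLM χ }

theorem mulTest_apply (χ : 𝓓(Ω, ℂ)) (g : 𝓢(Eucl d, ℂ)) (x : Eucl d) :
    mulTest χ g x = χ x * g x := rfl

/-- The compactly supported distribution `χ T`, extended by zero to `ℝ^d` and considered as a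
tempered distribution: `⟨χ T, g⟩ = ⟨T, χ g⟩`. -/
def localize (T : 𝓓'(Ω, ℂ)) (χ : 𝓓(Ω, ℂ)) : 𝓢'(Eucl d, ℂ) :=
  ContinuousLinearMap.toPointwiseConvergenceCLM _ _ _ _
    { toFun := fun g ↦ evalC T (mulTest χ g)
      map_add' := fun f g ↦ by
        simp only [evalC, map_add]; ring
      map_smul' := fun c g ↦ by
        have hre : TestFunction.postcompCLM Complex.reCLM (mulTest χ (c • g)) =
            c.re • TestFunction.postcompCLM Complex.reCLM (mulTest χ g) -
              c.im • TestFunction.postcompCLM Complex.imCLM (mulTest χ g) := by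
          ext x
          simp [mulTest_apply]
          ring
        have him : TestFunction.postcompCLM Complex.imCLM (mulTest χ (c • g)) =
            c.re • TestFunction.postcompCLM Complex.imCLM (mulTest χ g) +
              c.im • TestFunction.postcompCLM Complex.reCLM (mulTest χ g) := by
          ext x
          simp [mulTest_apply]
          ring
        simp only [evalC, hre, him, map_add, map_sub, map_smul, RingHom.id_apply,
          Complex.real_smul, smul_eq_mul]
        conv_rhs => rw [← Complex.re_add_im c]
        linear_combination (c.im * T (TestFunction.postcompCLM Complex.imCLM (mulTest χ g))) *
          (-Complex.I_sq)
      cont := by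
        unfold evalC
        fun_prop }

theorem localize_apply (T : 𝓓'(Ω, ℂ)) (χ : 𝓓(Ω, ℂ)) (g : 𝓢(Eucl d, ℂ)) :
    localize T χ g = evalC T (mulTest χ g) := rfl

/-- The local Besov space `B^s_{p,q,loc}(Ω)`. -/
def besovLoc (Ω : Opens (Eucl d)) (p q : ℝ≥0∞) (s : ℝ) (φ ψ : 𝓢(Eucl d, ℂ)) : Set 𝓓'(Ω, ℂ) :=
  {T | ∀ χ : 𝓓(Ω, ℂ), localize T χ ∈ besov p q s φ ψ}

/-! ### The spaces of nets and of generalized functions -/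

/-- The Sobolev norm `max_{|α| ≤ k} ‖u^{(α)}‖_{L^p(ω)}` of a function smooth on the open set `ω`;
the partial derivatives of order `n` are enumerated as `∂_{i 1} ⋯ ∂_{i n} u`. -/
def sobolevNorm (k : ℕ) (p : ℝ≥0∞) (ω : Set (Eucl d)) (u : Eucl d → ℂ) : ℝ≥0∞ :=
  ⨆ (n : Fin (k + 1)) (i : Fin n → Fin d),
    eLpNorm (fun x ↦ iteratedFDeriv ℝ n u x fun j ↦ EuclideanSpace.single (i j) 1) p
      (volume.restrict ω)

/-- A net `(f_ε)_{0 < ε < 1}` of smooth functions on `Ω` which depends continuously on `ε`, that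
is, `ε ↦ f_ε` is continuous from `(0, 1)` to `C^∞(Ω)`. Nets are written as functions on
`ℝ × ℝ^d`; only the values on `(0, 1) × Ω` matter. -/
structure IsContNet (Ω : Opens (Eucl d)) (f : ℝ → Eucl d → ℂ) : Prop where
  smooth : ∀ ε ∈ Ioo (0 : ℝ) 1, ContDiffOn ℝ (⊤ : ℕ∞) (f ε) Ω
  cont : ∀ n : ℕ, ContinuousOn (fun z : ℝ × Eucl d ↦ iteratedFDeriv ℝ n (f z.1) z.2)
    (Ioo (0 : ℝ) 1 ×ˢ (Ω : Set (Eucl d)))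

/-- `ω ⋐ Ω`: the set `ω` is open, with compact closure inside `Ω`. -/
structure IsRelCompact (ω : Set (Eucl d)) (Ω : Opens (Eucl d)) : Prop where
  isOpen : IsOpen ω
  isCompact_closure : IsCompact (closure ω)
  closure_subset : closure ω ⊆ Ω

/-- `(∫_0^1 ε^{qs} ‖f_ε‖_{W^{k,p}(ω)}^q dε/ε)^{1/q}`, respectively
`sup_{0 < ε < 1} ε^s ‖f_ε‖_{W^{k,p}(ω)}` if `q = ∞`. -/
def netNorm (q p : ℝ≥0∞) (k : ℕ) (s : ℝ) (ω : Set (Eucl d)) (f : ℝ → Eucl d → ℂ) : ℝ≥0∞ :=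
  eLpNorm (fun ε : ℝ ↦ ENNReal.ofReal (ε ^ s) * sobolevNorm k p ω (f ε)) q logMeasure

theorem IsContNet.zero (Ω : Opens (Eucl d)) : IsContNet Ω (0 : ℝ → Eucl d → ℂ) where
  smooth _ _ := contDiffOn_const
  cont n := by
    refine (continuousOn_const (c := 0)).congr fun z _ ↦ ?_
    exact congrFun iteratedFDeriv_fun_zero z.2

theorem IsContNet.contDiffAt {f : ℝ → Eucl d → ℂ} (hf : IsContNet Ω f) {ε : ℝ}
    (hε : ε ∈ Ioo (0 : ℝ) 1) {x : Eucl d} (hx : x ∈ Ω) (n : ℕ) : ContDiffAt ℝ n (f ε) x :=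
  ((hf.smooth ε hε).contDiffAt (Ω.isOpen.mem_nhds hx)).of_le (by exact_mod_cast le_top)

theorem IsContNet.add {f g : ℝ → Eucl d → ℂ} (hf : IsContNet Ω f) (hg : IsContNet Ω g) :
    IsContNet Ω (f + g) where
  smooth ε hε := (hf.smooth ε hε).add (hg.smooth ε hε)
  cont n := ((hf.cont n).add (hg.cont n)).congr fun _ hz ↦
    iteratedFDeriv_add_apply (hf.contDiffAt hz.1 hz.2 n) (hg.contDiffAt hz.1 hz.2 n)

theorem IsContNet.smul (c : ℂ) {f : ℝ → Eucl d → ℂ} (hf : IsContNet Ω f) :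
    IsContNet Ω (c • f) where
  smooth ε hε := (hf.smooth ε hε).const_smul c
  cont n := by
    refine ((hf.cont n).const_smul c).congr fun z hz ↦ ?_
    exact iteratedFDeriv_const_smul_apply (a := c) (hf.contDiffAt hz.1 hz.2 n)

theorem IsContNet.continuousOn_partial {f : ℝ → Eucl d → ℂ} (hf : IsContNet Ω f) {n : ℕ}
    (v : Fin n → Eucl d) :
    ContinuousOn (fun z : ℝ × Eucl d ↦ iteratedFDeriv ℝ n (f z.1) z.2 v)
      (Ioo (0 : ℝ) 1 ×ˢ (Ω : Set (Eucl d))) :=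
  (ContinuousMultilinearMap.apply ℝ _ ℂ v).continuous.comp_continuousOn (hf.cont n)

theorem IsContNet.aestronglyMeasurable_partial {f : ℝ → Eucl d → ℂ} (hf : IsContNet Ω f)
    {ω : Set (Eucl d)} (hω : IsRelCompact ω Ω) {n : ℕ} (v : Fin n → Eucl d) {ε : ℝ}
    (hε : ε ∈ Ioo (0 : ℝ) 1) :
    AEStronglyMeasurable (fun x ↦ iteratedFDeriv ℝ n (f ε) x v) (volume.restrict ω) := by
  refine ContinuousOn.aestronglyMeasurable ?_ hω.isOpen.measurableSet
  exact (hf.continuousOn_partial v).comp (f := fun x ↦ (ε, x)) (by fun_prop)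
    fun x hx ↦ ⟨hε, hω.closure_subset (subset_closure hx)⟩

theorem ae_logMeasure : ∀ᵐ ε ∂logMeasure, ε ∈ Ioo (0 : ℝ) 1 :=
  (withDensity_absolutelyContinuous _ _).ae_le (ae_restrict_mem measurableSet_Ioo)

/-- `ε ↦ ‖f_ε‖_{W^{k,p}(ω)}` is measurable. -/
theorem IsContNet.aemeasurable_sobolevNorm {f : ℝ → Eucl d → ℂ} (hf : IsContNet Ω f)
    {ω : Set (Eucl d)} (hω : IsRelCompact ω Ω) (k : ℕ) (p : ℝ≥0∞) :
    AEMeasurable (fun ε ↦ sobolevNorm k p ω (f ε)) logMeasure := by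
  refine AEMeasurable.mono_ac ?_ (withDensity_absolutelyContinuous _ _)
  refine aemeasurable_restrict_of_measurable_subtype measurableSet_Ioo ?_
  refine Measurable.iSup fun n ↦ Measurable.iSup fun i ↦ LowerSemicontinuous.measurable ?_
  rw [lowerSemicontinuous_iff_isClosed_preimage]
  refine fun C ↦ IsSeqClosed.isClosed fun ε ε₀ hε hlim ↦ ?_
  refine Lp.eLpNorm_le_of_ae_tendsto (u := atTop) (Eventually.of_forall hε)
    (fun m ↦ hf.aestronglyMeasurable_partial hω _ (ε m).2) ?_
  filter_upwards [ae_restrict_mem hω.isOpen.measurableSet] with x hx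
  have hxΩ : x ∈ Ω := hω.closure_subset (subset_closure hx)
  have hc := (hf.continuousOn_partial (n := n)
    fun j ↦ EuclideanSpace.single (i j) (1 : ℝ)).continuousAt
    ((isOpen_Ioo.prod Ω.isOpen).mem_nhds (show ((ε₀ : ℝ), x) ∈ _ from ⟨ε₀.2, hxΩ⟩))
  refine hc.tendsto.comp (f := fun m ↦ ((ε m : ℝ), x)) ?_
  exact ((continuous_subtype_val.tendsto ε₀).comp hlim).prodMk_nhds tendsto_const_nhds

theorem IsContNet.sobolevNorm_add_le {f g : ℝ → Eucl d → ℂ} (hf : IsContNet Ω f)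
    (hg : IsContNet Ω g) {ω : Set (Eucl d)} (hω : IsRelCompact ω Ω) (k : ℕ) (p : ℝ≥0∞) {ε : ℝ}
    (hε : ε ∈ Ioo (0 : ℝ) 1) :
    sobolevNorm k p ω ((f + g) ε) ≤
      ENNReal.LpAddConst p * (sobolevNorm k p ω (f ε) + sobolevNorm k p ω (g ε)) := by
  refine iSup_le fun n ↦ iSup_le fun i ↦ ?_
  set v : Fin n → Eucl d := fun j ↦ EuclideanSpace.single (i j) (1 : ℝ)
  calc _ = eLpNorm ((fun x ↦ iteratedFDeriv ℝ n (f ε) x v) + fun x ↦ iteratedFDeriv ℝ n (g ε) x v)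
        p (volume.restrict ω) := by
        refine eLpNorm_congr_ae ?_
        filter_upwards [ae_restrict_mem hω.isOpen.measurableSet] with x hx
        have hxΩ : x ∈ Ω := hω.closure_subset (subset_closure hx)
        have := iteratedFDeriv_add_apply (hf.contDiffAt hε hxΩ n) (hg.contDiffAt hε hxΩ n)
        exact congrArg (fun L ↦ L v) this
    _ ≤ ENNReal.LpAddConst p * (_ + _) := eLpNorm_add_le' (hf.aestronglyMeasurable_partial hω v hε)
        (hg.aestronglyMeasurable_partial hω v hε) p
    _ ≤ _ := by
      gcongr
      · exact le_iSup₂_of_le n i le_rfl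
      · exact le_iSup₂_of_le n i le_rfl

theorem netNorm_zero (q p : ℝ≥0∞) (k : ℕ) (s : ℝ) (ω : Set (Eucl d)) :
    netNorm q p k s ω (0 : ℝ → Eucl d → ℂ) = 0 := by
  have h : sobolevNorm k p ω (0 : Eucl d → ℂ) = 0 := by
    simp [sobolevNorm]
  simp [netNorm, h]

theorem netNorm_add_lt_top {q p : ℝ≥0∞} {k : ℕ} {s : ℝ}
    {ω : Set (Eucl d)} (hω : IsRelCompact ω Ω) {f g : ℝ → Eucl d → ℂ}
    (hf : IsContNet Ω f) (hg : IsContNet Ω g) (hf' : netNorm q p k s ω f < ∞)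
    (hg' : netNorm q p k s ω g < ∞) :
    netNorm q p k s ω (f + g) < ∞ := by
  have hm {f : ℝ → Eucl d → ℂ} (hf : IsContNet Ω f) : AEStronglyMeasurable
      (fun ε : ℝ ↦ ENNReal.ofReal (ε ^ s) * sobolevNorm k p ω (f ε)) logMeasure :=
    ((Measurable.aemeasurable (by fun_prop)).mul
      (hf.aemeasurable_sobolevNorm hω k p)).aestronglyMeasurable
  have hfin := eLpNorm_add_lt_top ⟨hm hf, hf'⟩ ⟨hm hg, hg'⟩
  refine lt_of_le_of_lt (eLpNorm_le_mul_eLpNorm_of_ae_le_mul' (c := (ENNReal.LpAddConst p).toNNReal)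
    ?_ q) (ENNReal.mul_lt_top (by simp) hfin)
  filter_upwards [ae_logMeasure] with ε hε
  rw [ENNReal.coe_toNNReal (ENNReal.LpAddConst_lt_top p).ne]
  simp only [enorm_eq_self, Pi.add_apply]
  calc _ ≤ ENNReal.ofReal (ε ^ s) * (ENNReal.LpAddConst p *
        (sobolevNorm k p ω (f ε) + sobolevNorm k p ω (g ε))) := by
        gcongr; exact hf.sobolevNorm_add_le hg hω k p hε
    _ = _ := by ring

theorem netNorm_smul_lt_top {q p : ℝ≥0∞} {k : ℕ} {s : ℝ}
    {ω : Set (Eucl d)} (hω : IsRelCompact ω Ω) (c : ℂ) {f : ℝ → Eucl d → ℂ}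
    (hf : IsContNet Ω f) (hf' : netNorm q p k s ω f < ∞) :
    netNorm q p k s ω (c • f) < ∞ := by
  refine lt_of_le_of_lt (eLpNorm_le_mul_eLpNorm_of_ae_le_mul' (c := ‖c‖₊)
    ?_ q) (ENNReal.mul_lt_top (by simp) hf')
  filter_upwards [ae_logMeasure] with ε hε
  simp only [enorm_eq_self]
  rw [mul_left_comm]
  gcongr
  refine iSup_le fun n ↦ iSup_le fun i ↦ ?_
  refine le_trans ?_ (mul_le_mul_right (le_iSup₂_of_le n i le_rfl) _)
  refine le_trans (eLpNorm_congr_ae ?_).le (eLpNorm_const_smul_le (c := c))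
  filter_upwards [ae_restrict_mem hω.isOpen.measurableSet] with x hx
  have hxΩ : x ∈ Ω := hω.closure_subset (subset_closure hx)
  have := iteratedFDeriv_const_smul_apply (a := c) (hf.contDiffAt hε hxΩ n)
  exact congrArg (fun L ↦ L fun j ↦ EuclideanSpace.single (i j) (1 : ℝ)) this

theorem netNorm_mono (q p : ℝ≥0∞) (k : ℕ) {s t : ℝ} (hst : s ≤ t) (ω : Set (Eucl d))
    (f : ℝ → Eucl d → ℂ) : netNorm q p k t ω f ≤ netNorm q p k s ω f := by
  refine eLpNorm_mono_enorm_ae ?_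
  filter_upwards [ae_logMeasure] with ε hε
  simp only [enorm_eq_self]
  gcongr ENNReal.ofReal ?_ * _
  exact Real.rpow_le_rpow_of_exponent_ge hε.1 hε.2.le hst

/-- The space `𝓔_q(Ω)` of nets with `L^q`-moderate growth. (Like `negligible`, it does not depend
on `p`, by the Sobolev embedding theorem.) -/
def moderate (Ω : Opens (Eucl d)) (q p : ℝ≥0∞) : Submodule ℂ (ℝ → Eucl d → ℂ) where
  carrier := {f | IsContNet Ω f ∧
    ∀ (k : ℕ) (ω : Set (Eucl d)), IsRelCompact ω Ω → ∃ s : ℝ, netNorm q p k s ω f < ∞}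
  zero_mem' := ⟨.zero Ω, fun k ω _ ↦ ⟨0, by simp [netNorm_zero]⟩⟩
  add_mem' := fun {f g} hf hg ↦ ⟨hf.1.add hg.1, fun k ω hω ↦ by
    obtain ⟨s, hs⟩ := hf.2 k ω hω
    obtain ⟨t, ht⟩ := hg.2 k ω hω
    exact ⟨max s t, netNorm_add_lt_top hω hf.1 hg.1
      ((netNorm_mono q p k (le_max_left s t) ω f).trans_lt hs)
      ((netNorm_mono q p k (le_max_right s t) ω g).trans_lt ht)⟩⟩
  smul_mem' := fun c f hf ↦ ⟨hf.1.smul c, fun k ω hω ↦ by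
    obtain ⟨s, hs⟩ := hf.2 k ω hω
    exact ⟨s, netNorm_smul_lt_top hω c hf.1 hs⟩⟩

/-- The space `𝓝_q(Ω)` of `L^q`-negligible nets. -/
def negligible (Ω : Opens (Eucl d)) (q p : ℝ≥0∞) : Submodule ℂ (ℝ → Eucl d → ℂ) where
  carrier := {f | IsContNet Ω f ∧
    ∀ (k : ℕ) (ω : Set (Eucl d)), IsRelCompact ω Ω → ∀ s : ℝ, netNorm q p k s ω f < ∞}
  zero_mem' := ⟨.zero Ω, fun k ω _ s ↦ by simp [netNorm_zero]⟩
  add_mem' := fun {f g} hf hg ↦ ⟨hf.1.add hg.1, fun k ω hω s ↦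
    netNorm_add_lt_top hω hf.1 hg.1 (hf.2 k ω hω s) (hg.2 k ω hω s)⟩
  smul_mem' := fun c f hf ↦ ⟨hf.1.smul c, fun k ω hω s ↦
    netNorm_smul_lt_top hω c hf.1 (hf.2 k ω hω s)⟩

/-- All nets modulo `𝓝_q(Ω)`. It contains `𝓖_q(Ω) = 𝓔_q(Ω) / 𝓝_q(Ω)`. -/
abbrev NetQuotient (Ω : Opens (Eucl d)) (q p : ℝ≥0∞) : Type :=
  (ℝ → Eucl d → ℂ) ⧸ negligible Ω q p

/-- The space of generalized functions `𝓖_q(Ω) = 𝓔_q(Ω) / 𝓝_q(Ω)`: the classes `[(f_ε)]` of the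
nets in `𝓔_q(Ω)`. -/
def genFun (Ω : Opens (Eucl d)) (q p : ℝ≥0∞) : Submodule ℂ (NetQuotient Ω q p) :=
  (moderate Ω q p).map (negligible Ω q p).mkQ

/-- The nets `𝓔^{k,-s}_{q,p}(Ω)`. -/
def besovNets (Ω : Opens (Eucl d)) (q p : ℝ≥0∞) (k : ℕ) (s : ℝ) : Set (ℝ → Eucl d → ℂ) :=
  {f | f ∈ moderate Ω q p ∧
    ∀ ω : Set (Eucl d), IsRelCompact ω Ω → netNorm q p k s ω f < ∞}

/-- The subset `𝓖^{k,-s}_{q,p}(Ω)` of `𝓖_q(Ω)`: the generalized functions that have a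
representative in `𝓔^{k,-s}_{q,p}(Ω)`. -/
def besovGenFun (Ω : Opens (Eucl d)) (q p : ℝ≥0∞) (k : ℕ) (s : ℝ) : Set (NetQuotient Ω q p) :=
  {F | F ∈ genFun Ω q p ∧ ∃ f ∈ besovNets Ω q p k s, (negligible Ω q p).mkQ f = F}

/-! ### The embedding of the distributions -/

/-- Smooth cutoffs exhausting `Ω`: each `θ (n + 1)` is `1` near the support of `θ n`, and each
compact subset of `Ω` has a neighbourhood where some `θ n` is `1`. -/
structure IsCutoffSequence (Ω : Opens (Eucl d)) (θ : ℕ → 𝓓(Ω, ℂ)) : Prop where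
  succ_eq_one : ∀ n, ∀ᶠ x in 𝓝ˢ (tsupport (θ n)), θ (n + 1) x = 1
  exhausts : ∀ K : Set (Eucl d), IsCompact K → K ⊆ Ω → ∃ n, ∀ᶠ x in 𝓝ˢ K, θ n x = 1

theorem exists_cutoff (Ω : Opens (Eucl d)) {K U : Set (Eucl d)} (hK : IsCompact K)
    (hU : IsCompact U) (hUΩ : U ⊆ Ω) (hKU : K ⊆ interior U) :
    ∃ θ : 𝓓(Ω, ℂ), (∀ᶠ x in 𝓝ˢ K, θ x = 1) ∧ tsupport θ ⊆ U := by
  obtain ⟨f, hf1, hf0, -⟩ := exists_contMDiffMap_one_nhds_of_subset_interior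
    (n := (⊤ : ℕ∞)) (modelWithCornersSelf ℝ (Eucl d)) hK.isClosed hKU
  have hsupp : tsupport (fun x ↦ (f x : ℂ)) ⊆ U := by
    refine closure_minimal (fun x hx ↦ ?_) hU.isClosed
    by_contra h
    exact hx (by simp [hf0 x h])
  refine ⟨⟨fun x ↦ (f x : ℂ), Complex.ofRealCLM.contDiff.comp f.contMDiff.contDiff,
    hU.of_isClosed_subset (isClosed_tsupport _) hsupp, hsupp.trans hUΩ⟩, ?_, hsupp⟩
  filter_upwards [hf1] with x hx
  change ((f x : ℝ) : ℂ) = 1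
  simp [hx]

theorem exists_isCutoffSequence (Ω : Opens (Eucl d)) :
    ∃ θ : ℕ → 𝓓(Ω, ℂ), IsCutoffSequence Ω θ := by
  have : LocallyCompactSpace Ω := Ω.isOpen.locallyCompactSpace
  let e : CompactExhaustion Ω := default
  let K : ℕ → Set (Eucl d) := fun n ↦ Subtype.val '' e n
  have hK (n) : IsCompact (K n) := (e.isCompact n).image continuous_subtype_val
  have hKΩ (n) : K n ⊆ Ω := by rintro _ ⟨x, -, rfl⟩; exact x.2
  have hint (n) : Subtype.val '' interior (e n) ⊆ interior (K n) :=
    interior_maximal (image_mono interior_subset)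
      (Ω.isOpen.isOpenMap_subtype_val _ isOpen_interior)
  have hKK (n) : K n ⊆ interior (K (n + 1)) :=
    (image_mono (e.subset_interior_succ n)).trans (hint _)
  choose θ h1 h2 using fun n ↦ exists_cutoff Ω (hK n) (hK (n + 1)) (hKΩ (n + 1)) (hKK n)
  refine ⟨θ, fun n ↦ (h1 (n + 1)).filter_mono (nhdsSet_mono (h2 n)), fun C hC hCΩ ↦ ?_⟩
  obtain ⟨n, hn⟩ := e.exists_superset_of_isCompact
    (Topology.IsInducing.subtypeVal.isCompact_preimage' hC (by simpa using hCΩ))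
  have hCn : C ⊆ K n := fun x hx ↦
    ⟨(⟨x, hCΩ hx⟩ : Ω), hn (show (⟨x, hCΩ hx⟩ : Ω) ∈ Subtype.val ⁻¹' C from hx), rfl⟩
  exact ⟨n, (h1 n).filter_mono (nhdsSet_mono hCn)⟩

/-- A choice of smooth cutoffs exhausting `Ω`. -/
def cutoff (Ω : Opens (Eucl d)) : ℕ → 𝓓(Ω, ℂ) := (exists_isCutoffSequence Ω).choose

theorem isCutoffSequence_cutoff (Ω : Opens (Eucl d)) : IsCutoffSequence Ω (cutoff Ω) :=
  (exists_isCutoffSequence Ω).choose_spec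

/-- The smooth, locally finite partition of unity `χ_n = θ_n - θ_{n-1}` (with `θ_{-1} = 0`) on `Ω`.
The function `θ_{n+1}` is `1` near the support of `χ_n`. -/
def partition (Ω : Opens (Eucl d)) : ℕ → 𝓓(Ω, ℂ)
  | 0 => cutoff Ω 0
  | n + 1 => cutoff Ω (n + 1) - cutoff Ω n

/-- The net `∑_n χ_n ((θ_{n+1} T) * φ_ε)`, where `(χ_n)` is a partition of unity on `Ω` and
`θ_{n+1}` is a test function that is `1` near the support of `χ_n`. The sum is locally finite. -/
def embedNet (φ : 𝓢(Eucl d, ℂ)) (T : 𝓓'(Ω, ℂ)) (ε : ℝ) (x : Eucl d) : ℂ :=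
  ∑ᶠ n : ℕ, partition Ω n x * conv (localize T (cutoff Ω (n + 1))) (dilate ε φ) x

/-- The embedding `ι` of `𝓓'(Ω)`, the extension of `T ↦ [(T * φ_ε)_ε]` from the compactly supported
distributions to a map of sheaves: on `ω ⋐ Ω`, `ι(T)` is represented by `(χ T) * φ_ε` for any test
function `χ` that is `1` near the closure of `ω`, and these local classes are glued by means of a
partition of unity. -/
def embed (q p : ℝ≥0∞) (φ : 𝓢(Eucl d, ℂ)) (T : 𝓓'(Ω, ℂ)) : NetQuotient Ω q p :=
  (negligible Ω q p).mkQ (embedNet φ T)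

end BesovColombeau

end

open BesovColombeau

/-!
The net of `T` on a relatively compact set agrees, up to a negligible net, with `(ρ T) * φ_ε` for a
single cutoff `ρ` (`exists_netNorm_embedNet_iff`): the convolution of `φ_ε` with a distribution whose
support stays away from the set is `O(ε ^ M)` for all `M`, because localized distributions have finite
order and `φ` decays rapidly. As `∂^v (u * φ_ε) = ε ^ (-|v|) u * (∂^v φ)_ε`, the statement thus
compares the functions `ε ↦ ‖u * (∂^v φ)_ε‖_p`, weighted by `ε ^ (k - r - |v|)` with `|v| ≤ k`, with
the functions `y ↦ ‖u * (ψ₁)_y‖_p`, weighted by `y ^ (-r)`.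

Both directions are instances of one transfer principle, `eLpNorm_conv_localize_lt_top`. Let finitely
many `ψ i` satisfy a Tauberian condition (their Fourier transforms have no common zero on an annulus
`η σ ≤ |ξ| ≤ σ`), and let `ζ` have vanishing moments of order less than `m`, where `r < m`. If the
functions `u * (ψ i)_y` are locally of size `y ^ r` in the sense of `L^q (dy / y)`, so is
`(χ u) * ζ_ε`.

* If `T` is locally in the Besov space, take `ψ₁` for the single `ψ i`, and `∂^v φ` for `ζ`, whose
  moments of order less than `|v|` vanish. The principle is applied with the regularity
  `r - k + |v|` instead of `r`, which is less than `|v|` since `r < k`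
  (`netNorm_embedNet_lt_top_of_mem_besovLoc`).
* Conversely, take for the `ψ i` the pure derivatives `∂_i^k φ`. Their Fourier transforms are
  multiples of `ξ_i ^ k φ̂(ξ)` and have no common zero on an annulus close to the origin, because
  `φ̂(0) = 1`; and take `ψ₁` for `ζ`, which has vanishing moments of order up to `⌊r⌋`
  (`mem_besovLoc_of_netNorm_embedNet_lt_top`). The term `T * φ₁` of the Besov norm is finite for all
  compactly supported `T`.

The transfer principle rests on a discrete Calderón reproducing formula: division of Fourier
transforms on the annulus gives functions `b i`, with vanishing moments of all orders, and `Θ` with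
integral one such that `Θ = Θ_l + ∑ i, b i * ψ i` (`exists_calderon`). By iteration, the
approximate identity `Θ_{t l^{-J}}` becomes a sum over the scales `t l^{-j}` (`dilate_telescope`), and
`(χ u) * ζ_ε` becomes a sum of integrals of `u * (ψ i)_y` against the kernels
`∫ χ(s) ζ_ε(x - s) (b i)_y(s - z) ds`. The vanishing moments of `b i` and of `ζ` and Taylor's formula
(`HasVanishingMoments.exists_norm_integral_dilate_mul_le`) bound these kernels by
`min ((y / ε) ^ M, (ε / y) ^ m)` times an integrable function of size `max y ε`; at a positive distance
from the support of `χ` they are smaller than any power of `y`, which absorbs the growth of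
`u * (ψ i)_y` there. Young's inequality then leads to a discrete convolution over the
geometric grid through `ε`, for which the spaces `L^q (dε / ε)` are stable
(`eLpNorm_lt_top_of_le_grid`).
-/

namespace BesovColombeau

variable {d : ℕ} {Ω : Opens (Eucl d)}

open scoped LineDeriv

/-! ### Compactly supported distributions have finite order -/

/-- The distribution `u` is bounded by `C` times the `C^L` norm on the set `K`. The supremum of the
derivatives is replaced by an arbitrary upper bound `B`, so that `K` may be empty or unbounded. -/
def IsOrderBound (u : 𝓢'(Eucl d, ℂ)) (K : Set (Eucl d)) (L : ℕ) (C : ℝ) : Prop :=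
  0 ≤ C ∧ ∀ (g : 𝓢(Eucl d, ℂ)) (B : ℝ), 0 ≤ B →
    (∀ l ≤ L, ∀ z ∈ K, ‖iteratedFDeriv ℝ l g z‖ ≤ B) → ‖u g‖ ≤ C * B

theorem norm_iteratedFDeriv_mul_le_two_pow {f g : Eucl d → ℂ} {x : Eucl d} {n : ℕ} {A B : ℝ}
    (hf : ContDiff ℝ (⊤ : ℕ∞) f) (hg : ContDiff ℝ (⊤ : ℕ∞) g)
    (hA : ∀ j ≤ n, ‖iteratedFDeriv ℝ j f x‖ ≤ A) (hB : ∀ j ≤ n, ‖iteratedFDeriv ℝ j g x‖ ≤ B) :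
    ‖iteratedFDeriv ℝ n (fun y ↦ f y * g y) x‖ ≤ 2 ^ n * (A * B) := by
  refine (norm_iteratedFDeriv_mul_le hf hg x (n := n) (by exact_mod_cast le_top)).trans ?_
  have h0 : 0 ≤ A := (norm_nonneg _).trans (hA 0 n.zero_le)
  calc _ ≤ ∑ i ∈ Finset.range (n + 1), (n.choose i : ℝ) * (A * B) := by
        refine Finset.sum_le_sum fun i hi ↦ ?_
        rw [mul_assoc]
        gcongr
        · exact hA i (by simpa [Nat.lt_succ_iff] using hi)
        · exact hB (n - i) (Nat.sub_le _ _)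
    _ = 2 ^ n * (A * B) := by
        rw [← Finset.sum_mul]
        congr 1
        exact_mod_cast Nat.sum_range_choose n

theorem exists_bound_iteratedFDeriv {F : Type*} [NormedAddCommGroup F] [NormedSpace ℝ F]
    (g : 𝓢(Eucl d, F)) (n : ℕ) :
    ∃ A, 0 ≤ A ∧ ∀ j ≤ n, ∀ x, ‖iteratedFDeriv ℝ j g x‖ ≤ A := by
  refine ⟨∑ j ∈ Finset.range (n + 1), SchwartzMap.seminorm ℝ 0 j g,
    Finset.sum_nonneg fun j _ ↦ apply_nonneg _ _, fun j hj x ↦ ?_⟩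
  refine (SchwartzMap.norm_iteratedFDeriv_le_seminorm ℝ g j x).trans ?_
  exact Finset.single_le_sum (f := fun j ↦ SchwartzMap.seminorm ℝ 0 j g)
    (fun j _ ↦ apply_nonneg _ _) (Finset.mem_range.2 (by omega))

/-- A test function, considered as a Schwartz function. -/
noncomputable def toSchwartz (χ : 𝓓(Ω, ℂ)) : 𝓢(Eucl d, ℂ) := χ.hasCompactSupport.toSchwartzMap χ.contDiff

theorem exists_bound_iteratedFDeriv_test (χ : 𝓓(Ω, ℂ)) (n : ℕ) :
    ∃ A, 0 ≤ A ∧ ∀ j ≤ n, ∀ x, ‖iteratedFDeriv ℝ j χ x‖ ≤ A :=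
  exists_bound_iteratedFDeriv (toSchwartz χ) n

/-- The map `T` as a continuous functional on the complex test functions with support in a fixed
compact set. -/
noncomputable def evalSupported (T : 𝓓'(Ω, ℂ)) {K : Compacts (Eucl d)} (hK : (K : Set (Eucl d)) ⊆ Ω) :
    𝓓_{K}(Eucl d, ℂ) →L[ℝ] ℂ where
  toFun f := evalC T (TestFunction.ofSupportedInCLM ℝ hK f)
  map_add' f g := by simp only [evalC, map_add]; ring
  map_smul' c f := by
    simp only [evalC, map_smul, RingHom.id_apply, Complex.real_smul]; ring
  cont := by unfold evalC; fun_prop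

/-- The continuity of `T` on the test functions supported in a compact set gives a bound by finitely
many derivatives; Leibniz' rule transfers it from `ρ g` to `g`. -/
theorem exists_isOrderBound_localize (T : 𝓓'(Ω, ℂ)) (ρ : 𝓓(Ω, ℂ)) :
    ∃ L C, IsOrderBound (localize T ρ) (tsupport ρ) L C := by
  set Φ := evalSupported T (K := compactSupport ρ) ρ.tsupport_subset
  have hcont : Continuous ((normSeminorm ℝ ℂ).comp Φ.toLinearMap) := by
    exact continuous_norm.comp Φ.continuous
  obtain ⟨s, C, -, h⟩ := Seminorm.bound_of_continuous
    (ContDiffMapSupportedIn.withSeminorms ℝ (Eucl d) ℂ ⊤ (compactSupport ρ)) _ hcont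
  obtain ⟨A, hA0, hA⟩ := exists_bound_iteratedFDeriv_test ρ (s.sup id)
  refine ⟨s.sup id, C * (2 ^ (s.sup id) * A), by positivity, fun g B hB hg ↦ ?_⟩
  have h1 : ‖Φ (mulSupportedLM ρ g)‖ ≤ _ := h (mulSupportedLM ρ g)
  have h2 : localize T ρ g = Φ (mulSupportedLM ρ g) := rfl
  rw [h2]
  refine h1.trans ?_
  rw [smul_apply, NNReal.smul_def, smul_eq_mul, mul_assoc]
  refine mul_le_mul_of_nonneg_left ?_ C.2
  refine Seminorm.finset_sup_apply_le (by positivity) fun i hi ↦ ?_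
  have hi' : i ≤ s.sup id := Finset.le_sup (f := id) hi
  refine (ContDiffMapSupportedIn.seminorm_top_le_iff ℝ (by positivity) i _).2 fun x hx ↦ ?_
  have hx' : x ∈ tsupport ρ := hx
  refine (norm_iteratedFDeriv_mul_le_two_pow ρ.contDiff (g.smooth ⊤)
    (fun j hj ↦ hA j (hj.trans hi') x) (fun j hj ↦ hg j (hj.trans hi') x hx')).trans ?_
  rw [mul_assoc]
  gcongr
  norm_num

/-! ### Dilates, reflections and their derivatives -/

theorem dilate_eq_smul {y : ℝ} (hy : y ≠ 0) (f : 𝓢(Eucl d, ℂ)) :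
    (dilate y f : Eucl d → ℂ) = fun x ↦ ((y ^ d)⁻¹ : ℝ) • f (y⁻¹ • x) :=
  funext (dilate_apply hy f)

theorem iteratedFDeriv_dilate {y : ℝ} (hy : y ≠ 0) (f : 𝓢(Eucl d, ℂ)) (n : ℕ) (z : Eucl d) :
    iteratedFDeriv ℝ n (dilate y f) z =
      ((y ^ d)⁻¹ * y⁻¹ ^ n) • iteratedFDeriv ℝ n f (y⁻¹ • z) := by
  have hf : ContDiff ℝ n f := f.smooth n
  rw [dilate_eq_smul hy]
  rw [iteratedFDeriv_const_smul_apply' (f := fun x ↦ f (y⁻¹ • x))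
    (ContDiff.contDiffAt (by fun_prop))]
  rw [iteratedFDeriv_comp_const_smul _ hf, smul_smul]

theorem iteratedFDeriv_reflectAt (x : Eucl d) (f : 𝓢(Eucl d, ℂ)) (n : ℕ) (z : Eucl d) :
    iteratedFDeriv ℝ n (reflectAt x f) z = (-1 : ℝ) ^ n • iteratedFDeriv ℝ n f (x - z) := by
  have hf : ContDiff ℝ n f := f.smooth n
  have h : (reflectAt x f : Eucl d → ℂ) = fun z ↦ (fun w ↦ f (x + w)) ((-1 : ℝ) • z) := by
    ext z; simp [reflectAt_apply, sub_eq_add_neg]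
  rw [h, iteratedFDeriv_comp_const_smul (-1 : ℝ) (f := fun w ↦ f (x + w)) (by fun_prop),
    iteratedFDeriv_comp_add_left']
  simp [sub_eq_add_neg]

theorem norm_iteratedFDeriv_reflectAt (x : Eucl d) (f : 𝓢(Eucl d, ℂ)) (n : ℕ) (z : Eucl d) :
    ‖iteratedFDeriv ℝ n (reflectAt x f) z‖ = ‖iteratedFDeriv ℝ n f (x - z)‖ := by
  rw [iteratedFDeriv_reflectAt, norm_smul]; simp

theorem norm_iteratedFDeriv_dilate {y : ℝ} (hy : 0 < y) (f : 𝓢(Eucl d, ℂ)) (n : ℕ) (z : Eucl d) :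
    ‖iteratedFDeriv ℝ n (dilate y f) z‖ =
      (y ^ (d + n))⁻¹ * ‖iteratedFDeriv ℝ n f (y⁻¹ • z)‖ := by
  rw [iteratedFDeriv_dilate hy.ne', norm_smul, pow_add, mul_inv, inv_pow, Real.norm_of_nonneg]
  positivity

theorem dilate_dilate {y t : ℝ} (hy : y ≠ 0) (ht : t ≠ 0) (f : 𝓢(Eucl d, ℂ)) :
    dilate y (dilate t f) = dilate (y * t) f := by
  ext x
  rw [dilate_apply hy, dilate_apply ht, dilate_apply (mul_ne_zero hy ht), smul_smul, smul_smul,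
    mul_pow, mul_inv, mul_inv, mul_comm t⁻¹]

theorem dilate_add (y : ℝ) (f g : 𝓢(Eucl d, ℂ)) : dilate y (f + g) = dilate y f + dilate y g := by
  by_cases hy : y = 0
  · simp [dilate, hy]
  · ext x; simp [dilate_apply hy]

theorem dilate_sum {ι : Type*} (s : Finset ι) (y : ℝ) (f : ι → 𝓢(Eucl d, ℂ)) :
    dilate y (∑ i ∈ s, f i) = ∑ i ∈ s, dilate y (f i) :=
  map_sum (AddMonoidHom.mk' (dilate (d := d) y) (dilate_add y)) f s

theorem reflectAt_add (x : Eucl d) (f g : 𝓢(Eucl d, ℂ)) :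
    reflectAt x (f + g) = reflectAt x f + reflectAt x g := by
  ext z; simp [reflectAt_apply]

theorem conv_add (u : 𝓢'(Eucl d, ℂ)) (f g : 𝓢(Eucl d, ℂ)) (x : Eucl d) :
    conv u (f + g) x = conv u f x + conv u g x := by
  rw [conv, reflectAt_add, map_add]; rfl

theorem conv_sum {ι : Type*} (s : Finset ι) (u : 𝓢'(Eucl d, ℂ)) (f : ι → 𝓢(Eucl d, ℂ))
    (x : Eucl d) : conv u (∑ i ∈ s, f i) x = ∑ i ∈ s, conv u (f i) x :=
  map_sum (AddMonoidHom.mk' (fun f ↦ conv u f x) fun f g ↦ conv_add u f g x) f s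

/-- Schwartz functions and their derivatives decay faster than any power. -/
theorem exists_decay {F : Type*} [NormedAddCommGroup F] [NormedSpace ℝ F]
    (f : 𝓢(Eucl d, F)) (N n : ℕ) :
    ∃ C, 0 ≤ C ∧ ∀ j ≤ n, ∀ x, ‖iteratedFDeriv ℝ j f x‖ ≤ C * ((1 + ‖x‖) ^ N)⁻¹ := by
  refine ⟨2 ^ N * (Finset.Iic (N, n)).sup (fun m ↦ SchwartzMap.seminorm ℝ m.1 m.2) f,
    by positivity, fun j hj x ↦ ?_⟩
  have := SchwartzMap.one_add_le_sup_seminorm_apply (𝕜 := ℝ) (m := (N, n)) le_rfl hj f x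
  rw [le_mul_inv_iff₀ (by positivity), mul_comm]
  exact this

theorem inv_one_add_norm_add_le (a b : Eucl d) (N : ℕ) :
    ((1 + ‖a + b‖) ^ N)⁻¹ ≤ ((1 + ‖a‖) ^ N)⁻¹ * (1 + ‖b‖) ^ N := by
  rw [← div_eq_inv_mul, le_div_iff₀ (by positivity), inv_mul_le_iff₀ (by positivity), ← mul_pow]
  gcongr
  have : ‖a‖ ≤ ‖a + b‖ + ‖b‖ := by simpa using norm_sub_le (a + b) b
  nlinarith [norm_nonneg (a + b), norm_nonneg b]

/-! ### Convolution of a compactly supported distribution with a Schwartz function -/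

theorem IsOrderBound.norm_conv_le {u : 𝓢'(Eucl d, ℂ)} {K : Set (Eucl d)} {L : ℕ} {C : ℝ}
    (hu : IsOrderBound u K L C) {f : 𝓢(Eucl d, ℂ)} {x : Eucl d} {B : ℝ} (hB : 0 ≤ B)
    (h : ∀ l ≤ L, ∀ z ∈ K, ‖iteratedFDeriv ℝ l f (x - z)‖ ≤ B) : ‖conv u f x‖ ≤ C * B := by
  refine hu.2 _ B hB fun l hl z hz ↦ ?_
  rw [norm_iteratedFDeriv_reflectAt]
  exact h l hl z hz

/-- `u * f_y` grows at most like a power of `1 / y`. -/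
theorem IsOrderBound.exists_norm_conv_dilate_le {u : 𝓢'(Eucl d, ℂ)} {K : Set (Eucl d)} {L : ℕ}
    {C : ℝ} (hu : IsOrderBound u K L C) (f : 𝓢(Eucl d, ℂ)) :
    ∃ C', 0 ≤ C' ∧ ∀ y ∈ Ioc (0 : ℝ) 1, ∀ x,
      ‖conv u (dilate y f) x‖ ≤ C' * (y ^ (d + L))⁻¹ := by
  obtain ⟨A, hA0, hA⟩ := exists_bound_iteratedFDeriv f L
  refine ⟨C * A, mul_nonneg hu.1 hA0, fun y hy x ↦ ?_⟩
  have hy0 := hy.1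
  rw [mul_assoc]
  refine hu.norm_conv_le (by positivity) fun l hl z _ ↦ ?_
  rw [norm_iteratedFDeriv_dilate hy.1, mul_comm]
  refine mul_le_mul (hA l hl _) ?_ (by positivity) hA0
  exact inv_anti₀ (by positivity) (pow_le_pow_of_le_one hy.1.le hy.2 (by omega))

/-- If `u` has bounded support, then `u * f` decays faster than any power. -/
theorem IsOrderBound.exists_norm_conv_le_decay {u : 𝓢'(Eucl d, ℂ)} {K : Set (Eucl d)} {L : ℕ}
    {C : ℝ} (hu : IsOrderBound u K L C) (f : 𝓢(Eucl d, ℂ)) {R : ℝ} (hR : ∀ z ∈ K, ‖z‖ ≤ R) (N : ℕ) :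
    ∃ C', 0 ≤ C' ∧ ∀ x, ‖conv u f x‖ ≤ C' * ((1 + ‖x‖) ^ N)⁻¹ := by
  obtain ⟨A, hA0, hA⟩ := exists_decay f N L
  refine ⟨C * (A * (1 + |R|) ^ N), mul_nonneg hu.1 (by positivity), fun x ↦ ?_⟩
  rw [mul_assoc]
  refine hu.norm_conv_le (by positivity) fun l hl z hz ↦ (hA l hl _).trans ?_
  rw [mul_assoc]
  gcongr
  rw [sub_eq_add_neg, mul_comm]
  refine (inv_one_add_norm_add_le x (-z) N).trans ?_
  rw [norm_neg]
  have : ‖z‖ ≤ |R| := (hR z hz).trans (le_abs_self R)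
  gcongr

/-- The second order Taylor estimate, uniformly for a function and its derivatives. -/
theorem exists_norm_iteratedFDeriv_taylor_le (l : ℕ) :
    ∀ {V : Type} [NormedAddCommGroup V] [NormedSpace ℝ V] (f : 𝓢(Eucl d, V)), ∃ A, 0 ≤ A ∧
      ∀ h w, ‖iteratedFDeriv ℝ l (fun w ↦ f (w + h) - f w - fderiv ℝ f w h) w‖ ≤ A * ‖h‖ ^ 2 := by
  induction l with
  | zero =>
    intro V _ _ f
    obtain ⟨A, hA0, hA⟩ := exists_bound_iteratedFDeriv (SchwartzMap.fderivCLM ℝ _ _ f) 1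
    refine ⟨A, hA0, fun h w ↦ ?_⟩
    rw [norm_iteratedFDeriv_zero, pow_two, ← mul_assoc]
    have hd : Differentiable ℝ (fderiv ℝ f) := by
      have := (SchwartzMap.fderivCLM ℝ _ _ f).differentiable
      exact this
    have hfd (x : Eucl d) (hx : x ∈ Metric.closedBall w ‖h‖) :
        ‖fderiv ℝ f x - fderiv ℝ f w‖ ≤ A * ‖h‖ := by
      have h1 := Convex.norm_image_sub_le_of_norm_fderiv_le (𝕜 := ℝ) (f := fderiv ℝ f) (C := A)
        (s := univ) (x := w) (y := x) (fun x _ ↦ hd x) (fun x _ ↦ ?_) convex_univ (mem_univ _)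
        (mem_univ _)
      · refine h1.trans ?_
        gcongr
        simpa [dist_eq_norm] using hx
      · rw [← norm_iteratedFDeriv_one]
        exact hA 1 le_rfl x
    have := Convex.norm_image_sub_le_of_norm_fderiv_le' (𝕜 := ℝ) (f := f) (C := A * ‖h‖)
      (φ := fderiv ℝ f w) (s := Metric.closedBall w ‖h‖) (x := w) (y := w + h)
      (fun x _ ↦ f.differentiableAt) hfd (convex_closedBall _ _) (by simp) (by simp)
    simpa using this
  | succ l ih =>
    intro V _ _ f
    obtain ⟨A, hA0, hA⟩ := ih (SchwartzMap.fderivCLM ℝ _ _ f)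
    refine ⟨A, hA0, fun h w ↦ ?_⟩
    rw [← norm_iteratedFDeriv_fderiv]
    have hd : Differentiable ℝ (fderiv ℝ f) := by
      have := (SchwartzMap.fderivCLM ℝ _ _ f).differentiable
      exact this
    have hfun : fderiv ℝ (fun w ↦ f (w + h) - f w - fderiv ℝ f w h) = fun w ↦
        SchwartzMap.fderivCLM ℝ _ _ f (w + h) - SchwartzMap.fderivCLM ℝ _ _ f w -
          fderiv ℝ (SchwartzMap.fderivCLM ℝ _ _ f) w h := by
      ext w k
      have hf := f.differentiable
      rw [fderiv_fun_sub (by fun_prop) (by fun_prop), fderiv_fun_sub (by fun_prop) (by fun_prop),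
        fderiv_comp_add_right]
      -- the second derivative is symmetric
      have hsymm : fderiv ℝ (fun w ↦ fderiv ℝ f w h) w k = fderiv ℝ (fderiv ℝ f) w h k := by
        rw [fderiv_clm_apply (hd w) (by fun_prop)]
        have := (f.contDiffAt 2 (x := w)).isSymmSndFDerivAt
          (by rw [minSmoothness_of_isRCLikeNormedField]; rfl)
        simpa using this k h
      have hS : (SchwartzMap.fderivCLM ℝ (Eucl d) V f : Eucl d → _) = fderiv ℝ f := rfl
      simp only [sub_apply, hsymm, hS]
    rw [hfun]
    exact hA h w

theorem lineDeriv_eq_sum (f : 𝓢(Eucl d, ℂ)) (h : Eucl d) :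
    ∂_{h} f = ∑ i, (h i) • ∂_{EuclideanSpace.single i (1 : ℝ)} f := by
  have hh : h = ∑ i, (h i) • EuclideanSpace.single i (1 : ℝ) := by
    simpa using ((EuclideanSpace.basisFun (Fin d) ℝ).sum_repr h).symm
  conv_lhs => rw [hh]
  simp only [LineDeriv.lineDerivOp_left_sum, LineDeriv.lineDerivOp_left_smul]

theorem conv_smul (u : 𝓢'(Eucl d, ℂ)) (c : ℝ) (f : 𝓢(Eucl d, ℂ)) (x : Eucl d) :
    conv u (c • f) x = c • conv u f x := by
  have : reflectAt x (c • f) = (c : ℂ) • reflectAt x f := by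
    ext z; simp [reflectAt_apply]
  rw [conv, this, map_smul]; simp [conv]

/-- The derivative of `u * f`, written as a continuous linear map. -/
noncomputable def convDeriv (u : 𝓢'(Eucl d, ℂ)) (f : 𝓢(Eucl d, ℂ)) (x : Eucl d) :
    Eucl d →L[ℝ] ℂ :=
  ∑ i, (EuclideanSpace.proj i : Eucl d →L[ℝ] ℝ).smulRight
    (conv u (∂_{EuclideanSpace.single i (1 : ℝ)} f) x)

theorem convDeriv_apply (u : 𝓢'(Eucl d, ℂ)) (f : 𝓢(Eucl d, ℂ)) (x h : Eucl d) :
    convDeriv u f x h = conv u (∂_{h} f) x := by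
  rw [lineDeriv_eq_sum, conv_sum]
  simp [convDeriv, conv_smul]

theorem IsOrderBound.hasFDerivAt_conv {u : 𝓢'(Eucl d, ℂ)} {K : Set (Eucl d)} {L : ℕ} {C : ℝ}
    (hu : IsOrderBound u K L C) (f : 𝓢(Eucl d, ℂ)) (x : Eucl d) :
    HasFDerivAt (conv u f) (convDeriv u f x) x := by
  choose A hA0 hA using fun l ↦ exists_norm_iteratedFDeriv_taylor_le (d := d) l f
  set A' := ∑ l ∈ Finset.range (L + 1), A l
  have hA' (l) (hl : l ≤ L) : A l ≤ A' :=
    Finset.single_le_sum (f := A) (fun j _ ↦ hA0 j) (Finset.mem_range.2 (by omega))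
  have hA'0 : 0 ≤ A' := (hA0 0).trans (hA' 0 (Nat.zero_le _))
  have key (h : Eucl d) :
      ‖conv u f (x + h) - conv u f x - convDeriv u f x h‖ ≤ C * (A' * ‖h‖ ^ 2) := by
    let r : 𝓢(Eucl d, ℂ) := SchwartzMap.compSubConstCLM ℝ (-h) f - f - ∂_{h} f
    have hr : (r : Eucl d → ℂ) = fun w ↦ f (w + h) - f w - fderiv ℝ f w h := by
      ext w
      simp [r, SchwartzMap.lineDerivOp_apply_eq_fderiv]
    have hc : conv u f (x + h) - conv u f x - convDeriv u f x h = conv u r x := by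
      rw [convDeriv_apply, conv, conv, conv, conv, ← map_sub, ← map_sub]
      congr 1
      ext z
      simp only [r, reflectAt_apply, sub_apply, SchwartzMap.compSubConstCLM_apply]
      congr 3
      abel
    rw [hc]
    refine hu.norm_conv_le (by positivity) fun l hl z _ ↦ ?_
    rw [hr]
    exact (hA l h _).trans (by gcongr; exact hA' l hl)
  rw [hasFDerivAt_iff_isLittleO_nhds_zero]
  refine Asymptotics.IsBigO.trans_isLittleO (g := fun h : Eucl d ↦ ‖h‖ ^ 2) ?_ ?_
  · refine Asymptotics.IsBigO.of_bound (C * A') (Eventually.of_forall fun h ↦ ?_)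
    rw [mul_assoc]
    simpa using key h
  · exact Asymptotics.isLittleO_norm_pow_id one_lt_two

theorem IsOrderBound.contDiff_conv {u : 𝓢'(Eucl d, ℂ)} {K : Set (Eucl d)} {L : ℕ} {C : ℝ}
    (hu : IsOrderBound u K L C) (f : 𝓢(Eucl d, ℂ)) : ContDiff ℝ (⊤ : ℕ∞) (conv u f) := by
  refine contDiff_infty.2 fun n ↦ ?_
  induction n generalizing f with
  | zero => exact contDiff_zero.2 (continuous_iff_continuousAt.2
      fun x ↦ (hu.hasFDerivAt_conv f x).continuousAt)
  | succ n ih =>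
    refine contDiff_succ_iff_hasFDerivAt.2 ⟨convDeriv u f, ?_, hu.hasFDerivAt_conv f⟩
    refine ContDiff.sum fun i _ ↦ ?_
    exact ContDiff.smulRight contDiff_const (ih _)

theorem IsOrderBound.continuous_conv {u : 𝓢'(Eucl d, ℂ)} {K : Set (Eucl d)} {L : ℕ} {C : ℝ}
    (hu : IsOrderBound u K L C) (f : 𝓢(Eucl d, ℂ)) : Continuous (conv u f) :=
  (hu.contDiff_conv f).continuous

theorem IsOrderBound.iteratedFDeriv_conv {u : 𝓢'(Eucl d, ℂ)} {K : Set (Eucl d)} {L : ℕ} {C : ℝ}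
    (hu : IsOrderBound u K L C) (f : 𝓢(Eucl d, ℂ)) {n : ℕ} (v : Fin n → Eucl d) (x : Eucl d) :
    iteratedFDeriv ℝ n (conv u f) x v = conv u (∂^{v} f) x := by
  induction n generalizing x with
  | zero => simp
  | succ n ih =>
    rw [LineDeriv.iteratedLineDerivOp_succ_left, iteratedFDeriv_succ_apply_left,
      ← fderiv_continuousMultilinear_apply_const_apply]
    · simp only [ih]
      rw [(hu.hasFDerivAt_conv _ x).fderiv, convDeriv_apply]
    · exact (hu.contDiff_conv f).differentiable_iteratedFDeriv (mod_cast ENat.natCast_lt_top n) x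

theorem iteratedLineDeriv_dilate {y : ℝ} (hy : y ≠ 0) (f : 𝓢(Eucl d, ℂ)) {n : ℕ}
    (v : Fin n → Eucl d) : ∂^{v} (dilate y f) = (y⁻¹ ^ n) • dilate y (∂^{v} f) := by
  ext x
  rw [SchwartzMap.iteratedLineDerivOp_eq_iteratedFDeriv, iteratedFDeriv_dilate hy, smul_apply,
    smul_apply, dilate_apply hy, SchwartzMap.iteratedLineDerivOp_eq_iteratedFDeriv, smul_smul,
    mul_comm]

theorem IsOrderBound.iteratedFDeriv_conv_dilate {u : 𝓢'(Eucl d, ℂ)} {K : Set (Eucl d)} {L : ℕ}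
    {C : ℝ} (hu : IsOrderBound u K L C) (f : 𝓢(Eucl d, ℂ)) {n : ℕ} (v : Fin n → Eucl d)
    (x : Eucl d) {y : ℝ} (hy : y ≠ 0) :
    iteratedFDeriv ℝ n (conv u (dilate y f)) x v = (y⁻¹ ^ n) • conv u (dilate y (∂^{v} f)) x := by
  rw [hu.iteratedFDeriv_conv, iteratedLineDeriv_dilate hy, conv_smul]

theorem IsOrderBound.continuousOn_conv_dilate {u : 𝓢'(Eucl d, ℂ)} {K : Set (Eucl d)} {L : ℕ}
    {C : ℝ} (hu : IsOrderBound u K L C) (hK : IsCompact K) (f : 𝓢(Eucl d, ℂ)) :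
    ContinuousOn (fun p : ℝ × Eucl d ↦ conv u (dilate p.1 f) p.2) (Ioi 0 ×ˢ univ) := by
  intro q hq
  rw [ContinuousWithinAt, Metric.tendsto_nhds]
  intro e he
  set B := e / (2 * (C + 1))
  have hC := hu.1
  have hB : 0 < B := by positivity
  let H (l : ℕ) (p : ℝ × Eucl d) (z : Eucl d) :=
    iteratedFDeriv ℝ l (reflectAt p.2 (dilate p.1 f)) z
  have hH (l : ℕ) : ContinuousOn (Function.uncurry (H l)) ((Ioi 0 ×ˢ univ) ×ˢ K) := by
    have hc : Continuous (iteratedFDeriv ℝ l f) :=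
      (f.smooth ⊤).continuous_iteratedFDeriv (mod_cast le_top)
    have hne : ∀ P ∈ ((Ioi (0 : ℝ) ×ˢ (univ : Set (Eucl d))) ×ˢ K), P.1.1 ≠ 0 :=
      fun P hP ↦ (show (0 : ℝ) < P.1.1 from hP.1.1).ne'
    have hinv : ContinuousOn (fun P : (ℝ × Eucl d) × Eucl d ↦ P.1.1⁻¹)
        ((Ioi (0 : ℝ) ×ˢ (univ : Set (Eucl d))) ×ˢ K) :=
      ContinuousOn.inv₀ (by fun_prop) hne
    have hinvd : ContinuousOn (fun P : (ℝ × Eucl d) × Eucl d ↦ (P.1.1 ^ d)⁻¹)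
        ((Ioi (0 : ℝ) ×ˢ (univ : Set (Eucl d))) ×ˢ K) :=
      ContinuousOn.inv₀ (by fun_prop) fun P hP ↦ pow_ne_zero _ (hne P hP)
    have harg : ContinuousOn (fun P : (ℝ × Eucl d) × Eucl d ↦ P.1.1⁻¹ • (P.1.2 - P.2))
        ((Ioi (0 : ℝ) ×ˢ (univ : Set (Eucl d))) ×ˢ K) := hinv.smul (by fun_prop)
    have : ContinuousOn (fun P : (ℝ × Eucl d) × Eucl d ↦ (-1 : ℝ) ^ l •
        (((P.1.1 ^ d)⁻¹ * P.1.1⁻¹ ^ l) • iteratedFDeriv ℝ l f (P.1.1⁻¹ • (P.1.2 - P.2))))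
        ((Ioi 0 ×ˢ univ) ×ˢ K) :=
      ((hinvd.mul (hinv.pow l)).smul (hc.comp_continuousOn harg)).const_smul ((-1 : ℝ) ^ l)
    refine this.congr fun P hP ↦ ?_
    have hP0 : P.1.1 ≠ 0 := (show (0 : ℝ) < P.1.1 from hP.1.1).ne'
    simp only [H, Function.uncurry]
    rw [iteratedFDeriv_reflectAt, iteratedFDeriv_dilate hP0]
  have hev : ∀ᶠ p in 𝓝[Ioi 0 ×ˢ univ] q, ∀ l ∈ Finset.range (L + 1), ∀ z ∈ K,
      dist (H l p z) (H l q z) < B := by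
    refine (Finset.eventually_all _).2 fun l _ ↦ ?_
    obtain ⟨v, hv, h⟩ := hK.mem_uniformity_of_prod (hH l) hq (Metric.dist_mem_uniformity hB)
    filter_upwards [hv] with p hp z hz using h p hp z hz
  filter_upwards [hev] with p hp
  rw [dist_eq_norm, conv, conv, ← map_sub]
  refine (hu.2 _ B hB.le fun l hl z hz ↦ ?_).trans_lt ?_
  · have := hp l (Finset.mem_range.2 (by omega)) z hz
    rw [dist_eq_norm] at this
    refine le_trans (le_of_eq ?_) this.le
    simp only [H]
    rw [← iteratedFDeriv_sub_apply (SchwartzMap.contDiffAt _ l) (SchwartzMap.contDiffAt _ l)]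
    rfl
  · have : C * B < (2 * (C + 1)) * B := by gcongr; linarith
    exact this.trans_eq (by simp only [B]; field_simp)

/-! ### Convolution and integration against a distribution -/

/-- The convolution of two Schwartz functions. -/
noncomputable def sconv (f g : 𝓢(Eucl d, ℂ)) : 𝓢(Eucl d, ℂ) :=
  SchwartzMap.convolution (ContinuousLinearMap.mul ℂ ℂ) f g

theorem sconv_apply (f g : 𝓢(Eucl d, ℂ)) (x : Eucl d) :
    sconv f g x = ∫ t, f t * g (x - t) := by
  rw [sconv, SchwartzMap.convolution_apply, convolution_def]; rfl

theorem sconv_comm (f g : 𝓢(Eucl d, ℂ)) : sconv f g = sconv g f := by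
  ext x
  rw [sconv_apply, sconv_apply, ← integral_sub_left_eq_self _ volume x]
  simp [mul_comm]

theorem fourier_sconv (f g : 𝓢(Eucl d, ℂ)) (ξ : Eucl d) :
    FourierTransform.fourier (sconv f g) ξ =
      FourierTransform.fourier f ξ * FourierTransform.fourier g ξ := by
  rw [sconv, SchwartzMap.fourier_convolution, SchwartzMap.pairing_apply_apply]; rfl

theorem schwartz_ext_fourier {f g : 𝓢(Eucl d, ℂ)}
    (h : ∀ ξ, FourierTransform.fourier f ξ = FourierTransform.fourier g ξ) : f = g := by
  have : FourierTransform.fourier f = FourierTransform.fourier g := SchwartzMap.ext h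
  exact (FourierTransform.fourierCLE ℂ 𝓢(Eucl d, ℂ)).injective this

theorem fourier_lineDeriv (m : Eucl d) (f : 𝓢(Eucl d, ℂ)) (ξ : Eucl d) :
    FourierTransform.fourier (∂_{m} f : 𝓢(Eucl d, ℂ)) ξ =
      (2 * Real.pi * Complex.I) * (inner ℝ ξ m : ℂ) * FourierTransform.fourier f ξ := by
  rw [SchwartzMap.fourier_lineDerivOp_eq, smul_apply,
    SchwartzMap.smulLeftCLM_apply_apply (by fun_prop)]
  simp [mul_assoc]

theorem lineDeriv_sconv (m : Eucl d) (f g : 𝓢(Eucl d, ℂ)) :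
    ∂_{m} (sconv f g) = sconv f (∂_{m} g) := by
  refine schwartz_ext_fourier fun ξ ↦ ?_
  rw [fourier_lineDeriv, fourier_sconv, fourier_sconv, fourier_lineDeriv]
  ring

theorem iteratedLineDeriv_sconv {n : ℕ} (v : Fin n → Eucl d) (f g : 𝓢(Eucl d, ℂ)) :
    ∂^{v} (sconv f g) = sconv f (∂^{v} g) := by
  induction n with
  | zero => simp
  | succ n ih => simp only [LineDeriv.iteratedLineDerivOp_succ_left, ih, lineDeriv_sconv]

theorem iteratedFDeriv_sconv {n : ℕ} (v : Fin n → Eucl d) (f g : 𝓢(Eucl d, ℂ)) (x : Eucl d) :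
    iteratedFDeriv ℝ n (sconv f g) x v = ∫ t, f t * iteratedFDeriv ℝ n g (x - t) v := by
  rw [← SchwartzMap.iteratedLineDerivOp_eq_iteratedFDeriv, iteratedLineDeriv_sconv, sconv_apply]
  simp_rw [SchwartzMap.iteratedLineDerivOp_eq_iteratedFDeriv]

theorem integral_dilate_mul {y : ℝ} (hy : 0 < y) (f : 𝓢(Eucl d, ℂ)) (h : Eucl d → ℂ) :
    ∫ t, dilate y f t * h t = ∫ t, f t * h (y • t) := by
  have h1 := Measure.integral_comp_smul (volume : Measure (Eucl d))
    (fun t ↦ dilate y f t * h t) y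
  have h2 : (fun t ↦ dilate y f (y • t) * h (y • t)) =
      fun t ↦ ((y ^ d)⁻¹ : ℝ) • (f t * h (y • t)) := by
    ext t
    rw [dilate_apply hy.ne', smul_smul, inv_mul_cancel₀ hy.ne', one_smul, smul_mul_assoc]
  rw [h2, integral_smul, finrank_euclideanSpace, Fintype.card_fin,
    abs_of_pos (by positivity)] at h1
  exact (smul_right_injective ℂ (by positivity : ((y ^ d)⁻¹ : ℝ) ≠ 0) h1).symm

theorem dilate_sconv {y : ℝ} (hy : 0 < y) (f g : 𝓢(Eucl d, ℂ)) :
    dilate y (sconv f g) = sconv (dilate y f) (dilate y g) := by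
  ext x
  rw [sconv_apply, integral_dilate_mul hy, dilate_apply hy.ne', sconv_apply, ← integral_smul]
  congr with t
  rw [dilate_apply hy.ne', smul_sub, smul_smul, inv_mul_cancel₀ hy.ne', one_smul]
  simp; ring

/-! ### Distributions of finite order as functionals on jets -/

section HahnBanach

/-- The Banach space of the `C^L` jets on a compact set `K`: families of continuous functions on
`K`, one for each order of differentiation up to `L`. -/
def JetSpace (K : Set (Eucl d)) (L : ℕ) : Type :=
  (l : Fin (L + 1)) → C(K, Eucl d [×(l : ℕ)]→L[ℝ] ℂ)

variable {K : Set (Eucl d)} {L : ℕ} [CompactSpace K]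

noncomputable instance : NormedAddCommGroup (JetSpace K L) :=
  inferInstanceAs (NormedAddCommGroup ((l : Fin (L + 1)) → C(K, Eucl d [×(l : ℕ)]→L[ℝ] ℂ)))

noncomputable instance : NormedSpace ℂ (JetSpace K L) :=
  inferInstanceAs (NormedSpace ℂ ((l : Fin (L + 1)) → C(K, Eucl d [×(l : ℕ)]→L[ℝ] ℂ)))

instance : CompleteSpace (JetSpace K L) :=
  inferInstanceAs (CompleteSpace ((l : Fin (L + 1)) → C(K, Eucl d [×(l : ℕ)]→L[ℝ] ℂ)))

theorem continuous_iteratedFDeriv_schwartz (g : 𝓢(Eucl d, ℂ)) (l : ℕ) :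
    Continuous (iteratedFDeriv ℝ l g) :=
  (g.smooth ⊤).continuous_iteratedFDeriv (mod_cast le_top)

/-- The jet of a Schwartz function on `K`. -/
noncomputable def jet (K : Set (Eucl d)) (L : ℕ) [CompactSpace K] : 𝓢(Eucl d, ℂ) →ₗ[ℂ] JetSpace K L where
  toFun g l := ⟨fun z ↦ iteratedFDeriv ℝ l g z,
    (continuous_iteratedFDeriv_schwartz g l).comp continuous_subtype_val⟩
  map_add' f g := by
    funext l
    ext z : 1
    exact iteratedFDeriv_add_apply (f.contDiffAt l) (g.contDiffAt l)
  map_smul' c g := by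
    funext l
    ext z : 1
    exact iteratedFDeriv_const_smul_apply (a := c) (g.contDiffAt l)

theorem jet_apply (g : 𝓢(Eucl d, ℂ)) (l : Fin (L + 1)) (z : K) :
    jet K L g l z = iteratedFDeriv ℝ l g z := rfl

/-- A distribution of order `L` with support in `K` is a continuous functional of the jets
on `K`, by the Hahn-Banach theorem. -/
theorem IsOrderBound.exists_functional {u : 𝓢'(Eucl d, ℂ)} {C : ℝ} (hu : IsOrderBound u K L C) :
    ∃ Λ : JetSpace K L →L[ℂ] ℂ, ∀ g, Λ (jet K L g) = u g := by
  have hbound (g : 𝓢(Eucl d, ℂ)) : ‖u g‖ ≤ C * ‖jet K L g‖ := by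
    refine hu.2 g _ (norm_nonneg _) fun l hl z hz ↦ ?_
    have h1 := (jet K L g ⟨l, by omega⟩).norm_coe_le_norm ⟨z, hz⟩
    exact h1.trans (norm_le_pi_norm
      (show (l : Fin (L + 1)) → C(K, Eucl d [×(l : ℕ)]→L[ℝ] ℂ) from jet K L g) ⟨l, by omega⟩)
  obtain ⟨s, hs⟩ := LinearMap.exists_rightInverse_of_surjective (jet K L).rangeRestrict
    (LinearMap.range_rangeRestrict _)
  have hs' (x : LinearMap.range (jet K L)) : jet K L (s x) = x :=
    congrArg Subtype.val (LinearMap.congr_fun hs x)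
  let f : LinearMap.range (jet K L) →L[ℂ] ℂ :=
    LinearMap.mkContinuous ((u : 𝓢(Eucl d, ℂ) →ₗ[ℂ] ℂ).comp s) C fun x ↦ by
      have := hbound (s x)
      rw [hs'] at this
      exact this
  obtain ⟨Λ, hΛ, -⟩ := exists_extension_norm_eq _ f
  refine ⟨Λ, fun g ↦ ?_⟩
  have h1 := hΛ ⟨jet K L g, LinearMap.mem_range_self _ g⟩
  have h2 : u (s ⟨jet K L g, LinearMap.mem_range_self _ g⟩ - g) = 0 := by
    have := hbound (s ⟨jet K L g, LinearMap.mem_range_self _ g⟩ - g)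
    rw [map_sub (jet K L), hs', sub_self, norm_zero, mul_zero] at this
    exact norm_le_zero_iff.1 this
  rw [map_sub, sub_eq_zero] at h2
  rw [← h2]
  exact h1

theorem norm_jet_le {g : 𝓢(Eucl d, ℂ)} {A : ℝ} (hA0 : 0 ≤ A)
    (hA : ∀ l ≤ L, ∀ z, ‖iteratedFDeriv ℝ l g z‖ ≤ A) : ‖jet K L g‖ ≤ A := by
  refine (pi_norm_le_iff_of_nonneg
    (x := (show (l : Fin (L + 1)) → C(K, Eucl d [×(l : ℕ)]→L[ℝ] ℂ) from jet K L g)) hA0).2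
    fun l ↦ (ContinuousMap.norm_le _ hA0).2 fun z ↦ ?_
  exact hA l (by omega) z

/-- The evaluation of a jet. -/
noncomputable def JetSpace.eval (l : Fin (L + 1)) (z : K) (v : Fin l → Eucl d) :
    JetSpace K L →L[ℝ] ℂ :=
  (ContinuousMultilinearMap.apply ℝ (fun _ : Fin l ↦ Eucl d) ℂ v).comp
    ((ContinuousMap.evalCLM ℝ z).comp (ContinuousLinearMap.proj
      (φ := fun l : Fin (L + 1) ↦ C(K, Eucl d [×(l : ℕ)]→L[ℝ] ℂ)) l))

theorem JetSpace.eval_apply (l : Fin (L + 1)) (z : K) (v : Fin l → Eucl d) (j : JetSpace K L) :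
    JetSpace.eval l z v j = j l z v := rfl

theorem continuous_jet_reflectAt (f : 𝓢(Eucl d, ℂ)) :
    Continuous fun s ↦ jet K L (reflectAt s f) := by
  have h (l : Fin (L + 1)) : Continuous fun s ↦ jet K L (reflectAt s f) l := by
    refine ContinuousMap.continuous_of_continuous_uncurry _ ?_
    have hc := continuous_iteratedFDeriv_schwartz f l
    have : (Function.uncurry fun (s : Eucl d) (z : K) ↦ jet K L (reflectAt s f) l z) =
        fun p ↦ (-1 : ℝ) ^ (l : ℕ) • iteratedFDeriv ℝ l f (p.1 - p.2) := by
      ext1 p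
      exact iteratedFDeriv_reflectAt _ _ _ _
    rw [this]
    have hc' := hc.comp (f := fun p : Eucl d × K ↦ p.1 - p.2) (by fun_prop)
    exact hc'.const_smul ((-1 : ℝ) ^ (l : ℕ))
  exact continuous_pi h

end HahnBanach

/-- Fubini's theorem for a compactly supported distribution and an integral. -/
theorem IsOrderBound.integral_mul_conv {u : 𝓢'(Eucl d, ℂ)} {K : Set (Eucl d)} {L : ℕ}
    {C : ℝ} (hu : IsOrderBound u K L C) (hK : IsCompact K) (g f : 𝓢(Eucl d, ℂ)) :
    ∫ s, g s * conv u f s = u (sconv g (reflectAt 0 f)) := by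
  have : CompactSpace K := isCompact_iff_compactSpace.1 hK
  obtain ⟨Λ, hΛ⟩ := hu.exists_functional
  set J : Eucl d → JetSpace K L := fun s ↦ jet K L (reflectAt s f)
  have hJc : Continuous J := continuous_jet_reflectAt f
  obtain ⟨A, hA0, hA⟩ := exists_bound_iteratedFDeriv f L
  have hJb (s) : ‖J s‖ ≤ A := norm_jet_le hA0 fun l hl z ↦ by
    rw [norm_iteratedFDeriv_reflectAt]
    exact hA l hl _
  have hint : Integrable fun s ↦ g s • J s :=
    g.integrable.smul_bdd A hJc.aestronglyMeasurable (Eventually.of_forall hJb)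
  have h1 : ∫ s, g s * conv u f s = Λ (∫ s, g s • J s) := by
    rw [← Λ.integral_comp_comm hint]
    congr with s
    rw [map_smul, hΛ]; rfl
  rw [h1, ← hΛ]
  congr 1
  funext l
  ext z v
  rw [← JetSpace.eval_apply, ← (JetSpace.eval l z v).integral_comp_comm hint, jet_apply,
    iteratedFDeriv_sconv]
  congr with s
  have h3 : JetSpace.eval l z v (g s • J s) =
    g s * iteratedFDeriv ℝ l (reflectAt s f) z v := rfl
  rw [h3, iteratedFDeriv_reflectAt, iteratedFDeriv_reflectAt]
  congr 4
  abel

/-- The associativity of the convolution, `u * (b * f) = b * (u * f)`. -/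
theorem IsOrderBound.conv_sconv {u : 𝓢'(Eucl d, ℂ)} {K : Set (Eucl d)} {L : ℕ}
    {C : ℝ} (hu : IsOrderBound u K L C) (hK : IsCompact K) (b f : 𝓢(Eucl d, ℂ)) (s : Eucl d) :
    conv u (sconv b f) s = ∫ z, b (s - z) * conv u f z := by
  have := hu.integral_mul_conv hK (reflectAt s b) f
  simp only [reflectAt_apply] at this
  rw [this, conv]
  congr 1
  ext z
  rw [reflectAt_apply, sconv_apply, sconv_apply, ← integral_sub_left_eq_self _ volume s]
  congr with t
  rw [reflectAt_apply, reflectAt_apply]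
  congr 2
  abel

/-- Approximate identities converge on distributions of compact support. -/
theorem IsOrderBound.tendsto_integral_mul_conv_dilate {u : 𝓢'(Eucl d, ℂ)} {K : Set (Eucl d)}
    {L : ℕ} {C : ℝ} (hu : IsOrderBound u K L C) (hK : IsCompact K) {f : 𝓢(Eucl d, ℂ)}
    (hf : ∫ x, f x = 1) (g : 𝓢(Eucl d, ℂ)) :
    Tendsto (fun y ↦ ∫ s, g s * conv u (dilate y f) s) (𝓝[>] 0) (𝓝 (u g)) := by
  obtain ⟨A, hA0, hA⟩ := exists_bound_iteratedFDeriv g (L + 1)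
  set I := ∫ t, ‖t‖ * ‖f t‖
  have hI0 : 0 ≤ I := integral_nonneg fun t ↦ by positivity
  have hfi : Integrable fun t ↦ ‖t‖ * ‖f t‖ := by simpa using f.integrable_pow_mul volume 1
  have key : ∀ y ∈ Ioi (0 : ℝ),
      ‖(∫ s, g s * conv u (dilate y f) s) - u g‖ ≤ C * (A * I) * y := by
    intro y hy
    have hy0 : 0 < y := hy
    rw [hu.integral_mul_conv hK, ← map_sub, mul_assoc]
    refine hu.2 _ _ (by positivity) fun l hl z _ ↦ ?_
    refine ContinuousMultilinearMap.opNorm_le_bound (by positivity) fun v ↦ ?_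
    have h1 : iteratedFDeriv ℝ l (sconv g (reflectAt 0 (dilate y f)) - g : 𝓢(Eucl d, ℂ)) z v =
        ∫ t, f t * (iteratedFDeriv ℝ l g (z + y • t) v - iteratedFDeriv ℝ l g z v) := by
      have hsub := iteratedFDeriv_sub_apply (x := z) (SchwartzMap.contDiffAt
        (sconv g (reflectAt 0 (dilate y f))) l) (SchwartzMap.contDiffAt g l)
      have : iteratedFDeriv ℝ l (sconv g (reflectAt 0 (dilate y f)) - g : 𝓢(Eucl d, ℂ)) z v =
          iteratedFDeriv ℝ l (sconv g (reflectAt 0 (dilate y f))) z v -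
            iteratedFDeriv ℝ l g z v := congrArg (fun B ↦ B v) hsub
      rw [this, sconv_comm, iteratedFDeriv_sconv]
      have h2 : ∫ t, reflectAt 0 (dilate y f) t * iteratedFDeriv ℝ l g (z - t) v =
          ∫ t, f t * iteratedFDeriv ℝ l g (z + y • t) v := by
        rw [← integral_dilate_mul hy0 f (fun t ↦ iteratedFDeriv ℝ l g (z + t) v),
          ← integral_neg_eq_self]
        congr with t
        simp [reflectAt_apply]
      have hcont : Continuous fun t ↦ iteratedFDeriv ℝ l g (z + y • t) v :=
        (ContinuousMultilinearMap.apply ℝ (fun _ : Fin l ↦ Eucl d) ℂ v).continuous.comp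
          ((continuous_iteratedFDeriv_schwartz g l).comp (by fun_prop))
      have hi : Integrable fun t ↦ f t * iteratedFDeriv ℝ l g (z + y • t) v :=
        f.integrable.mul_bdd (c := A * ∏ i, ‖v i‖) hcont.aestronglyMeasurable
          (Eventually.of_forall fun t ↦ (ContinuousMultilinearMap.le_opNorm _ _).trans (by
            gcongr; exact hA l (by omega) _))
      simp_rw [mul_sub]
      rw [h2, integral_sub hi (f.integrable.mul_const _), integral_mul_const, hf, one_mul]
    rw [h1]
    have hL (t) : ‖iteratedFDeriv ℝ l g (z + y • t) v - iteratedFDeriv ℝ l g z v‖ ≤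
        A * (y * ‖t‖) * ∏ i, ‖v i‖ := by
      refine (ContinuousMultilinearMap.le_opNorm
        (iteratedFDeriv ℝ l g (z + y • t) - iteratedFDeriv ℝ l g z) v).trans ?_
      gcongr
      have := Convex.norm_image_sub_le_of_norm_fderiv_le (𝕜 := ℝ) (f := iteratedFDeriv ℝ l g)
        (C := A) (s := univ) (x := z) (y := z + y • t)
        (fun x _ ↦ ((g.smooth ⊤).differentiable_iteratedFDeriv
          (mod_cast ENat.natCast_lt_top l)).differentiableAt)
        (fun x _ ↦ by rw [norm_fderiv_iteratedFDeriv]; exact hA _ (by omega) x)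
        convex_univ (mem_univ _) (mem_univ _)
      simpa [norm_smul, abs_of_pos hy0] using this
    calc _ ≤ ∫ t, A * y * (∏ i, ‖v i‖) * (‖t‖ * ‖f t‖) := by
          refine norm_integral_le_of_norm_le (hfi.const_mul _) (Eventually.of_forall fun t ↦ ?_)
          rw [norm_mul]
          calc _ ≤ ‖f t‖ * (A * (y * ‖t‖) * ∏ i, ‖v i‖) := by gcongr; exact hL t
            _ = _ := by ring
      _ = _ := by rw [integral_const_mul]; ring
  rw [tendsto_iff_norm_sub_tendsto_zero]
  refine squeeze_zero' (Eventually.of_forall fun y ↦ norm_nonneg _)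
    (eventually_nhdsWithin_of_forall key) ?_
  have : Tendsto (fun y : ℝ ↦ C * (A * I) * y) (𝓝 0) (𝓝 (C * (A * I) * 0)) := by
    exact tendsto_id.const_mul _
  rw [mul_zero] at this
  exact this.mono_left nhdsWithin_le_nhds

/-! ### Vanishing moments -/

/-- All moments of `f` of order less than `m` vanish, expressed as the vanishing of the derivatives
of the Fourier transform at the origin. -/
def HasVanishingMoments (m : ℕ) (f : 𝓢(Eucl d, ℂ)) : Prop :=
  ∀ j < m, iteratedFDeriv ℝ j (FourierTransform.fourier f : 𝓢(Eucl d, ℂ)) 0 = 0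

theorem iteratedFDeriv_fourier_zero_apply (f : 𝓢(Eucl d, ℂ)) {j : ℕ} (v : Fin j → Eucl d) :
    iteratedFDeriv ℝ j (FourierTransform.fourier f : 𝓢(Eucl d, ℂ)) 0 v =
      (-(2 * Real.pi * Complex.I)) ^ j * ∫ s, f s * ∏ l, ((inner ℝ s (v l) : ℝ) : ℂ) := by
  have h1 : Integrable (VectorFourier.fourierPowSMulRight (innerSL ℝ) (f : Eucl d → ℂ) · j) volume :=
    VectorFourier.integrable_fourierPowSMulRight (innerSL ℝ)
      (f.integrable_pow_mul volume j) f.continuous.aestronglyMeasurable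
  rw [SchwartzMap.fourier_coe, Real.iteratedFDeriv_fourier (N := ⊤)
    (fun n _ ↦ f.integrable_pow_mul volume n) f.continuous.aestronglyMeasurable (by exact_mod_cast le_top)]
  rw [Real.fourier_eq]
  simp only [inner_zero_right, neg_zero, AddChar.map_zero_eq_one, one_smul]
  rw [ContinuousMultilinearMap.integral_apply h1]
  simp only [VectorFourier.fourierPowSMulRight_apply, smul_eq_mul]
  rw [integral_const_mul]
  congr 2
  ext s
  rw [Complex.real_smul, mul_comm, Complex.ofReal_prod]
  rfl

/-- A linear combination of moments is a moment. -/
theorem HasVanishingMoments.integral_eq_zero {m : ℕ} {f : 𝓢(Eucl d, ℂ)}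
    (hf : HasVanishingMoments m f) {j : ℕ} (hj : j < m) (A : Eucl d [×j]→L[ℝ] ℂ) :
    ∫ s, f s * A (fun _ ↦ s) = 0 := by
  have hint (v : Fin j → Fin d) : Integrable (fun s : Eucl d ↦ f s * ∏ l, ((s (v l) : ℝ) : ℂ)) := by
    refine (f.integrable_pow_mul volume j).mono' (by fun_prop) (.of_forall fun s ↦ ?_)
    rw [norm_mul, norm_prod, mul_comm]
    gcongr
    refine (Finset.prod_le_prod (fun _ _ ↦ norm_nonneg _) (g := fun _ ↦ ‖s‖) fun l _ ↦ ?_).trans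
      (by simp)
    rw [Complex.norm_real]
    exact PiLp.norm_apply_le s (v l)
  have hA (s : Eucl d) : f s * A (fun _ ↦ s) = ∑ v : Fin j → Fin d,
      A (fun l ↦ EuclideanSpace.single (v l) (1 : ℝ)) * (f s * ∏ l, ((s (v l) : ℝ) : ℂ)) := by
    have hs : s = ∑ i, (s i) • EuclideanSpace.single i (1 : ℝ) := by
      simpa using ((EuclideanSpace.basisFun (Fin d) ℝ).sum_repr s).symm
    have : A (fun _ ↦ s) = ∑ v : Fin j → Fin d,
        (∏ l, s (v l)) • A (fun l ↦ EuclideanSpace.single (v l) (1 : ℝ)) := by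
      conv_lhs => rw [hs]
      rw [A.map_sum]
      simp_rw [A.map_smul_univ]
    rw [this, Finset.mul_sum]
    refine Finset.sum_congr rfl fun v _ ↦ ?_
    rw [Complex.real_smul, Complex.ofReal_prod]
    ring
  simp_rw [hA]
  rw [integral_finsetSum _ fun v _ ↦ (hint v).const_mul _]
  refine Finset.sum_eq_zero fun v _ ↦ ?_
  rw [integral_const_mul]
  have := iteratedFDeriv_fourier_zero_apply f (fun l ↦ EuclideanSpace.single (v l) (1 : ℝ))
  rw [hf j hj] at this
  have h2 : (-(2 * Real.pi * Complex.I)) ^ j ≠ 0 := by simp [Real.pi_ne_zero]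
  have h3 := (mul_eq_zero.1 this.symm).resolve_left h2
  simp only [EuclideanSpace.inner_single_right, one_mul, conj_trivial] at h3
  rw [h3, mul_zero]

theorem hasVanishingMoments_of_moment {m : ℕ} {f : 𝓢(Eucl d, ℂ)}
    (hf : ∀ α : Fin d → ℕ, ∑ i, α i < m → moment f α = 0) : HasVanishingMoments m f := by
  intro j hj
  refine ContinuousMultilinearMap.toMultilinearMap_injective ?_
  refine Module.Basis.ext_multilinear (fun _ ↦ (EuclideanSpace.basisFun (Fin d) ℝ).toBasis) fun v ↦ ?_
  have h := hf (fun i ↦ (Finset.univ.filter fun l ↦ v l = i).card) (by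
    rw [← Finset.card_eq_sum_card_fiberwise (f := v) (t := Finset.univ) (by simp)]; simpa using hj)
  have h2 := iteratedFDeriv_fourier_zero_apply f (fun l ↦ EuclideanSpace.single (v l) (1 : ℝ))
  have h3 : ∫ s, f s * ∏ l, ((inner ℝ s (EuclideanSpace.single (v l) (1 : ℝ)) : ℝ) : ℂ) = 0 := by
    rw [← h, moment]
    congr with s
    rw [mul_comm]
    congr 1
    simp only [EuclideanSpace.inner_single_right, one_mul, conj_trivial]
    rw [← Complex.ofReal_prod, ← Finset.prod_fiberwise (g := v)]
    congr 1
    refine Finset.prod_congr rfl fun i _ ↦ ?_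
    rw [Finset.prod_congr rfl (g := fun _ ↦ s i), Finset.prod_const]
    intro l hl
    rw [(Finset.mem_filter.1 hl).2]
  rw [h3, mul_zero] at h2
  simpa using h2

theorem hasVanishingMoments_of_eventuallyEq {f : 𝓢(Eucl d, ℂ)}
    (hf : ∀ᶠ ξ in 𝓝 0, (FourierTransform.fourier f : 𝓢(Eucl d, ℂ)) ξ = 0) (m : ℕ) :
    HasVanishingMoments m f := fun j _ ↦ by
  have := (Filter.EventuallyEq.iteratedFDeriv ℝ (f₁ := (FourierTransform.fourier f : 𝓢(Eucl d, ℂ)))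
    (f₂ := fun _ ↦ (0 : ℂ)) (x := 0) hf j).eq_of_nhds
  rw [this]
  exact congrFun iteratedFDeriv_fun_zero 0

/-- Each derivative raises the order of the vanishing moments by one. -/
theorem HasVanishingMoments.lineDeriv {m : ℕ} {f : 𝓢(Eucl d, ℂ)} (hf : HasVanishingMoments m f)
    (w : Eucl d) : HasVanishingMoments (m + 1) (∂_{w} f) := by
  intro j hj
  set g : Eucl d → ℂ := fun ξ ↦ (2 * Real.pi * Complex.I) * (inner ℝ ξ w : ℂ)
  have hg : ContDiff ℝ (⊤ : ℕ∞) g :=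
    contDiff_const.mul (Complex.ofRealCLM.contDiff.comp (contDiff_id.inner ℝ contDiff_const))
  have h : ((FourierTransform.fourier (∂_{w} f) : 𝓢(Eucl d, ℂ)) : Eucl d → ℂ) =
      fun ξ ↦ g ξ * (FourierTransform.fourier f : 𝓢(Eucl d, ℂ)) ξ := funext (fourier_lineDeriv w f)
  rw [h, ← norm_le_zero_iff]
  refine (norm_iteratedFDeriv_mul_le hg (SchwartzMap.smooth _ ⊤) 0
    (n := j) (by exact_mod_cast le_top)).trans ?_
  refine Finset.sum_nonpos fun i hi ↦ ?_
  rcases Nat.eq_zero_or_pos i with rfl | hi0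
  · simp [g]
  · have := Finset.mem_range.1 hi
    rw [hf (j - i) (by omega)]; simp

/-- A derivative of order `n` has vanishing moments of all orders less than `n`. -/
theorem hasVanishingMoments_iteratedLineDeriv (f : 𝓢(Eucl d, ℂ)) {n : ℕ} (v : Fin n → Eucl d) :
    HasVanishingMoments n (∂^{v} f) := by
  induction n with
  | zero => exact fun j hj ↦ absurd hj (by omega)
  | succ n ih =>
    rw [LineDeriv.iteratedLineDerivOp_succ_left]
    exact (ih (Fin.tail v)).lineDeriv _

/-! ### Taylor expansion and almost orthogonality -/

theorem iteratedDeriv_comp_line {G : Eucl d → ℂ} (hG : ContDiff ℝ (⊤ : ℕ∞) G) (z h : Eucl d) (k : ℕ)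
    (τ : ℝ) : iteratedDeriv k (fun τ : ℝ ↦ G (z + τ • h)) τ =
      iteratedFDeriv ℝ k G (z + τ • h) fun _ ↦ h := by
  have h1 := (ContinuousLinearMap.toSpanSingleton ℝ h).iteratedFDeriv_comp_right (i := k)
    (f := fun w ↦ G (z + w)) (n := (⊤ : ℕ∞)) (by fun_prop) τ (by exact_mod_cast le_top)
  have h2 : (fun w ↦ G (z + w)) ∘ (ContinuousLinearMap.toSpanSingleton ℝ h) =
      fun τ : ℝ ↦ G (z + τ • h) := by ext; simp
  rw [h2] at h1
  rw [iteratedDeriv_eq_iteratedFDeriv, h1, iteratedFDeriv_comp_add_left']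
  simp

/-- Taylor's formula with a bound of the remainder. -/
theorem norm_sub_taylor_le {G : Eucl d → ℂ} (hG : ContDiff ℝ (⊤ : ℕ∞) G) (z h : Eucl d) (M : ℕ)
    {B : ℝ} (hB : ∀ τ ∈ Icc (0 : ℝ) 1, ‖iteratedFDeriv ℝ M G (z + τ • h)‖ ≤ B) :
    ‖G (z + h) - ∑ j ∈ Finset.range M,
      ((j.factorial : ℝ)⁻¹ • iteratedFDeriv ℝ j G z) fun _ ↦ h‖ ≤ B * ‖h‖ ^ M := by
  rcases M with _ | n
  · simpa using hB 1 (by simp)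
  set g : ℝ → ℂ := fun τ ↦ G (z + τ • h)
  have hg : ContDiff ℝ (⊤ : ℕ∞) g := by fun_prop
  have hw (k : ℕ) (τ : ℝ) (hτ : τ ∈ Icc (0 : ℝ) 1) : iteratedDerivWithin k g (Icc 0 1) τ =
      iteratedFDeriv ℝ k G (z + τ • h) fun _ ↦ h := by
    rw [iteratedDerivWithin_eq_iteratedDeriv (uniqueDiffOn_Icc_zero_one)
      ((hg.of_le (by exact_mod_cast le_top)).contDiffAt) hτ]
    exact iteratedDeriv_comp_line hG z h k τ
  have hB0 : 0 ≤ B := (norm_nonneg _).trans (hB 0 (by simp))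
  have h1 := taylor_mean_remainder_bound (f := g) (a := 0) (b := 1) (x := 1) (n := n)
    (C := B * ‖h‖ ^ (n + 1)) zero_le_one
    ((hg.of_le (by exact_mod_cast le_top)).contDiffOn) (by simp) fun τ hτ ↦ by
      rw [hw _ _ hτ]
      refine (ContinuousMultilinearMap.le_opNorm _ _).trans ?_
      simp only [Finset.prod_const, Finset.card_univ, Fintype.card_fin]
      gcongr
      exact hB τ hτ
  rw [taylor_within_apply] at h1
  simp only [sub_zero, one_pow, mul_one, g, one_smul] at h1
  have h2 : ∑ j ∈ Finset.range (n + 1),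
      ((j.factorial : ℝ)⁻¹ • iteratedFDeriv ℝ j G z) (fun _ ↦ h) = ∑ j ∈ Finset.range (n + 1),
      (j.factorial : ℝ)⁻¹ • iteratedDerivWithin j (fun τ : ℝ ↦ G (z + τ • h)) (Icc 0 1) 0 := by
    refine Finset.sum_congr rfl fun j _ ↦ ?_
    rw [hw j 0 (by simp)]; simp
  rw [h2]
  refine h1.trans (div_le_self (by positivity) ?_)
  exact_mod_cast n.factorial_pos

/-- Integration against the dilate of a function with vanishing moments of order less than `M` gains
the factor `y ^ M`, and it preserves the decay of the integrand at any scale `ε ≥ y`. -/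
theorem HasVanishingMoments.exists_norm_integral_dilate_mul_le {M : ℕ} {b : 𝓢(Eucl d, ℂ)}
    (hb : HasVanishingMoments M b) (N : ℕ) : ∃ C, 0 ≤ C ∧ ∀ (y ε : ℝ), 0 < y → y ≤ ε →
      ∀ (a : ℝ), |a| = 1 → ∀ (G : Eucl d → ℂ), ContDiff ℝ (⊤ : ℕ∞) G → ∀ (A : ℝ), 0 ≤ A →
      ∀ x z : Eucl d,
      (∀ t, ‖iteratedFDeriv ℝ M G t‖ ≤ A * ((1 + ‖ε⁻¹ • (t - x)‖) ^ N)⁻¹) →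
      ‖∫ t, dilate y b t * G (z + a • t)‖ ≤
        C * A * y ^ M * ((1 + ‖ε⁻¹ • (x - z)‖) ^ N)⁻¹ := by
  have hI : Integrable fun t : Eucl d ↦ ‖b t‖ * ((1 + ‖t‖) ^ N * ‖t‖ ^ M) := by
    obtain ⟨C, hC0, hC⟩ := exists_decay b (N + M + (d + 1)) 0
    have h0 : Integrable (fun t : Eucl d ↦ C * (1 + ‖t‖) ^ (-((d + 1 : ℕ) : ℝ))) :=
      (integrable_one_add_norm (by simp)).const_mul C
    refine h0.mono' (by fun_prop) (.of_forall fun t ↦ ?_)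
    rw [Real.norm_of_nonneg (by positivity), Real.rpow_neg (by positivity), Real.rpow_natCast]
    have h1 := hC 0 le_rfl t
    rw [norm_iteratedFDeriv_zero] at h1
    calc _ ≤ (C * ((1 + ‖t‖) ^ (N + M + (d + 1)))⁻¹) * ((1 + ‖t‖) ^ N * (1 + ‖t‖) ^ M) := by
          gcongr; linarith
      _ = _ := by
          have : 0 < 1 + ‖t‖ := by positivity
          rw [pow_add, pow_add]; field_simp
  refine ⟨∫ t, ‖b t‖ * ((1 + ‖t‖) ^ N * ‖t‖ ^ M), integral_nonneg fun t ↦ by positivity,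
    fun y ε hy hyε a ha G hG A hA0 x z hA ↦ ?_⟩
  have hε : 0 < ε := hy.trans_le hyε
  set P : Eucl d → ℂ := fun h ↦ ∑ j ∈ Finset.range M,
    ((j.factorial : ℝ)⁻¹ • iteratedFDeriv ℝ j G z) fun _ ↦ h
  set w := ((1 + ‖ε⁻¹ • (x - z)‖) ^ N)⁻¹
  have hTaylor (t : Eucl d) : ‖G (z + a • (y • t)) - P (a • (y • t))‖ ≤
      A * w * y ^ M * ((1 + ‖t‖) ^ N * ‖t‖ ^ M) := by
    have := norm_sub_taylor_le hG z (a • (y • t)) M (B := A * (w * (1 + ‖t‖) ^ N)) fun τ hτ ↦ by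
      refine (hA _).trans ?_
      gcongr
      have h1 := inv_one_add_norm_add_le (ε⁻¹ • (z - x)) (ε⁻¹ • (τ • a • y • t)) N
      rw [← smul_add, show z - x + τ • a • y • t = z + τ • a • y • t - x by abel] at h1
      refine h1.trans ?_
      have h2 : ‖ε⁻¹ • (z - x)‖ = ‖ε⁻¹ • (x - z)‖ := by
        rw [← norm_neg, ← smul_neg, neg_sub]
      rw [h2]
      gcongr
      rw [norm_smul, norm_smul, norm_smul, norm_smul, Real.norm_eq_abs a, ha, norm_inv,
        Real.norm_of_nonneg hε.le, Real.norm_of_nonneg hy.le, Real.norm_of_nonneg hτ.1, one_mul,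
        inv_mul_le_iff₀ hε]
      calc τ * (y * ‖t‖) ≤ 1 * (ε * ‖t‖) := by gcongr; exact hτ.2
        _ = _ := one_mul _
    refine this.trans (le_of_eq ?_)
    rw [norm_smul, norm_smul, Real.norm_eq_abs a, ha, Real.norm_of_nonneg hy.le, one_mul, mul_pow]
    ring
  have hPint (j : ℕ) : Integrable fun t ↦ b t *
      ((j.factorial : ℝ)⁻¹ • iteratedFDeriv ℝ j G z) (fun _ ↦ a • y • t) := by
    set B := (j.factorial : ℝ)⁻¹ • iteratedFDeriv ℝ j G z
    have hB : Continuous fun t : Eucl d ↦ B (fun _ ↦ a • y • t) := by fun_prop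
    refine ((b.integrable_pow_mul volume j).const_mul (‖B‖ * (|a| * |y|) ^ j)).mono'
      (by fun_prop) (.of_forall fun t ↦ ?_)
    rw [norm_mul]
    have := B.le_opNorm (fun _ ↦ a • y • t)
    simp only [Finset.prod_const, Finset.card_univ, Fintype.card_fin, norm_smul,
      Real.norm_eq_abs] at this
    calc _ ≤ ‖b t‖ * (‖B‖ * (|a| * (|y| * ‖t‖)) ^ j) := by gcongr
      _ = _ := by ring
  have hP : ∫ t, b t * P (a • (y • t)) = 0 := by
    simp only [P, Finset.mul_sum]
    rw [integral_finsetSum _ fun j _ ↦ hPint j]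
    refine Finset.sum_eq_zero fun j hj ↦ ?_
    have := hb.integral_eq_zero (Finset.mem_range.1 hj)
      ((((j.factorial : ℝ)⁻¹ • iteratedFDeriv ℝ j G z)).compContinuousLinearMap
        fun _ ↦ (a * y) • ContinuousLinearMap.id ℝ (Eucl d))
    simpa [mul_smul] using this
  have hPI : Integrable fun t ↦ b t * P (a • (y • t)) := by
    simp only [P, Finset.mul_sum]
    exact integrable_finsetSum _ fun j _ ↦ hPint j
  have hdom (t : Eucl d) : ‖b t * (G (z + a • (y • t)) - P (a • (y • t)))‖ ≤
      A * w * y ^ M * (‖b t‖ * ((1 + ‖t‖) ^ N * ‖t‖ ^ M)) := by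
    rw [norm_mul]
    calc _ ≤ ‖b t‖ * (A * w * y ^ M * ((1 + ‖t‖) ^ N * ‖t‖ ^ M)) := by gcongr; exact hTaylor t
      _ = _ := by ring
  have hPc : Continuous P := by fun_prop
  have hGc : Continuous G := hG.continuous
  have hdiff : Integrable fun t ↦ b t * (G (z + a • (y • t)) - P (a • (y • t))) :=
    (hI.const_mul (A * w * y ^ M)).mono' (by fun_prop) (.of_forall hdom)
  rw [integral_dilate_mul hy b fun t ↦ G (z + a • t)]
  have : ∫ t, b t * G (z + a • (y • t)) =
      ∫ t, b t * (G (z + a • (y • t)) - P (a • (y • t))) := by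
    rw [← add_zero (∫ t, b t * (G (z + a • (y • t)) - P (a • (y • t)))), ← hP,
      ← integral_add hdiff hPI]
    congr with t; ring
  rw [this]
  refine (norm_integral_le_of_norm_le (hI.const_mul (A * w * y ^ M)) (.of_forall hdom)).trans ?_
  rw [integral_const_mul]
  exact le_of_eq (by ring)

/-! ### A discrete Calderón reproducing formula -/

theorem fourier_dilate {y : ℝ} (hy : 0 < y) (f : 𝓢(Eucl d, ℂ)) (ξ : Eucl d) :
    FourierTransform.fourier (dilate y f) ξ = FourierTransform.fourier f (y • ξ) := by
  rw [SchwartzMap.fourier_coe, SchwartzMap.fourier_coe, Real.fourier_eq, Real.fourier_eq]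
  simp only [Circle.smul_def, smul_eq_mul]
  have := integral_dilate_mul hy f fun t ↦ (Real.fourierChar (-inner ℝ t ξ) : ℂ)
  simp only [mul_comm _ (dilate y f _)]
  rw [this]
  congr with t
  rw [mul_comm, inner_smul_left, inner_smul_right]; simp

theorem integral_eq_fourier_zero (f : 𝓢(Eucl d, ℂ)) : ∫ x, f x = FourierTransform.fourier f 0 := by
  rw [SchwartzMap.fourier_coe, Real.fourier_eq]; simp

theorem exists_fourier_eq {g : Eucl d → ℂ} (hg : ContDiff ℝ (⊤ : ℕ∞) g) (hc : HasCompactSupport g) :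
    ∃ f : 𝓢(Eucl d, ℂ), ∀ ξ, FourierTransform.fourier f ξ = g ξ :=
  ⟨FourierTransformInv.fourierInv (hc.toSchwartzMap hg), fun ξ ↦ by
    rw [FourierTransform.fourier_fourierInv_eq]; rfl⟩

/-- If the Fourier transforms of the functions `ψ i` have no common zero on an annulus, then there
are functions `b i` with vanishing moments of all orders such that `∑ i, b i * ψ i` is the difference
of a function `Θ` with integral one and of its dilate. -/
theorem exists_calderon {ι : Type*} [Fintype ι] (ψ : ι → 𝓢(Eucl d, ℂ)) {σ η : ℝ} (hσ : 0 < σ)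
    (hη : η ∈ Ioo (0 : ℝ) 1)
    (h : ∀ ξ : Eucl d, η * σ ≤ ‖ξ‖ → ‖ξ‖ ≤ σ → ∃ i, FourierTransform.fourier (ψ i) ξ ≠ 0) :
    ∃ l : ℝ, 1 < l ∧ ∃ (Θ : 𝓢(Eucl d, ℂ)) (b : ι → 𝓢(Eucl d, ℂ)), ∫ x, Θ x = 1 ∧
      (∀ i m, HasVanishingMoments m (b i)) ∧ Θ = dilate l Θ + ∑ i, sconv (b i) (ψ i) := by
  obtain ⟨hη0, hη1⟩ := hη
  set l : ℝ := (1 + η) / (2 * η) with hl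
  have hl1 : 1 < l := by rw [hl, lt_div_iff₀ (by positivity)]; linarith
  have hl0 : 0 < l := by linarith
  have hlη : l * (η * σ) = (1 + η) / 2 * σ := by rw [hl]; field_simp
  -- `B` is a bump function, one for `‖ξ‖ ≤ l η σ` and zero for `σ ≤ ‖ξ‖`, so that `β = B - B (l ·)` is
  -- supported in the annulus
  let B : ContDiffBump (0 : Eucl d) := ⟨l * (η * σ), σ, by positivity, by rw [hlη]; nlinarith⟩
  have hB1 (ξ : Eucl d) (hξ : ‖ξ‖ ≤ l * (η * σ)) : B ξ = 1 :=
    B.one_of_mem_closedBall (by simpa using hξ)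
  have hB0 (ξ : Eucl d) (hξ : σ ≤ ‖ξ‖) : B ξ = 0 :=
    B.zero_of_le_dist (by simpa using hξ)
  have hBs : ContDiff ℝ (⊤ : ℕ∞) fun ξ ↦ (B ξ : ℂ) := Complex.ofRealCLM.contDiff.comp B.contDiff
  have hBc : HasCompactSupport fun ξ ↦ (B ξ : ℂ) :=
    B.hasCompactSupport.comp_left (g := fun x : ℝ ↦ (x : ℂ)) (by simp)
  obtain ⟨Θ, hΘ⟩ := exists_fourier_eq hBs hBc
  set β : Eucl d → ℂ := fun ξ ↦ (B ξ : ℂ) - (B (l • ξ) : ℂ)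
  have hβs : ContDiff ℝ (⊤ : ℕ∞) β := hBs.sub (hBs.comp (contDiff_const_smul l))
  have hβsupp : Function.support β ⊆ {ξ | η * σ ≤ ‖ξ‖ ∧ ‖ξ‖ ≤ σ} := by
    intro ξ hξ
    by_contra hcon
    rw [mem_ofPred_eq, not_and_or, not_le, not_le] at hcon
    refine hξ ?_
    have hnorm : ‖l • ξ‖ = l * ‖ξ‖ := by rw [norm_smul, Real.norm_of_nonneg hl0.le]
    rcases hcon with h1 | h1
    · have h2 : ‖l • ξ‖ ≤ l * (η * σ) := by rw [hnorm]; gcongr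
      have h3 : ‖ξ‖ ≤ l * (η * σ) := by nlinarith [norm_nonneg ξ]
      simp [β, hB1 _ h2, hB1 _ h3]
    · have h2 : σ ≤ ‖l • ξ‖ := by rw [hnorm]; nlinarith [norm_nonneg ξ]
      simp [β, hB0 _ h2, hB0 _ h1.le]
  have hclosed : IsClosed {ξ : Eucl d | η * σ ≤ ‖ξ‖ ∧ ‖ξ‖ ≤ σ} :=
    (isClosed_le continuous_const continuous_norm).inter
      (isClosed_le continuous_norm continuous_const)
  have hβt : tsupport β ⊆ {ξ | η * σ ≤ ‖ξ‖ ∧ ‖ξ‖ ≤ σ} := closure_minimal hβsupp hclosed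
  have hβc : HasCompactSupport β := by
    refine (isCompact_closedBall (0 : Eucl d) σ).of_isClosed_subset (isClosed_tsupport _) ?_
    exact hβt.trans fun ξ hξ ↦ by simpa using hξ.2
  set F : ι → Eucl d → ℂ := fun i ξ ↦ FourierTransform.fourier (ψ i) ξ
  have hF (i) : ContDiff ℝ (⊤ : ℕ∞) (F i) := SchwartzMap.smooth _ ⊤
  set S : Eucl d → ℂ := fun ξ ↦ ∑ j, (starRingEnd ℂ) (F j ξ) * F j ξ
  have hconj (i) : ContDiff ℝ (⊤ : ℕ∞) fun ξ ↦ (starRingEnd ℂ) (F i ξ) :=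
    Complex.conjCLE.contDiff.comp (hF i)
  have hS : ContDiff ℝ (⊤ : ℕ∞) S := ContDiff.sum fun i _ ↦ (hconj i).mul (hF i)
  have hS0 (ξ : Eucl d) (hξ : ξ ∈ tsupport β) : S ξ ≠ 0 := by
    obtain ⟨i, hi⟩ := h ξ (hβt hξ).1 (hβt hξ).2
    have : S ξ = ((∑ j, Complex.normSq (F j ξ) : ℝ) : ℂ) := by
      push_cast
      exact Finset.sum_congr rfl fun j _ ↦ by rw [mul_comm, Complex.mul_conj]
    rw [this, Complex.ofReal_ne_zero]
    exact (Finset.sum_pos' (f := fun j ↦ Complex.normSq (F j ξ)) (fun j _ ↦ Complex.normSq_nonneg _)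
      ⟨i, Finset.mem_univ i, Complex.normSq_pos.2 hi⟩).ne'
  -- the Fourier transforms of the `b i` solve `∑ i, b̂ i * ψ̂ i = β`
  have hbs (i) : ContDiff ℝ (⊤ : ℕ∞) fun ξ ↦ β ξ * ((starRingEnd ℂ) (F i ξ) / S ξ) := by
    rw [contDiff_iff_contDiffAt]
    intro ξ
    by_cases hξ : ξ ∈ tsupport β
    · simp only [div_eq_mul_inv]
      exact hβs.contDiffAt.mul ((hconj i).contDiffAt.mul (hS.contDiffAt.inv (hS0 ξ hξ)))
    · refine (contDiffAt_const (c := (0 : ℂ))).congr_of_eventuallyEq ?_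
      filter_upwards [notMem_tsupport_iff_eventuallyEq.1 hξ] with x hx
      simp [hx]
  have hbc (i) : HasCompactSupport fun ξ ↦ β ξ * ((starRingEnd ℂ) (F i ξ) / S ξ) := hβc.mul_right
  choose b hb using fun i ↦ exists_fourier_eq (hbs i) (hbc i)
  refine ⟨l, hl1, Θ, b, ?_, fun i m ↦ hasVanishingMoments_of_eventuallyEq ?_ m, ?_⟩
  · rw [integral_eq_fourier_zero, hΘ, hB1 _ (by rw [norm_zero]; positivity)]; simp
  · have h0 : (0 : Eucl d) ∉ tsupport β := fun h0 ↦ by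
      have := (hβt h0).1
      rw [norm_zero] at this
      nlinarith [mul_pos hη0 hσ]
    filter_upwards [notMem_tsupport_iff_eventuallyEq.1 h0] with x hx
    rw [hb]; simp [hx]
  · refine schwartz_ext_fourier fun ξ ↦ ?_
    have hadd : FourierTransform.fourier (dilate l Θ + ∑ i, sconv (b i) (ψ i)) ξ =
        FourierTransform.fourier (dilate l Θ) ξ +
          ∑ i, FourierTransform.fourier (sconv (b i) (ψ i)) ξ := by
      rw [FourierTransform.fourier_add]
      have : FourierTransform.fourier (∑ i, sconv (b i) (ψ i)) =
          ∑ i, FourierTransform.fourier (sconv (b i) (ψ i)) :=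
        map_sum (FourierTransform.fourierCLE ℂ 𝓢(Eucl d, ℂ)) _ _
      rw [this, add_apply, sum_apply]
    rw [hadd, fourier_dilate hl0, hΘ, hΘ]
    simp only [fourier_sconv, hb]
    have : ∑ i, β ξ * ((starRingEnd ℂ) (F i ξ) / S ξ) * F i ξ = β ξ := by
      by_cases hξ : β ξ = 0
      · simp [hξ]
      have hs := hS0 ξ (subset_tsupport _ hξ)
      have h1 : ∀ i, β ξ * ((starRingEnd ℂ) (F i ξ) / S ξ) * F i ξ =
          β ξ / S ξ * ((starRingEnd ℂ) (F i ξ) * F i ξ) := fun i ↦ by ring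
      simp only [h1]
      rw [← Finset.mul_sum]
      exact div_mul_cancel₀ _ hs
    have h2 : ∑ i, β ξ * ((starRingEnd ℂ) (F i ξ) / S ξ) * FourierTransform.fourier (ψ i) ξ = β ξ :=
      this
    rw [h2]
    simp [β]

/-- The iterated form of the reproducing formula. -/
theorem dilate_telescope {ι : Type*} [Fintype ι] {ψ b : ι → 𝓢(Eucl d, ℂ)} {Θ : 𝓢(Eucl d, ℂ)} {l : ℝ}
    (hl : 1 < l) (h : Θ = dilate l Θ + ∑ i, sconv (b i) (ψ i)) {t : ℝ} (ht : 0 < t) (J : ℕ) :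
    dilate (t * (l ^ J)⁻¹) Θ = dilate t Θ + ∑ j ∈ Finset.range J, ∑ i,
      sconv (dilate (t * (l ^ (j + 1))⁻¹) (b i)) (dilate (t * (l ^ (j + 1))⁻¹) (ψ i)) := by
  have hl0 : 0 < l := by linarith
  induction J with
  | zero => simp
  | succ J ih =>
    rw [Finset.sum_range_succ, ← add_assoc, ← ih]
    have hy : 0 < t * (l ^ (J + 1))⁻¹ := by positivity
    conv_lhs => rw [h]
    rw [dilate_add, dilate_dilate hy.ne' hl0.ne', dilate_sum]
    simp only [dilate_sconv hy]
    congr 2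
    rw [pow_succ]; field_simp

/-! ### Inequalities of Minkowski and Young -/

section LpTools

variable {X : Type*} [MeasurableSpace X] {μ : Measure X}

theorem eLpNorm_const_mul_le {c : ℝ≥0∞} (hc : c ≠ ∞) (f : X → ℝ≥0∞) (p : ℝ≥0∞) :
    eLpNorm (fun x ↦ c * f x) p μ ≤ c * eLpNorm f p μ := by
  lift c to NNReal using hc
  exact eLpNorm_le_mul_eLpNorm_of_ae_le_mul' (.of_forall fun x ↦ by simp) p

/-- Minkowski's inequality for countable sums. -/
theorem eLpNorm_tsum_le {ι : Type*} [Countable ι] {f : ι → X → ℝ≥0∞}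
    (hf : ∀ i, AEMeasurable (f i) μ) {p : ℝ≥0∞} (hp : 1 ≤ p) :
    eLpNorm (fun x ↦ ∑' i, f i x) p μ ≤ ∑' i, eLpNorm (f i) p μ := by
  rcases eq_or_ne p ∞ with rfl | hpt
  · simp only [eLpNorm_exponent_top]
    refine essSup_le_of_ae_le _ ?_
    filter_upwards [ae_all_iff.2 fun i ↦ ae_le_eLpNormEssSup (f := f i) (μ := μ)] with x hx
    exact ENNReal.tsum_le_tsum hx
  have hp0 : 0 < p.toReal := ENNReal.toReal_pos (by positivity) hpt
  have hfin (s : Finset ι) : eLpNorm (fun x ↦ ∑ i ∈ s, f i x) p μ ≤ ∑' i, eLpNorm (f i) p μ := by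
    have : (fun x ↦ ∑ i ∈ s, f i x) = ∑ i ∈ s, f i := by ext; simp
    rw [this]
    exact (eLpNorm_sum_le (fun i _ ↦ (hf i).aestronglyMeasurable) hp).trans (ENNReal.sum_le_tsum s)
  have h1 (g : X → ℝ≥0∞) : eLpNorm g p μ = (∫⁻ x, g x ^ p.toReal ∂μ) ^ (1 / p.toReal) := by
    rw [eLpNorm_eq_lintegral_rpow_enorm_toReal (by positivity) hpt]; simp
  rw [h1]
  have h2 : ∀ x, (∑' i, f i x) ^ p.toReal = ⨆ s : Finset ι, (∑ i ∈ s, f i x) ^ p.toReal := fun x ↦ by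
    rw [ENNReal.tsum_eq_iSup_sum]
    exact (ENNReal.orderIsoRpow p.toReal hp0).map_iSup _
  simp_rw [h2]
  rw [lintegral_iSup_directed]
  · have h3 := (ENNReal.orderIsoRpow (1 / p.toReal) (by positivity)).map_iSup
      fun s : Finset ι ↦ ∫⁻ x, (∑ i ∈ s, f i x) ^ p.toReal ∂μ
    refine h3.trans_le (iSup_le fun s ↦ ?_)
    have h4 := hfin s
    rw [h1] at h4
    exact h4
  · intro s
    exact (Finset.aemeasurable_fun_sum s fun i _ ↦ hf i).pow_const _
  · classical
    intro s t
    refine ⟨s ∪ t, fun x ↦ ?_, fun x ↦ ?_⟩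
    · exact ENNReal.rpow_le_rpow (Finset.sum_le_sum_of_subset Finset.subset_union_left) hp0.le
    · exact ENNReal.rpow_le_rpow (Finset.sum_le_sum_of_subset Finset.subset_union_right) hp0.le

end LpTools

/-- Young's inequality for the convolution with a function in `L^1`, by Hölder's inequality for the
measure `H (x - z) dz`. -/
theorem eLpNorm_lintegral_mul_le {H w : Eucl d → ℝ≥0∞} (hH : Measurable H) (hw : Measurable w)
    {p : ℝ≥0∞} (hp : 1 ≤ p) :
    eLpNorm (fun x ↦ ∫⁻ z, H (x - z) * w z) p volume ≤ (∫⁻ z, H z) * eLpNorm w p volume := by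
  set I := ∫⁻ z, H z
  have hIx (x : Eucl d) : ∫⁻ z, H (x - z) = I := lintegral_sub_left_eq_self H x
  rcases eq_or_ne p ∞ with rfl | hpt
  · simp only [eLpNorm_exponent_top]
    refine essSup_le_of_ae_le _ (.of_forall fun x ↦ ?_)
    rw [← hIx x, ← lintegral_mul_const _ (by fun_prop)]
    refine lintegral_mono_ae ?_
    filter_upwards [ae_le_eLpNormEssSup (f := w) (μ := volume)] with z hz
    gcongr
    exact hz
  have hp0 : 0 < p.toReal := ENNReal.toReal_pos (by positivity) hpt
  have hp1 : 1 ≤ p.toReal := by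
    rw [← ENNReal.toReal_one]; exact ENNReal.toReal_mono hpt hp
  have hpoint (x : Eucl d) : (∫⁻ z, H (x - z) * w z) ^ p.toReal ≤
      (∫⁻ z, H (x - z) * w z ^ p.toReal) * I ^ (p.toReal - 1) := by
    set ν := (volume : Measure (Eucl d)).withDensity fun z ↦ H (x - z)
    have hν (g : Eucl d → ℝ≥0∞) (hg : Measurable g) : ∫⁻ z, g z ∂ν = ∫⁻ z, H (x - z) * g z :=
      lintegral_withDensity_eq_lintegral_mul _ (by fun_prop) hg
    have huniv : ν Set.univ = I := by
      rw [withDensity_apply _ MeasurableSet.univ, Measure.restrict_univ, hIx]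
    have h := eLpNorm_le_eLpNorm_mul_rpow_measure_univ hp (μ := ν) (f := w)
      hw.aestronglyMeasurable
    rw [eLpNorm_one_eq_lintegral_enorm, eLpNorm_eq_lintegral_rpow_enorm_toReal (by positivity) hpt,
      huniv] at h
    simp only [enorm_eq_self] at h
    rw [hν _ hw, hν _ (hw.pow_const _)] at h
    refine (ENNReal.rpow_le_rpow h hp0.le).trans (le_of_eq ?_)
    rw [ENNReal.mul_rpow_of_nonneg _ _ hp0.le, ← ENNReal.rpow_mul, ← ENNReal.rpow_mul]
    congr 1
    · rw [one_div, inv_mul_cancel₀ hp0.ne', ENNReal.rpow_one]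
    · congr 1; rw [ENNReal.toReal_one]; field_simp
  have h1 (g : Eucl d → ℝ≥0∞) :
      eLpNorm g p volume = (∫⁻ x, g x ^ p.toReal) ^ (1 / p.toReal) := by
    rw [eLpNorm_eq_lintegral_rpow_enorm_toReal (by positivity) hpt]; simp
  rw [h1, h1]
  have h2 : ∫⁻ x, (∫⁻ z, H (x - z) * w z) ^ p.toReal ≤ I ^ p.toReal * ∫⁻ z, w z ^ p.toReal := by
    have hm : Measurable fun q : Eucl d × Eucl d ↦ H (q.1 - q.2) * w q.2 ^ p.toReal := by fun_prop
    calc _ ≤ ∫⁻ x, (∫⁻ z, H (x - z) * w z ^ p.toReal) * I ^ (p.toReal - 1) := lintegral_mono hpoint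
      _ = (∫⁻ x, ∫⁻ z, H (x - z) * w z ^ p.toReal) * I ^ (p.toReal - 1) :=
          lintegral_mul_const _ hm.lintegral_prod_right'
      _ = (∫⁻ z, ∫⁻ x, H (x - z) * w z ^ p.toReal) * I ^ (p.toReal - 1) := by
          rw [lintegral_lintegral_swap hm.aemeasurable]
      _ = (∫⁻ z, I * w z ^ p.toReal) * I ^ (p.toReal - 1) := by
          congr 2 with z
          rw [lintegral_mul_const _ (by fun_prop), lintegral_sub_right_eq_self H z]
      _ = _ := by
          rw [lintegral_const_mul _ (by fun_prop)]
          have : I ^ p.toReal = I * I ^ (p.toReal - 1) := by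
            conv_rhs => enter [1]; rw [← ENNReal.rpow_one I]
            rw [← ENNReal.rpow_add_of_nonneg _ _ zero_le_one (by linarith)]
            congr 1; ring
          rw [this]; ring
  refine (ENNReal.rpow_le_rpow h2 (by positivity)).trans (le_of_eq ?_)
  rw [ENNReal.mul_rpow_of_nonneg _ _ (by positivity), ← ENNReal.rpow_mul, one_div,
    mul_inv_cancel₀ hp0.ne', ENNReal.rpow_one]

theorem eLpNorm_setLIntegral_mul_le {H w : Eucl d → ℝ≥0∞} (hH : Measurable H) (hw : Measurable w)
    {p : ℝ≥0∞} (hp : 1 ≤ p) {ω : Set (Eucl d)} (hω : MeasurableSet ω) :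
    eLpNorm (fun x ↦ ∫⁻ z in ω, H (x - z) * w z) p volume ≤
      (∫⁻ z, H z) * eLpNorm w p (volume.restrict ω) := by
  have h := eLpNorm_lintegral_mul_le hH (hw.indicator hω) hp
  rw [eLpNorm_indicator_eq_eLpNorm_restrict hω] at h
  refine le_trans (le_of_eq ?_) h
  congr 1
  ext x
  rw [← lintegral_indicator hω]
  congr with z
  by_cases hz : z ∈ ω <;> simp [hz]

/-! ### The dilation invariant measure -/

/-- Dilations preserve `dε / ε`; the indicator function discards the part of `F` outside `(0, 1)`. -/
theorem eLpNorm_logMeasure_dilation_le {F : ℝ → ℝ≥0∞} (hF : AEMeasurable F logMeasure) {a : ℝ}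
    (ha : 0 < a) (q : ℝ≥0∞) :
    AEMeasurable (fun ε ↦ (Ioo (0 : ℝ) 1).indicator F (ε * a)) logMeasure ∧
    eLpNorm (fun ε ↦ (Ioo (0 : ℝ) 1).indicator F (ε * a)) q logMeasure ≤
      eLpNorm F q logMeasure := by
  have hmap : (logMeasure.map fun ε ↦ ε * a).restrict (Ioo 0 1) ≤ logMeasure := by
    refine Measure.le_iff.2 fun s hs ↦ ?_
    have hms : MeasurableSet (s ∩ Ioo (0 : ℝ) 1) := hs.inter measurableSet_Ioo
    rw [Measure.restrict_apply hs, Measure.map_apply (by fun_prop) hms, logMeasure,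
      withDensity_apply _ ((by fun_prop : Measurable fun ε : ℝ ↦ ε * a) hms),
      withDensity_apply _ hs, Measure.restrict_restrict hs,
      Measure.restrict_restrict ((by fun_prop : Measurable fun ε : ℝ ↦ ε * a) hms)]
    calc ∫⁻ ε in (fun ε ↦ ε * a) ⁻¹' (s ∩ Ioo 0 1) ∩ Ioo 0 1, ENNReal.ofReal ε⁻¹
        ≤ ∫⁻ ε in (fun ε ↦ ε * a) ⁻¹' (s ∩ Ioo 0 1), ENNReal.ofReal ε⁻¹ :=
          lintegral_mono_set inter_subset_left
      _ = ∫⁻ ε, (s ∩ Ioo 0 1).indicator (fun y ↦ ENNReal.ofReal (y / a)⁻¹) (ε * a) := by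
          rw [← lintegral_indicator ((by fun_prop : Measurable fun ε : ℝ ↦ ε * a) hms)]
          congr with ε
          by_cases h : ε * a ∈ s ∩ Ioo 0 1
          · rw [indicator_of_mem h, indicator_of_mem (by exact h), mul_div_cancel_right₀ _ ha.ne']
          · rw [indicator_of_notMem h, indicator_of_notMem (by exact h)]
      _ = ∫⁻ y, (s ∩ Ioo 0 1).indicator (fun y ↦ ENNReal.ofReal (y / a)⁻¹) y
            ∂(Measure.map (fun x ↦ x * a) volume) := by
          rw [lintegral_map _ (by fun_prop)]
          exact (Measurable.ennreal_ofReal (by fun_prop)).indicator hms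
      _ = ∫⁻ y in s ∩ Ioo 0 1, ENNReal.ofReal y⁻¹ := by
          rw [Real.map_volume_mul_right ha.ne', lintegral_smul_measure, lintegral_indicator hms,
            smul_eq_mul, ← lintegral_const_mul _ (Measurable.ennreal_ofReal (by fun_prop))]
          congr with y
          rw [← ENNReal.ofReal_mul (abs_nonneg _), abs_of_pos (by positivity)]
          congr 1
          rw [inv_div, div_eq_mul_inv, ← mul_assoc, inv_mul_cancel₀ ha.ne', one_mul]
      _ ≤ _ := le_rfl
  have hm : AEMeasurable ((Ioo (0 : ℝ) 1).indicator F) (logMeasure.map fun ε ↦ ε * a) :=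
    (aemeasurable_indicator_iff measurableSet_Ioo).2 (hF.mono_measure hmap)
  refine ⟨hm.comp_aemeasurable (by fun_prop), ?_⟩
  have h := eLpNorm_map_measure (p := q) (μ := logMeasure) (f := fun ε ↦ ε * a)
    hm.aestronglyMeasurable (by fun_prop)
  refine h.symm.trans_le ?_
  rw [eLpNorm_indicator_eq_eLpNorm_restrict measurableSet_Ioo]
  exact eLpNorm_mono_measure F hmap

theorem eLpNorm_rpow_logMeasure_lt_top {c : ℝ} (hc : 0 < c) (q : ℝ≥0∞) :
    eLpNorm (fun ε : ℝ ↦ ENNReal.ofReal (ε ^ c)) q logMeasure < ∞ := by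
  have hle : ∀ᵐ ε ∂logMeasure, ENNReal.ofReal (ε ^ c) ≤ 1 := by
    filter_upwards [ae_logMeasure] with ε hε
    rw [ENNReal.ofReal_le_one]
    exact Real.rpow_le_one hε.1.le hε.2.le hc.le
  rcases eq_or_ne q ∞ with rfl | hqt
  · rw [eLpNorm_exponent_top]
    exact (essSup_le_of_ae_le 1 hle).trans_lt ENNReal.one_lt_top
  rcases eq_or_ne q 0 with rfl | hq0
  · simp
  have hq : 0 < q.toReal := ENNReal.toReal_pos hq0 hqt
  refine (eLpNorm_lt_top_iff_lintegral_rpow_enorm_lt_top hq0 hqt).2 ?_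
  rw [logMeasure, lintegral_withDensity_eq_lintegral_mul _ (by fun_prop) (by fun_prop)]
  have hint : IntegrableOn (fun ε : ℝ ↦ ε ^ (c * q.toReal - 1)) (Ioo 0 1) :=
    (intervalIntegral.integrableOn_Ioo_rpow_iff one_pos).2 (by nlinarith [mul_pos hc hq])
  refine lt_of_le_of_lt (setLIntegral_mono' measurableSet_Ioo fun ε hε ↦ ?_) hint.lintegral_lt_top
  simp only [Pi.mul_apply, enorm_eq_self]
  rw [ENNReal.ofReal_rpow_of_nonneg (Real.rpow_nonneg hε.1.le _) hq.le,
    ← ENNReal.ofReal_mul (inv_nonneg.2 hε.1.le)]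
  refine ENNReal.ofReal_le_ofReal (le_of_eq ?_)
  rw [Real.rpow_sub hε.1, ← Real.rpow_mul hε.1.le, Real.rpow_one, div_eq_inv_mul]

theorem tsum_pow_natAbs_lt_top {θ : ℝ} (hθ0 : 0 ≤ θ) (hθ1 : θ < 1) :
    ∑' i : ℤ, ENNReal.ofReal (θ ^ i.natAbs) < ∞ := by
  have hs : Summable fun i : ℤ ↦ θ ^ i.natAbs := by
    refine summable_int_iff_summable_nat_and_neg.2 ⟨?_, ?_⟩ <;>
    simpa using summable_geometric_of_lt_one hθ0 hθ1
  rw [← ENNReal.ofReal_tsum_of_nonneg (fun i ↦ by positivity) hs]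
  exact ENNReal.ofReal_lt_top

/-- A bound by a weighted sum over a geometric grid through `ε` is preserved by the passage to
the `L^q` norms with respect to the dilation invariant measure. -/
theorem eLpNorm_lt_top_of_le_grid {F G : ℝ → ℝ≥0∞} {q : ℝ≥0∞} (hq : 1 ≤ q)
    (hF : AEMeasurable F logMeasure) (hFq : eLpNorm F q logMeasure < ∞) {l θ c : ℝ} (hl : 0 < l)
    (hθ0 : 0 ≤ θ) (hθ1 : θ < 1) (hc : 0 < c) {A : ℝ≥0∞} (hA : A ≠ ∞)
    (h : ∀ ε ∈ Ioo (0 : ℝ) 1, G ε ≤ A * ENNReal.ofReal (ε ^ c) +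
      A * ∑' i : ℤ, ENNReal.ofReal (θ ^ i.natAbs) * (Ioo (0 : ℝ) 1).indicator F (ε * l ^ i)) :
    eLpNorm G q logMeasure < ∞ := by
  have hd (i : ℤ) := eLpNorm_logMeasure_dilation_le hF (zpow_pos hl i) q
  have hm (i : ℤ) : AEMeasurable (fun ε ↦ ENNReal.ofReal (θ ^ i.natAbs) *
      (Ioo (0 : ℝ) 1).indicator F (ε * l ^ i)) logMeasure := (hd i).1.const_mul _
  set G1 : ℝ → ℝ≥0∞ := fun ε ↦ A * ENNReal.ofReal (ε ^ c)
  set G2 : ℝ → ℝ≥0∞ := fun ε ↦ ∑' i : ℤ, ENNReal.ofReal (θ ^ i.natAbs) *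
    (Ioo (0 : ℝ) 1).indicator F (ε * l ^ i)
  have hG2 : eLpNorm G2 q logMeasure < ∞ := by
    refine (eLpNorm_tsum_le hm hq).trans_lt ?_
    calc _ ≤ ∑' i : ℤ, ENNReal.ofReal (θ ^ i.natAbs) * eLpNorm F q logMeasure := by
          refine ENNReal.tsum_le_tsum fun i ↦ ?_
          exact (eLpNorm_const_mul_le ENNReal.ofReal_ne_top _ q).trans (by gcongr; exact (hd i).2)
      _ = _ := ENNReal.tsum_mul_right
      _ < ∞ := ENNReal.mul_lt_top (tsum_pow_natAbs_lt_top hθ0 hθ1) hFq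
  have hG2m : AEMeasurable G2 logMeasure := AEMeasurable.tsum hm
  have h1 : eLpNorm G1 q logMeasure < ∞ := (eLpNorm_const_mul_le hA _ q).trans_lt
    (ENNReal.mul_lt_top hA.lt_top (eLpNorm_rpow_logMeasure_lt_top hc q))
  have h2 : eLpNorm (fun ε ↦ A * G2 ε) q logMeasure < ∞ := (eLpNorm_const_mul_le hA _ q).trans_lt
    (ENNReal.mul_lt_top hA.lt_top hG2)
  have hsum := eLpNorm_add_lt_top (f := G1) (g := fun ε ↦ A * G2 ε)
    ⟨(by fun_prop : AEMeasurable G1 logMeasure).aestronglyMeasurable, h1⟩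
    ⟨(hG2m.const_mul A).aestronglyMeasurable, h2⟩
  refine lt_of_le_of_lt (eLpNorm_mono_enorm_ae ?_) hsum
  filter_upwards [ae_logMeasure] with ε hε
  simpa using h ε hε

/-! ### Kernel estimates -/

theorem norm_iteratedFDeriv_lineDeriv_le (g : 𝓢(Eucl d, ℂ)) (w : Eucl d) (l : ℕ) (z : Eucl d) :
    ‖iteratedFDeriv ℝ l (∂_{w} g : 𝓢(Eucl d, ℂ)) z‖ ≤ ‖w‖ * ‖iteratedFDeriv ℝ (l + 1) g z‖ := by
  have hw : ((∂_{w} g : 𝓢(Eucl d, ℂ)) : Eucl d → ℂ) =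
      (ContinuousLinearMap.apply ℝ ℂ w) ∘ fderiv ℝ g := by
    ext x; rw [SchwartzMap.lineDerivOp_apply_eq_fderiv]; rfl
  have hg : ContDiff ℝ l (fderiv ℝ g) := (g.smooth (l + 1)).fderiv_right (by exact_mod_cast le_rfl)
  rw [hw]
  refine ((ContinuousLinearMap.apply ℝ ℂ w).norm_iteratedFDeriv_comp_left
    hg.contDiffAt (le_refl _)).trans ?_
  rw [norm_iteratedFDeriv_fderiv]
  gcongr
  refine ContinuousLinearMap.opNorm_le_bound _ (norm_nonneg _) fun A ↦ ?_
  rw [mul_comm]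
  exact A.le_opNorm w

theorem norm_iteratedFDeriv_iteratedLineDeriv_le (f : 𝓢(Eucl d, ℂ)) {n : ℕ} (v : Fin n → Eucl d)
    (l : ℕ) (z : Eucl d) :
    ‖iteratedFDeriv ℝ l (∂^{v} f : 𝓢(Eucl d, ℂ)) z‖ ≤
      (∏ i, ‖v i‖) * ‖iteratedFDeriv ℝ (l + n) f z‖ := by
  induction n generalizing l with
  | zero => simp
  | succ n ih =>
    rw [LineDeriv.iteratedLineDerivOp_succ_left]
    refine (norm_iteratedFDeriv_lineDeriv_le _ _ l z).trans ?_
    rw [Fin.prod_univ_succ, mul_assoc]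
    gcongr
    have := ih (Fin.tail v) (l + 1)
    rwa [show l + 1 + n = l + (n + 1) by ring] at this

theorem IsOrderBound.norm_iteratedFDeriv_conv_le {u : 𝓢'(Eucl d, ℂ)} {K : Set (Eucl d)} {L : ℕ}
    {C : ℝ} (hu : IsOrderBound u K L C) {f : 𝓢(Eucl d, ℂ)} {x : Eucl d} {n : ℕ} {B : ℝ} (hB : 0 ≤ B)
    (h : ∀ l ≤ L, ∀ z ∈ K, ‖iteratedFDeriv ℝ (l + n) f (x - z)‖ ≤ B) :
    ‖iteratedFDeriv ℝ n (conv u f) x‖ ≤ C * B := by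
  refine ContinuousMultilinearMap.opNorm_le_bound (mul_nonneg hu.1 hB) fun v ↦ ?_
  rw [hu.iteratedFDeriv_conv, mul_assoc]
  refine hu.norm_conv_le (by positivity) fun l hl z hz ↦
    (norm_iteratedFDeriv_iteratedLineDeriv_le f v l _).trans ?_
  rw [mul_comm]
  gcongr
  exact h l hl z hz

theorem exists_norm_iteratedFDeriv_mul_reflectAt_le (χ : 𝓓(Ω, ℂ)) (f : 𝓢(Eucl d, ℂ)) (M N : ℕ) :
    ∃ C, 0 ≤ C ∧ ∀ y ∈ Ioc (0 : ℝ) 1, ∀ c s : Eucl d,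
      ‖iteratedFDeriv ℝ M (fun s ↦ χ s * reflectAt c (dilate y f) s) s‖ ≤
        C * (y ^ (d + M))⁻¹ * ((1 + ‖y⁻¹ • (s - c)‖) ^ N)⁻¹ := by
  obtain ⟨A, hA0, hA⟩ := exists_bound_iteratedFDeriv_test χ M
  obtain ⟨B, hB0, hB⟩ := exists_decay f N M
  refine ⟨2 ^ M * (A * B), by positivity, fun y hy c s ↦ ?_⟩
  have hy0 := hy.1
  refine (norm_iteratedFDeriv_mul_le_two_pow (χ.contDiff) (SchwartzMap.smooth _ ⊤)
    (fun j hj ↦ hA j hj s) (B := (y ^ (d + M))⁻¹ * (B * ((1 + ‖y⁻¹ • (s - c)‖) ^ N)⁻¹))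
    fun j hj ↦ ?_).trans (le_of_eq (by ring))
  rw [norm_iteratedFDeriv_reflectAt, norm_iteratedFDeriv_dilate hy0]
  have h1 : ‖y⁻¹ • (s - c)‖ = ‖y⁻¹ • (c - s)‖ := by rw [← norm_neg, ← smul_neg, neg_sub]
  rw [h1]
  have h2 : (y ^ (d + j))⁻¹ ≤ (y ^ (d + M))⁻¹ := by
    have := pow_le_pow_of_le_one hy0.le hy.2 (show d + j ≤ d + M by omega)
    gcongr
  exact mul_le_mul h2 (hB j hj _) (norm_nonneg _) (by positivity)

/-- The kernel `∫ χ(s) ζ_ε(x - s) b_y(s - z) ds`. -/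
noncomputable def kernel (χ : 𝓓(Ω, ℂ)) (ζ b : 𝓢(Eucl d, ℂ)) (ε y : ℝ) (x z : Eucl d) : ℂ :=
  ∫ s, dilate ε ζ (x - s) * (χ s * dilate y b (s - z))

theorem reflectAt_dilate_reflectAt {y : ℝ} (hy : y ≠ 0) (b : 𝓢(Eucl d, ℂ)) (z s : Eucl d) :
    reflectAt z (dilate y (reflectAt 0 b)) s = dilate y b (s - z) := by
  rw [reflectAt_apply, dilate_apply hy, dilate_apply hy, reflectAt_apply, zero_sub, ← smul_neg,
    neg_sub]

/-- For `y ≤ ε`, the vanishing moments of `b` give a gain in the kernel, which lives on the scale `ε`. -/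
theorem exists_norm_kernel_le_of_le (χ : 𝓓(Ω, ℂ)) (ζ : 𝓢(Eucl d, ℂ)) {b : 𝓢(Eucl d, ℂ)} {M : ℕ}
    (hb : HasVanishingMoments M b) (N : ℕ) :
    ∃ C, 0 ≤ C ∧ ∀ y ε : ℝ, 0 < y → y ≤ ε → ε ≤ 1 → ∀ x z : Eucl d,
      ‖kernel χ ζ b ε y x z‖ ≤
        C * (y / ε) ^ M * ((ε ^ d)⁻¹ * ((1 + ‖ε⁻¹ • (x - z)‖) ^ N)⁻¹) := by
  obtain ⟨C₁, hC₁, h₁⟩ := exists_norm_iteratedFDeriv_mul_reflectAt_le χ ζ M N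
  obtain ⟨C₂, hC₂, h₂⟩ := hb.exists_norm_integral_dilate_mul_le N
  refine ⟨C₂ * C₁, by positivity, fun y ε hy hyε hε1 x z ↦ ?_⟩
  have hε : 0 < ε := hy.trans_le hyε
  have h := h₂ y ε hy hyε 1 (by simp) (fun s ↦ χ s * reflectAt x (dilate ε ζ) s)
    (χ.contDiff.mul (SchwartzMap.smooth _ ⊤)) (C₁ * (ε ^ (d + M))⁻¹) (by positivity) x z
    fun t ↦ h₁ ε ⟨hε, hε1⟩ x t
  have hk : kernel χ ζ b ε y x z = ∫ t, dilate y b t * (fun s ↦ χ s * reflectAt x (dilate ε ζ) s)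
      (z + (1 : ℝ) • t) := by
    rw [kernel, ← integral_add_left_eq_self _ z]
    congr with t
    simp only [reflectAt_apply, one_smul, add_sub_cancel_left]
    ring
  rw [hk]
  refine h.trans (le_of_eq ?_)
  rw [div_pow, pow_add]; field_simp

/-- For `ε ≤ y`, the vanishing moments of `ζ` give a gain in the kernel, which lives on the scale `y`. -/
theorem exists_norm_kernel_le_of_ge (χ : 𝓓(Ω, ℂ)) {ζ : 𝓢(Eucl d, ℂ)} (b : 𝓢(Eucl d, ℂ)) {m : ℕ}
    (hζ : HasVanishingMoments m ζ) (N : ℕ) :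
    ∃ C, 0 ≤ C ∧ ∀ y ε : ℝ, 0 < ε → ε ≤ y → y ≤ 1 → ∀ x z : Eucl d,
      ‖kernel χ ζ b ε y x z‖ ≤
        C * (ε / y) ^ m * ((y ^ d)⁻¹ * ((1 + ‖y⁻¹ • (x - z)‖) ^ N)⁻¹) := by
  obtain ⟨C₁, hC₁, h₁⟩ := exists_norm_iteratedFDeriv_mul_reflectAt_le χ (reflectAt 0 b) m N
  obtain ⟨C₂, hC₂, h₂⟩ := hζ.exists_norm_integral_dilate_mul_le N
  refine ⟨C₂ * C₁, by positivity, fun y ε hε hεy hy1 x z ↦ ?_⟩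
  have hy : 0 < y := hε.trans_le hεy
  have h := h₂ ε y hε hεy (-1) (by simp)
    (fun s ↦ χ s * reflectAt z (dilate y (reflectAt 0 b)) s)
    (χ.contDiff.mul (SchwartzMap.smooth _ ⊤)) (C₁ * (y ^ (d + m))⁻¹) (by positivity) z x
    fun t ↦ h₁ y ⟨hy, hy1⟩ z t
  have hk : kernel χ ζ b ε y x z = ∫ t, dilate ε ζ t *
      (fun s ↦ χ s * reflectAt z (dilate y (reflectAt 0 b)) s) (x + (-1 : ℝ) • t) := by
    rw [kernel, ← integral_sub_left_eq_self _ volume x]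
    congr with t
    simp only [reflectAt_dilate_reflectAt hy.ne', neg_smul, one_smul, sub_sub_cancel,
      ← sub_eq_add_neg]
  rw [hk]
  refine h.trans (le_of_eq ?_)
  have h1 : ‖y⁻¹ • (z - x)‖ = ‖y⁻¹ • (x - z)‖ := by rw [← norm_neg, ← smul_neg, neg_sub]
  rw [div_pow, pow_add, h1]; field_simp

/-- The almost orthogonality estimate for compactly supported integrands at the scale one. -/
theorem HasVanishingMoments.exists_norm_integral_dilate_le {m : ℕ} {ζ : 𝓢(Eucl d, ℂ)}
    (hζ : HasVanishingMoments m ζ) (R : ℝ) (N : ℕ) :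
    ∃ C, 0 ≤ C ∧ ∀ ε ∈ Ioc (0 : ℝ) 1, ∀ G : Eucl d → ℂ, ContDiff ℝ (⊤ : ℕ∞) G →
      tsupport G ⊆ Metric.closedBall 0 R → ∀ A, 0 ≤ A → (∀ s, ‖iteratedFDeriv ℝ m G s‖ ≤ A) →
      ∀ x, ‖∫ s, dilate ε ζ (x - s) * G s‖ ≤ C * A * ε ^ m * ((1 + ‖x‖) ^ N)⁻¹ := by
  obtain ⟨C, hC0, hC⟩ := hζ.exists_norm_integral_dilate_mul_le N
  refine ⟨C * (1 + |R|) ^ N, by positivity, fun ε hε G hG hsupp A hA0 hA x ↦ ?_⟩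
  have h := hC ε 1 hε.1 hε.2 (-1) (by simp) G hG (A * (1 + |R|) ^ N) (by positivity) 0 x fun t ↦ by
    by_cases ht : t ∈ tsupport G
    · refine (hA t).trans ?_
      rw [mul_assoc]
      refine le_mul_of_one_le_right hA0 ?_
      rw [inv_one, one_smul, sub_zero, ← div_eq_mul_inv, one_le_div (by positivity)]
      gcongr
      exact (by simpa using hsupp ht : ‖t‖ ≤ R).trans (le_abs_self R)
    · rw [Function.notMem_support.1 fun h ↦ ht (support_iteratedFDeriv_subset m h), norm_zero]
      positivity
  rw [← integral_sub_left_eq_self _ volume x]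
  simp only [neg_smul, one_smul, zero_sub, inv_one, norm_neg, ← sub_eq_add_neg] at h
  simp only [sub_sub_cancel]
  exact h.trans (le_of_eq (by ring))

/-- At a positive distance of `z` from the support of `χ`, the kernel is smaller than any power of `y`,
because of the rapid decay of `b`. The vanishing moments of `ζ` still give the gain `ε ^ m`. -/
theorem exists_norm_kernel_le_of_dist (χ : 𝓓(Ω, ℂ)) {ζ : 𝓢(Eucl d, ℂ)} (b : 𝓢(Eucl d, ℂ)) {m : ℕ}
    (hζ : HasVanishingMoments m ζ) {δ : ℝ} (hδ : 0 < δ) (P N : ℕ) :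
    ∃ C, 0 ≤ C ∧ ∀ y ∈ Ioc (0 : ℝ) 1, ∀ ε ∈ Ioc (0 : ℝ) 1, ∀ x z : Eucl d,
      (∀ s ∈ tsupport χ, δ ≤ ‖s - z‖) →
      ‖kernel χ ζ b ε y x z‖ ≤
        C * ε ^ m * y ^ P * (((1 + ‖z‖) ^ N)⁻¹ * ((1 + ‖x‖) ^ N)⁻¹) := by
  obtain ⟨R, hR⟩ := χ.hasCompactSupport.isCompact.isBounded.subset_closedBall (0 : Eucl d)
  obtain ⟨C₁, hC₁, h₁⟩ := exists_norm_iteratedFDeriv_mul_reflectAt_le χ (reflectAt 0 b) m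
    (N + (d + m + P))
  obtain ⟨C₂, hC₂, h₂⟩ := hζ.exists_norm_integral_dilate_le R N
  refine ⟨C₂ * (C₁ * (δ ^ (d + m + P))⁻¹ * (1 + |R|) ^ N), by positivity,
    fun y hy ε hε x z hz ↦ ?_⟩
  have hy0 := hy.1
  have hk : kernel χ ζ b ε y x z = ∫ s, dilate ε ζ (x - s) *
      (χ s * reflectAt z (dilate y (reflectAt 0 b)) s) := by
    simp only [kernel, reflectAt_dilate_reflectAt hy0.ne']
  rw [hk]
  have hsupp : tsupport (fun s ↦ χ s * reflectAt z (dilate y (reflectAt 0 b)) s) ⊆ tsupport χ :=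
    tsupport_mul_subset_left
  refine (h₂ ε hε _ (χ.contDiff.mul (SchwartzMap.smooth _ ⊤)) (hsupp.trans hR)
    (C₁ * (δ ^ (d + m + P))⁻¹ * (1 + |R|) ^ N * y ^ P * ((1 + ‖z‖) ^ N)⁻¹) (by positivity)
    (fun s ↦ ?_) x).trans (le_of_eq (by ring))
  by_cases hs : s ∈ tsupport χ
  swap
  · rw [Function.notMem_support.1 fun h ↦ hs (hsupp (support_iteratedFDeriv_subset m h)), norm_zero]
    positivity
  refine (h₁ y hy z s).trans ?_
  have hn : ‖y⁻¹ • (s - z)‖ = y⁻¹ * ‖s - z‖ := by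
    rw [norm_smul, norm_inv, Real.norm_of_nonneg hy0.le]
  have hyinv : 1 ≤ y⁻¹ := (one_le_inv₀ hy0).2 hy.2
  -- the decay of `b_y` at the distance `δ` compensates for all negative powers of `y`
  have h3 : ((1 + ‖y⁻¹ • (s - z)‖) ^ (N + (d + m + P)))⁻¹ ≤
      ((1 + ‖s - z‖) ^ N)⁻¹ * ((y⁻¹ * δ) ^ (d + m + P))⁻¹ := by
    rw [pow_add, mul_inv, hn]
    gcongr
    · exact le_mul_of_one_le_left (norm_nonneg _) hyinv
    · calc y⁻¹ * δ ≤ y⁻¹ * ‖s - z‖ := by gcongr; exact hz s hs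
        _ ≤ _ := by linarith
  have h4 : ((1 + ‖s - z‖) ^ N)⁻¹ ≤ ((1 + ‖z‖) ^ N)⁻¹ * (1 + |R|) ^ N := by
    have := inv_one_add_norm_add_le (-z) s N
    rw [norm_neg, show -z + s = s - z by abel] at this
    refine this.trans ?_
    gcongr
    exact (by simpa using hR hs : ‖s‖ ≤ R).trans (le_abs_self R)
  calc _ ≤ C₁ * (y ^ (d + m))⁻¹ * (((1 + ‖z‖) ^ N)⁻¹ * (1 + |R|) ^ N *
        ((y⁻¹ * δ) ^ (d + m + P))⁻¹) := by
        gcongr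
        exact h3.trans (by gcongr)
    _ = _ := by
        rw [mul_pow, inv_pow, pow_add _ (d + m) P, pow_add _ (d + m) P]; field_simp

/-- The contribution of the coarse scale `t ≥ 1` to the reproducing formula is `O(ε ^ m)`: the function
`u * Θ_t` and its derivatives are bounded uniformly in `t`. -/
theorem IsOrderBound.exists_norm_integral_mul_conv_le {u : 𝓢'(Eucl d, ℂ)} {K : Set (Eucl d)} {L : ℕ}
    {C : ℝ} (hu : IsOrderBound u K L C) (χ : 𝓓(Ω, ℂ)) {ζ : 𝓢(Eucl d, ℂ)} (Θ : 𝓢(Eucl d, ℂ)) {m : ℕ}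
    (hζ : HasVanishingMoments m ζ) (N : ℕ) :
    ∃ C', 0 ≤ C' ∧ ∀ t : ℝ, 1 ≤ t → ∀ ε ∈ Ioc (0 : ℝ) 1, ∀ x : Eucl d,
      ‖∫ s, dilate ε ζ (x - s) * (χ s * conv u (dilate t Θ) s)‖ ≤
        C' * ε ^ m * ((1 + ‖x‖) ^ N)⁻¹ := by
  obtain ⟨R, hR⟩ := χ.hasCompactSupport.isCompact.isBounded.subset_closedBall (0 : Eucl d)
  obtain ⟨A, hA0, hA⟩ := exists_bound_iteratedFDeriv_test χ m
  obtain ⟨B, hB0, hB⟩ := exists_bound_iteratedFDeriv Θ (L + m)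
  obtain ⟨C₂, hC₂, h₂⟩ := hζ.exists_norm_integral_dilate_le R N
  have hC := hu.1
  refine ⟨C₂ * (2 ^ m * (A * (C * B))), by positivity, fun t ht ε hε x ↦ ?_⟩
  have ht0 : 0 < t := by linarith
  refine h₂ ε hε _ (χ.contDiff.mul (hu.contDiff_conv _))
    ((tsupport_mul_subset_left).trans hR) (2 ^ m * (A * (C * B))) (by positivity) (fun s ↦ ?_) x
  refine norm_iteratedFDeriv_mul_le_two_pow χ.contDiff (hu.contDiff_conv _)
    (fun j hj ↦ hA j hj s) fun j hj ↦ ?_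
  refine hu.norm_iteratedFDeriv_conv_le hB0 fun l hl z _ ↦ ?_
  rw [norm_iteratedFDeriv_dilate ht0]
  refine (mul_le_of_le_one_left (norm_nonneg _) ?_).trans (hB _ (by omega) _)
  exact inv_le_one_of_one_le₀ (one_le_pow₀ ht)

/-! ### Transfer of decay between families of convolutions -/

theorem integrable_inv_one_add_norm_pow :
    Integrable fun z : Eucl d ↦ ((1 + ‖z‖) ^ (d + 1))⁻¹ := by
  have h : Integrable fun z : Eucl d ↦ (1 + ‖z‖) ^ (-((d + 1 : ℕ) : ℝ)) :=
    integrable_one_add_norm (by simp)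
  refine h.congr (.of_forall fun z ↦ ?_)
  dsimp only
  rw [Real.rpow_neg (by positivity), Real.rpow_natCast]

/-- The `L^1`-normalized dilates of a polynomially decaying function. -/
noncomputable def decayKernel (t : ℝ) (w : Eucl d) : ℝ :=
  (t ^ d)⁻¹ * ((1 + ‖t⁻¹ • w‖) ^ (d + 1))⁻¹

theorem decayKernel_nonneg {t : ℝ} (ht : 0 < t) (w : Eucl d) : 0 ≤ decayKernel t w := by
  unfold decayKernel; positivity

@[fun_prop]
theorem measurable_decayKernel (t : ℝ) : Measurable (decayKernel (d := d) t) := by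
  unfold decayKernel; fun_prop

theorem lintegral_decayKernel {t : ℝ} (ht : 0 < t) : ∫⁻ w : Eucl d, ENNReal.ofReal (decayKernel t w) =
    ENNReal.ofReal (∫ w : Eucl d, ((1 + ‖w‖) ^ (d + 1))⁻¹) := by
  have hi : Integrable (decayKernel (d := d) t) :=
    (integrable_inv_one_add_norm_pow.comp_smul (inv_ne_zero ht.ne')).const_mul _
  rw [← ofReal_integral_eq_lintegral_ofReal hi (.of_forall fun w ↦ decayKernel_nonneg ht w)]
  congr 1
  simp only [decayKernel]
  rw [integral_const_mul, Measure.integral_comp_smul volume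
    (fun w : Eucl d ↦ ((1 + ‖w‖) ^ (d + 1))⁻¹) t⁻¹]
  rw [smul_eq_mul, finrank_euclideanSpace_fin, ← mul_assoc, abs_of_pos (by positivity),
    inv_pow, inv_inv, inv_mul_cancel₀ (by positivity), one_mul]

theorem eLpNorm_inv_one_add_norm_pow_lt_top {p : ℝ≥0∞} (hp : 1 ≤ p) :
    eLpNorm (fun x : Eucl d ↦ ENNReal.ofReal ((1 + ‖x‖) ^ (d + 1))⁻¹) p volume < ∞ := by
  have h1 (x : Eucl d) : ENNReal.ofReal ((1 + ‖x‖) ^ (d + 1))⁻¹ ≤ 1 := by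
    rw [ENNReal.ofReal_le_one]
    exact inv_le_one_of_one_le₀ (one_le_pow₀ (by simp))
  rcases eq_or_ne p ∞ with rfl | hpt
  · rw [eLpNorm_exponent_top]
    exact (essSup_le_of_ae_le 1 (.of_forall h1)).trans_lt ENNReal.one_lt_top
  have hp1 : 1 ≤ p.toReal := by
    rw [← ENNReal.toReal_one]; exact ENNReal.toReal_mono hpt hp
  refine (eLpNorm_lt_top_iff_lintegral_rpow_enorm_lt_top (by positivity) hpt).2 ?_
  refine lt_of_le_of_lt (lintegral_mono fun x ↦ ?_)
    (integrable_inv_one_add_norm_pow (d := d)).lintegral_lt_top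
  rw [enorm_eq_self]
  exact ENNReal.rpow_le_self_of_le_one (h1 x) hp1

/-- The gain in the interaction of the scales `ε` and `y`, if the function at the scale `y` has
vanishing moments of order less than `M`, and the one at the scale `ε` of order less than `m`. -/
noncomputable def scaleGain (M m : ℕ) (ε y : ℝ) : ℝ := if y ≤ ε then (y / ε) ^ M else (ε / y) ^ m

theorem scaleGain_nonneg (M m : ℕ) {ε y : ℝ} (hε : 0 < ε) (hy : 0 < y) : 0 ≤ scaleGain M m ε y := by
  unfold scaleGain; split_ifs <;> positivity

theorem exists_norm_kernel_le (χ : 𝓓(Ω, ℂ)) {ζ b : 𝓢(Eucl d, ℂ)} {M m : ℕ}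
    (hζ : HasVanishingMoments m ζ) (hb : HasVanishingMoments M b) :
    ∃ C, 0 ≤ C ∧ ∀ y ∈ Ioc (0 : ℝ) 1, ∀ ε ∈ Ioc (0 : ℝ) 1, ∀ x z : Eucl d,
      ‖kernel χ ζ b ε y x z‖ ≤ C * scaleGain M m ε y * decayKernel (max y ε) (x - z) := by
  obtain ⟨C₁, hC₁, h₁⟩ := exists_norm_kernel_le_of_le χ ζ hb (d + 1)
  obtain ⟨C₂, hC₂, h₂⟩ := exists_norm_kernel_le_of_ge χ b hζ (d + 1)
  refine ⟨C₁ + C₂, by positivity, fun y hy ε hε x z ↦ ?_⟩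
  have hy0 := hy.1
  have hε0 := hε.1
  rw [scaleGain]
  split_ifs with h
  · rw [max_eq_right h]
    refine (h₁ y ε hy.1 h hε.2 x z).trans ?_
    have := decayKernel_nonneg hε0 (x - z)
    gcongr
    · linarith
    · exact le_rfl
  · rw [max_eq_left (by linarith)]
    refine (h₂ y ε hε.1 (by linarith) hy.2 x z).trans ?_
    have := decayKernel_nonneg hy0 (x - z)
    gcongr
    · linarith
    · exact le_rfl

theorem integral_mul_integral_swap {g v : Eucl d → ℂ} (b : 𝓢(Eucl d, ℂ)) (hg : Continuous g)
    {A : ℝ} (hgA : ∀ s, ‖g s‖ ≤ A) (hv : Integrable v) :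
    ∫ s, g s * ∫ z, b (s - z) * v z = ∫ z, (∫ s, g s * b (s - z)) * v z := by
  have h1 : Integrable (fun q : Eucl d × Eucl d ↦ v q.2 * b (q.1 - q.2)) (volume.prod volume) :=
    hv.convolution_integrand (ContinuousLinearMap.mul ℝ ℂ) b.integrable
  have h2 : Integrable (fun q : Eucl d × Eucl d ↦ g q.1 * (v q.2 * b (q.1 - q.2)))
      (volume.prod volume) :=
    h1.bdd_mul (c := A) (by fun_prop) (.of_forall fun q ↦ hgA q.1)
  have h3 := integral_integral_swap (f := fun s z ↦ g s * (v z * b (s - z))) h2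
  calc _ = ∫ s, ∫ z, g s * (v z * b (s - z)) := by
        congr with s
        rw [← integral_const_mul]
        congr with z; ring
    _ = _ := by
        rw [h3]
        congr with z
        rw [← integral_mul_const]
        congr with s; ring

/-- The estimate of a single term of the reproducing formula: the part of `u * ψ_y` over `ω`
enters through a convolution. Outside of `ω`, the function `u * ψ_y` grows at most like a power of
`1 / y`, which the decay of the kernel compensates. -/
theorem IsOrderBound.exists_enorm_term_le {u : 𝓢'(Eucl d, ℂ)} {K : Set (Eucl d)} {L : ℕ} {C : ℝ}
    (hu : IsOrderBound u K L C) (hK : IsCompact K) (χ : 𝓓(Ω, ℂ)) {ζ b : 𝓢(Eucl d, ℂ)}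
    (ψ : 𝓢(Eucl d, ℂ)) {M m : ℕ} (hζ : HasVanishingMoments m ζ) (hb : HasVanishingMoments M b)
    {ω : Set (Eucl d)} (hω : IsOpen ω) (hχω : tsupport χ ⊆ ω) :
    ∃ A : ℝ, 0 ≤ A ∧ ∀ y ∈ Ioc (0 : ℝ) 1, ∀ ε ∈ Ioc (0 : ℝ) 1, ∀ x : Eucl d,
      ‖∫ s, dilate ε ζ (x - s) * (χ s * conv u (sconv (dilate y b) (dilate y ψ)) s)‖ₑ ≤
        ENNReal.ofReal (A * scaleGain M m ε y) * (∫⁻ z in ω,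
          ENNReal.ofReal (decayKernel (max y ε) (x - z)) * ‖conv u (dilate y ψ) z‖ₑ) +
        ENNReal.ofReal (A * ε ^ m * y) * ENNReal.ofReal ((1 + ‖x‖) ^ (d + 1))⁻¹ := by
  obtain ⟨δ, hδ, hδω⟩ := χ.hasCompactSupport.isCompact.exists_thickening_subset_open hω hχω
  obtain ⟨R, hR⟩ := hK.isBounded.subset_closedBall (0 : Eucl d)
  obtain ⟨B, hB0, hB⟩ := hu.exists_norm_conv_dilate_le ψ
  obtain ⟨C₁, hC₁, h₁⟩ := exists_norm_kernel_le χ hζ hb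
  obtain ⟨C₂, hC₂, h₂⟩ := exists_norm_kernel_le_of_dist χ b hζ hδ (d + L + 1) (d + 1)
  set D := ∫ w : Eucl d, ((1 + ‖w‖) ^ (d + 1))⁻¹
  have hD : 0 ≤ D := integral_nonneg fun w ↦ by positivity
  refine ⟨C₁ + C₂ * B * D, by positivity, fun y hy ε hε x ↦ ?_⟩
  have hy0 := hy.1
  have hε0 := hε.1
  set v := conv u (dilate y ψ) with hv
  have hvc : Continuous v := hu.continuous_conv _
  obtain ⟨E, hE0, hE⟩ := hu.exists_norm_conv_le_decay (dilate y ψ) (R := R)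
    (fun z hz ↦ by simpa using hR hz) (d + 1)
  have hvi : Integrable v := (integrable_inv_one_add_norm_pow.const_mul E).mono'
    hvc.aestronglyMeasurable (.of_forall hE)
  obtain ⟨A₁, hA₁, hA₁'⟩ := exists_bound_iteratedFDeriv (dilate ε ζ) 0
  obtain ⟨A₂, hA₂, hA₂'⟩ := exists_bound_iteratedFDeriv_test χ 0
  have hg : ∀ s, ‖dilate ε ζ (x - s) * χ s‖ ≤ A₁ * A₂ := fun s ↦ by
    rw [norm_mul]
    have := hA₁' 0 le_rfl (x - s)
    have := hA₂' 0 le_rfl s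
    simp only [norm_iteratedFDeriv_zero] at *
    gcongr
  have hχc : Continuous χ := χ.contDiff.continuous
  have heq : ∫ s, dilate ε ζ (x - s) * (χ s * conv u (sconv (dilate y b) (dilate y ψ)) s) =
      ∫ z, kernel χ ζ b ε y x z * v z := by
    simp only [hu.conv_sconv hK, ← mul_assoc, ← hv, kernel]
    exact integral_mul_integral_swap (dilate y b) (by fun_prop) hg hvi
  rw [heq]
  refine (enorm_integral_le_lintegral_enorm _).trans ?_
  rw [← lintegral_add_compl _ hω.measurableSet]
  refine add_le_add ?_ ?_
  · rw [← lintegral_const_mul' _ _ ENNReal.ofReal_ne_top]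
    refine lintegral_mono fun z ↦ ?_
    rw [enorm_mul, ← mul_assoc, ← ENNReal.ofReal_mul (by
      have := scaleGain_nonneg M m hε0 hy0; positivity)]
    gcongr
    rw [← ofReal_norm]
    refine ENNReal.ofReal_le_ofReal ((h₁ y hy ε hε x z).trans ?_)
    have := decayKernel_nonneg (lt_max_of_lt_left hy0 : 0 < max y ε) (x - z)
    have := scaleGain_nonneg M m hε0 hy0
    gcongr
    exact le_add_of_nonneg_right (by positivity)
  · have hi := (integrable_inv_one_add_norm_pow (d := d)).const_mul
      (C₂ * B * ε ^ m * y * ((1 + ‖x‖) ^ (d + 1))⁻¹)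
    calc ∫⁻ z in ωᶜ, ‖kernel χ ζ b ε y x z * v z‖ₑ
        ≤ ∫⁻ z in ωᶜ, ENNReal.ofReal (C₂ * B * ε ^ m * y * ((1 + ‖x‖) ^ (d + 1))⁻¹ *
            ((1 + ‖z‖) ^ (d + 1))⁻¹) := by
          refine setLIntegral_mono' hω.measurableSet.compl fun z hz ↦ ?_
          rw [← ofReal_norm, norm_mul]
          refine ENNReal.ofReal_le_ofReal ?_
          have hz' : ∀ s ∈ tsupport χ, δ ≤ ‖s - z‖ := fun s hs ↦ by
            by_contra hcon
            refine hz (hδω (Metric.mem_thickening_iff.2 ⟨s, hs, ?_⟩))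
            rw [dist_comm, dist_eq_norm]; linarith
          calc _ ≤ (C₂ * ε ^ m * y ^ (d + L + 1) *
                (((1 + ‖z‖) ^ (d + 1))⁻¹ * ((1 + ‖x‖) ^ (d + 1))⁻¹)) * (B * (y ^ (d + L))⁻¹) := by
                gcongr
                · exact h₂ y hy ε hε x z hz'
                · exact hB y hy z
            _ = _ := by rw [pow_succ y (d + L)]; field_simp
      _ ≤ ∫⁻ z, ENNReal.ofReal (C₂ * B * ε ^ m * y * ((1 + ‖x‖) ^ (d + 1))⁻¹ *
            ((1 + ‖z‖) ^ (d + 1))⁻¹) := setLIntegral_le_lintegral _ _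
      _ = ENNReal.ofReal (C₂ * B * ε ^ m * y * ((1 + ‖x‖) ^ (d + 1))⁻¹ * D) := by
          rw [← ofReal_integral_eq_lintegral_ofReal hi (.of_forall fun z ↦ by positivity),
            integral_const_mul]
      _ ≤ _ := by
          rw [← ENNReal.ofReal_mul (by positivity)]
          refine ENNReal.ofReal_le_ofReal ?_
          have : 0 ≤ C₁ * (ε ^ m * y * ((1 + ‖x‖) ^ (d + 1))⁻¹) := by positivity
          linarith

/-- `χ T` depends on `T` only through `ρ T`, if `ρ` is one on the support of `χ`. -/
theorem localize_eq_localize_mul (T : 𝓓'(Ω, ℂ)) {χ ρ : 𝓓(Ω, ℂ)} (h : ∀ x ∈ tsupport χ, ρ x = 1)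
    {g g' : 𝓢(Eucl d, ℂ)} (hg : ∀ x, g' x = χ x * g x) :
    localize T χ g = localize T ρ g' := by
  rw [localize_apply, localize_apply]
  congr 1
  ext x
  rw [mulTest_apply, mulTest_apply, hg]
  by_cases hx : x ∈ tsupport χ
  · rw [h x hx, one_mul]
  · rw [image_eq_zero_of_notMem_tsupport hx]; simp

/-- The product of a test function and a Schwartz function. -/
noncomputable def mulSchwartz (χ : 𝓓(Ω, ℂ)) (g : 𝓢(Eucl d, ℂ)) : 𝓢(Eucl d, ℂ) :=
  SchwartzMap.smulLeftCLM ℂ (χ : Eucl d → ℂ) g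

theorem mulSchwartz_apply (χ : 𝓓(Ω, ℂ)) (g : 𝓢(Eucl d, ℂ)) (x : Eucl d) :
    mulSchwartz χ g x = χ x * g x :=
  SchwartzMap.smulLeftCLM_apply_apply (χ.hasCompactSupport.hasTemperateGrowth χ.contDiff) g x

/-- The reproducing formula in the form of a pointwise estimate of `(χ T) * ζ_ε`. -/
theorem enorm_conv_localize_le {T : 𝓓'(Ω, ℂ)} {χ ρ : 𝓓(Ω, ℂ)} (hρ : ∀ x ∈ tsupport χ, ρ x = 1)
    {ι : Type*} [Fintype ι] {ψ b : ι → 𝓢(Eucl d, ℂ)} {Θ : 𝓢(Eucl d, ℂ)} {l : ℝ} (hl : 1 < l)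
    (hΘ : ∫ x, Θ x = 1) (h : Θ = dilate l Θ + ∑ i, sconv (b i) (ψ i)) (ζ : 𝓢(Eucl d, ℂ)) {t : ℝ}
    (ht : 0 < t) (ε : ℝ) (x : Eucl d) :
    ‖conv (localize T χ) (dilate ε ζ) x‖ₑ ≤
      ‖∫ s, dilate ε ζ (x - s) * (χ s * conv (localize T ρ) (dilate t Θ) s)‖ₑ +
      ∑' j : ℕ, ∑ i, ‖∫ s, dilate ε ζ (x - s) * (χ s * conv (localize T ρ)
        (sconv (dilate (t * (l ^ (j + 1))⁻¹) (b i)) (dilate (t * (l ^ (j + 1))⁻¹) (ψ i))) s)‖ₑ := by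
  obtain ⟨L, C, hu⟩ := exists_isOrderBound_localize T ρ
  have hK : IsCompact (tsupport ρ) := ρ.hasCompactSupport.isCompact
  set u := localize T ρ
  set g := mulSchwartz χ (reflectAt x (dilate ε ζ))
  have hl0 : 0 < l := by linarith
  have h1 : conv (localize T χ) (dilate ε ζ) x = u g :=
    localize_eq_localize_mul T hρ fun z ↦ mulSchwartz_apply χ _ z
  have hlim : Tendsto (fun J : ℕ ↦ t * (l ^ J)⁻¹) atTop (𝓝[>] 0) := by
    refine tendsto_nhdsWithin_iff.2 ⟨?_, .of_forall fun J ↦ by simp only [mem_Ioi]; positivity⟩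
    have := (tendsto_pow_atTop_nhds_zero_of_lt_one (inv_nonneg.2 hl0.le)
      (inv_lt_one_of_one_lt₀ hl)).const_mul t
    simpa using this
  have h2 := ((hu.tendsto_integral_mul_conv_dilate hK hΘ g).comp hlim).enorm
  rw [h1]
  refine le_of_tendsto h2 (.of_forall fun J ↦ ?_)
  have hg (w : 𝓢(Eucl d, ℂ)) : ∫ s, dilate ε ζ (x - s) * (χ s * conv u w s) =
      ∫ s, g s * conv u w s := by
    congr with s
    rw [mulSchwartz_apply, reflectAt_apply]; ring
  have hint (w : 𝓢(Eucl d, ℂ)) : Integrable fun s ↦ g s * conv u w s := by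
    refine Continuous.integrable_of_hasCompactSupport
      (g.continuous.mul (hu.continuous_conv w)) (HasCompactSupport.mul_right ?_)
    have : (g : Eucl d → ℂ) = fun s ↦ χ s * reflectAt x (dilate ε ζ) s :=
      funext (mulSchwartz_apply χ _)
    rw [this]
    exact χ.hasCompactSupport.mul_right
  simp only [hg, Function.comp_apply, dilate_telescope hl h ht J, conv_add, conv_sum, mul_add,
    Finset.mul_sum]
  rw [integral_add (hint _) (integrable_finsetSum _ fun j _ ↦ integrable_finsetSum _
    fun i _ ↦ hint _), integral_finsetSum _ fun j _ ↦ integrable_finsetSum _ fun i _ ↦ hint _]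
  refine (enorm_add_le _ _).trans (add_le_add le_rfl ?_)
  refine (enorm_sum_le _ _).trans (le_trans (Finset.sum_le_sum fun j _ ↦ ?_)
    (ENNReal.sum_le_tsum (Finset.range J)))
  rw [integral_finsetSum _ fun i _ ↦ hint _]
  exact enorm_sum_le _ _

/-- The `L^p` norms of `(χ T) * ζ_ε` are controlled by the local `L^p` norms of `T * (ψ i)_y` for the
scales `y = t l^{-1}, t l^{-2}, …`. -/
theorem exists_eLpNorm_conv_localize_le (T : 𝓓'(Ω, ℂ)) {χ ρ : 𝓓(Ω, ℂ)}
    (hρ : ∀ x ∈ tsupport χ, ρ x = 1) {ι : Type*} [Fintype ι] {ψ b : ι → 𝓢(Eucl d, ℂ)}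
    {Θ : 𝓢(Eucl d, ℂ)} {l : ℝ} (hl : 1 < l) (hΘ : ∫ x, Θ x = 1)
    (h : Θ = dilate l Θ + ∑ i, sconv (b i) (ψ i)) (hb : ∀ i m, HasVanishingMoments m (b i))
    {ζ : 𝓢(Eucl d, ℂ)} {m : ℕ} (hζ : HasVanishingMoments m ζ) (M : ℕ) {ω : Set (Eucl d)}
    (hω : IsOpen ω) (hχω : tsupport χ ⊆ ω) {p : ℝ≥0∞} (hp : 1 ≤ p) :
    ∃ A : ℝ≥0∞, A ≠ ∞ ∧ ∀ ε ∈ Ioo (0 : ℝ) 1, ∀ t ∈ Ico 1 l,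
      eLpNorm (conv (localize T χ) (dilate ε ζ)) p volume ≤ A * ENNReal.ofReal (ε ^ m) +
        A * ∑' j : ℕ, ENNReal.ofReal (scaleGain M m ε (t * (l ^ (j + 1))⁻¹)) *
          ∑ i, eLpNorm (conv (localize T ρ) (dilate (t * (l ^ (j + 1))⁻¹) (ψ i))) p
            (volume.restrict ω) := by
  obtain ⟨L, C, hu⟩ := exists_isOrderBound_localize T ρ
  have hK : IsCompact (tsupport ρ) := ρ.hasCompactSupport.isCompact
  set u := localize T ρ with hudef
  have hl0 : 0 < l := by linarith
  obtain ⟨A₁, hA₁, h₁⟩ := hu.exists_norm_integral_mul_conv_le χ Θ hζ (d + 1)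
  choose A₂ hA₂ h₂ using fun i ↦ hu.exists_enorm_term_le hK χ (ψ i) hζ (hb i M) hω hχω
  set B := ∑ i, A₂ i
  have hB (i) : A₂ i ≤ B := Finset.single_le_sum (f := A₂) (fun j _ ↦ hA₂ j) (Finset.mem_univ i)
  have hB0 : 0 ≤ B := Finset.sum_nonneg fun j _ ↦ hA₂ j
  set W : Eucl d → ℝ≥0∞ := fun x ↦ ENNReal.ofReal ((1 + ‖x‖) ^ (d + 1))⁻¹
  have hWm : Measurable W := by fun_prop
  set D := eLpNorm W p volume
  have hD : D < ∞ := eLpNorm_inv_one_add_norm_pow_lt_top hp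
  set I := ENNReal.ofReal (∫ w : Eucl d, ((1 + ‖w‖) ^ (d + 1))⁻¹)
  set S := ∑' j : ℕ, ENNReal.ofReal (l⁻¹ ^ j)
  have hS : S < ∞ := by
    have hs := summable_geometric_of_lt_one (inv_nonneg.2 hl0.le) (inv_lt_one_of_one_lt₀ hl)
    rw [show S = _ from (ENNReal.ofReal_tsum_of_nonneg (fun j ↦ by positivity) hs).symm]
    exact ENNReal.ofReal_lt_top
  set k := (Fintype.card ι : ℝ≥0∞)
  refine ⟨ENNReal.ofReal A₁ * D + k * ENNReal.ofReal B * S * D + ENNReal.ofReal B * I,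
    by finiteness, fun ε hε t ht ↦ ?_⟩
  have hε' : ε ∈ Ioc (0 : ℝ) 1 := ⟨hε.1, hε.2.le⟩
  have ht0 : 0 < t := by linarith [ht.1]
  set y : ℕ → ℝ := fun j ↦ t * (l ^ (j + 1))⁻¹
  have hy0 (j) : 0 < y j := by positivity
  have hyl (j) : y j ≤ l⁻¹ ^ j := by
    calc t * (l ^ (j + 1))⁻¹ ≤ l * (l ^ (j + 1))⁻¹ := by gcongr; exact ht.2.le
      _ = l⁻¹ ^ j := by rw [pow_succ, inv_pow]; field_simp
  have hy1 (j) : y j ≤ 1 := (hyl j).trans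
    (pow_le_one₀ (inv_nonneg.2 hl0.le) (inv_le_one_of_one_le₀ hl.le))
  set V : ι → ℕ → ℝ≥0∞ := fun i j ↦ eLpNorm (conv u (dilate (y j) (ψ i))) p (volume.restrict ω)
  have hvm (i j) : Measurable fun z ↦ ‖conv u (dilate (y j) (ψ i)) z‖ₑ :=
    (hu.continuous_conv _).measurable.enorm
  -- the contribution of the scale `y j` and the function `ψ i`
  set N : ι → ℕ → Eucl d → ℝ≥0∞ := fun i j x ↦
    ENNReal.ofReal (B * scaleGain M m ε (y j)) * (∫⁻ z in ω,
      ENNReal.ofReal (decayKernel (max (y j) ε) (x - z)) * ‖conv u (dilate (y j) (ψ i)) z‖ₑ) +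
      ENNReal.ofReal (B * ε ^ m * l⁻¹ ^ j) * W x
  have hconvm (i j) : Measurable fun x ↦ ∫⁻ z in ω,
      ENNReal.ofReal (decayKernel (max (y j) ε) (x - z)) * ‖conv u (dilate (y j) (ψ i)) z‖ₑ := by
    refine Measurable.lintegral_prod_right' (f := fun q : Eucl d × Eucl d ↦
      ENNReal.ofReal (decayKernel (max (y j) ε) (q.1 - q.2)) *
        ‖conv u (dilate (y j) (ψ i)) q.2‖ₑ) ?_
    exact (by fun_prop : Measurable fun q : Eucl d × Eucl d ↦
      ENNReal.ofReal (decayKernel (max (y j) ε) (q.1 - q.2))).mul ((hvm i j).comp measurable_snd)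
  have hNm (i j) : Measurable (N i j) :=
    ((hconvm i j).const_mul _).add (hWm.const_mul _)
  have hNp (i j) : eLpNorm (N i j) p volume ≤
      ENNReal.ofReal B * I * (ENNReal.ofReal (scaleGain M m ε (y j)) * V i j) +
        ENNReal.ofReal B * D * ENNReal.ofReal (ε ^ m) * ENNReal.ofReal (l⁻¹ ^ j) := by
    refine (eLpNorm_add_le ((hconvm i j).const_mul _).aestronglyMeasurable
      (hWm.const_mul _).aestronglyMeasurable hp).trans (add_le_add ?_ ?_)
    · refine (eLpNorm_const_mul_le ENNReal.ofReal_ne_top _ p).trans ?_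
      have h3 := eLpNorm_setLIntegral_mul_le (H := fun w ↦
        ENNReal.ofReal (decayKernel (max (y j) ε) w)) (by fun_prop) (hvm i j) hp hω.measurableSet
      rw [lintegral_decayKernel (lt_max_of_lt_left (hy0 j)), eLpNorm_enorm] at h3
      rw [ENNReal.ofReal_mul hB0]
      calc _ ≤ ENNReal.ofReal B * ENNReal.ofReal (scaleGain M m ε (y j)) * (I * V i j) := by
            gcongr
        _ = _ := by ring
    · refine (eLpNorm_const_mul_le ENNReal.ofReal_ne_top _ p).trans (le_of_eq ?_)
      have hε0 := hε.1.le
      rw [ENNReal.ofReal_mul (by positivity), ENNReal.ofReal_mul hB0]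
      ring
  have hpoint (x : Eucl d) : ‖conv (localize T χ) (dilate ε ζ) x‖ₑ ≤
      ENNReal.ofReal (A₁ * ε ^ m) * W x + ∑' j, ∑ i, N i j x := by
    refine (enorm_conv_localize_le hρ hl hΘ h ζ ht0 ε x).trans (add_le_add ?_ ?_)
    · have hε0 := hε.1.le
      rw [← ofReal_norm, ← ENNReal.ofReal_mul (by positivity)]
      exact ENNReal.ofReal_le_ofReal (h₁ t ht.1 ε hε' x)
    · refine ENNReal.tsum_le_tsum fun j ↦ Finset.sum_le_sum fun i _ ↦ ?_
      refine (h₂ i (y j) ⟨hy0 j, hy1 j⟩ ε hε' x).trans ?_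
      have h3 := scaleGain_nonneg M m hε.1 (hy0 j)
      have hε0 := hε.1.le
      have h4 := (hy0 j).le
      simp only [N]
      gcongr
      · exact hB i
      · exact hB i
      · exact hyl j
  calc eLpNorm (conv (localize T χ) (dilate ε ζ)) p volume
      ≤ eLpNorm ((fun x ↦ ENNReal.ofReal (A₁ * ε ^ m) * W x) + fun x ↦ ∑' j, ∑ i, N i j x) p
          volume := eLpNorm_mono_enorm fun x ↦ by simpa using hpoint x
    _ ≤ eLpNorm (fun x ↦ ENNReal.ofReal (A₁ * ε ^ m) * W x) p volume +
          eLpNorm (fun x ↦ ∑' j, ∑ i, N i j x) p volume :=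
        eLpNorm_add_le (hWm.const_mul _).aestronglyMeasurable
          (Measurable.tsum fun j ↦ Finset.measurable_fun_sum _
            fun i _ ↦ hNm i j).aestronglyMeasurable hp
    _ ≤ ENNReal.ofReal A₁ * ENNReal.ofReal (ε ^ m) * D + ∑' j, ∑ i, (ENNReal.ofReal B * I *
          (ENNReal.ofReal (scaleGain M m ε (y j)) * V i j) +
          ENNReal.ofReal B * D * ENNReal.ofReal (ε ^ m) * ENNReal.ofReal (l⁻¹ ^ j)) := by
        gcongr
        · refine (eLpNorm_const_mul_le ENNReal.ofReal_ne_top _ p).trans (le_of_eq ?_)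
          rw [ENNReal.ofReal_mul hA₁]
        · refine (eLpNorm_tsum_le (fun j ↦ (Finset.measurable_fun_sum _
            fun i _ ↦ hNm i j).aemeasurable) hp).trans (ENNReal.tsum_le_tsum fun j ↦ ?_)
          have : (fun x ↦ ∑ i, N i j x) = ∑ i, N i j := by ext; simp
          rw [this]
          refine (eLpNorm_sum_le (fun i _ ↦ (hNm i j).aestronglyMeasurable) hp).trans ?_
          exact Finset.sum_le_sum fun i _ ↦ hNp i j
    _ = (ENNReal.ofReal A₁ * D + k * ENNReal.ofReal B * S * D) * ENNReal.ofReal (ε ^ m) +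
          ENNReal.ofReal B * I * ∑' j, ENNReal.ofReal (scaleGain M m ε (y j)) * ∑ i, V i j := by
        simp only [Finset.sum_add_distrib, Finset.sum_const, Finset.card_univ, nsmul_eq_mul,
          ← Finset.mul_sum]
        rw [ENNReal.tsum_add, ENNReal.tsum_mul_left, ENNReal.tsum_mul_left, ENNReal.tsum_mul_left]
        ring
    _ ≤ _ := by
        refine add_le_add (mul_le_mul_left ?_ _) (mul_le_mul_left ?_ _)
        · exact le_self_add
        · exact le_add_self

/-- The core of the argument: if the functions `ψ i` satisfy a Tauberian condition, then
the local behaviour of `T * (ψ i)_y` of the order `y ^ r` implies that of `(χ T) * ζ_ε`, for every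
function `ζ` with vanishing moments of order less than `m`, where `m > r`. -/
theorem eLpNorm_conv_localize_lt_top (T : 𝓓'(Ω, ℂ)) {χ ρ : 𝓓(Ω, ℂ)}
    (hρ : ∀ x ∈ tsupport χ, ρ x = 1) {ι : Type*} [Fintype ι] {ψ : ι → 𝓢(Eucl d, ℂ)} {σ η : ℝ}
    (hσ : 0 < σ) (hη : η ∈ Ioo (0 : ℝ) 1)
    (hψ : ∀ ξ : Eucl d, η * σ ≤ ‖ξ‖ → ‖ξ‖ ≤ σ → ∃ i, FourierTransform.fourier (ψ i) ξ ≠ 0)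
    {ζ : 𝓢(Eucl d, ℂ)} {m : ℕ} (hζ : HasVanishingMoments m ζ) {r : ℝ} (hr : r < m)
    {ω : Set (Eucl d)} (hω : IsOpen ω) (hχω : tsupport χ ⊆ ω) {p q : ℝ≥0∞} (hp : 1 ≤ p)
    (hq : 1 ≤ q)
    (hm : ∀ i, AEMeasurable (fun y ↦ eLpNorm (conv (localize T ρ) (dilate y (ψ i))) p
      (volume.restrict ω)) logMeasure)
    (hfin : ∀ i, eLpNorm (fun y : ℝ ↦ ENNReal.ofReal (y ^ (-r)) *
      eLpNorm (conv (localize T ρ) (dilate y (ψ i))) p (volume.restrict ω)) q logMeasure < ∞) :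
    eLpNorm (fun ε : ℝ ↦ ENNReal.ofReal (ε ^ (-r)) *
      eLpNorm (conv (localize T χ) (dilate ε ζ)) p volume) q logMeasure < ∞ := by
  obtain ⟨l, hl, Θ, b, hΘ, hb, h⟩ := exists_calderon ψ hσ hη hψ
  have hl0 : 0 < l := by linarith
  -- the order of the moments of the `b i` which are used must exceed `-r`
  obtain ⟨M, hM⟩ := exists_nat_ge (1 - r)
  obtain ⟨A, hA, hbound⟩ := exists_eLpNorm_conv_localize_le T hρ hl hΘ h hb hζ M hω hχω hp
  set V : ℝ → ℝ≥0∞ := fun y ↦ ∑ i, eLpNorm (conv (localize T ρ) (dilate y (ψ i))) p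
    (volume.restrict ω)
  set F : ℝ → ℝ≥0∞ := fun y ↦ ENNReal.ofReal (y ^ (-r)) * V y
  have hVm : AEMeasurable V logMeasure := Finset.aemeasurable_fun_sum _ fun i _ ↦ hm i
  have hFm : AEMeasurable F logMeasure := AEMeasurable.mul (by fun_prop) hVm
  have hF : eLpNorm F q logMeasure < ∞ := by
    have : F = ∑ i, fun y : ℝ ↦ ENNReal.ofReal (y ^ (-r)) *
        eLpNorm (conv (localize T ρ) (dilate y (ψ i))) p (volume.restrict ω) := by
      ext y; simp [F, V, Finset.mul_sum]
    rw [this]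
    refine (eLpNorm_sum_le (fun i _ ↦ ?_) hq).trans_lt (ENNReal.sum_lt_top.2 fun i _ ↦ hfin i)
    exact (AEMeasurable.mul (by fun_prop) (hm i)).aestronglyMeasurable
  set c := min 1 (m - r)
  have hc0 : 0 < c := lt_min one_pos (by linarith)
  set θ := l ^ (-c)
  have hθ0 : 0 < θ := Real.rpow_pos_of_pos hl0 _
  have hθ1 : θ < 1 := Real.rpow_lt_one_of_one_lt_of_neg hl (by linarith)
  have hθ (n : ℕ) : θ ^ n = l ^ (-(c * n)) := by
    rw [← Real.rpow_natCast, ← Real.rpow_mul hl0.le]; congr 1; ring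
  -- on the grid, the gain beats the weight with a geometric factor
  have hgain (ε : ℝ) (hε : 0 < ε) (i : ℤ) :
      ε ^ (-r) * scaleGain M m ε (ε * l ^ i) ≤ θ ^ i.natAbs * (ε * l ^ i) ^ (-r) := by
    have hli : (l ^ i : ℝ) = l ^ (i : ℝ) := (Real.rpow_intCast l i).symm
    rw [Real.mul_rpow hε.le (zpow_nonneg hl0.le i), mul_left_comm]
    gcongr
    rw [hli, ← Real.rpow_mul hl0.le, hθ, ← Real.rpow_add hl0, scaleGain]
    have h1 : ε * l ^ (i : ℝ) ≤ ε ↔ i ≤ 0 := by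
      rw [mul_le_iff_le_one_right hε]
      constructor
      · intro hle
        by_contra! hcon
        exact absurd hle (not_le.2 (Real.one_lt_rpow hl (by exact_mod_cast hcon)))
      · intro hle
        exact Real.rpow_le_one_of_one_le_of_nonpos hl.le (by exact_mod_cast hle)
    rcases le_or_gt i 0 with hi | hi
    · rw [if_pos (h1.2 hi), mul_div_cancel_left₀ _ hε.ne', ← Real.rpow_mul_natCast hl0.le]
      refine Real.rpow_le_rpow_of_exponent_le hl.le ?_
      have hn : ((i.natAbs : ℕ) : ℝ) = -(i : ℝ) := by
        rw [Nat.cast_natAbs, abs_of_nonpos hi]; push_cast; ring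
      have hi' : (i : ℝ) ≤ 0 := by exact_mod_cast hi
      rw [hn]
      nlinarith [min_le_left (1 : ℝ) (m - r)]
    · rw [if_neg (fun h ↦ absurd (h1.1 h) (by omega)), div_mul_cancel_left₀ hε.ne',
        ← Real.rpow_neg hl0.le, ← Real.rpow_mul_natCast hl0.le]
      refine Real.rpow_le_rpow_of_exponent_le hl.le ?_
      have hn : ((i.natAbs : ℕ) : ℝ) = (i : ℝ) := by
        rw [Nat.cast_natAbs, abs_of_pos hi]
      have hi' : (0 : ℝ) < i := by exact_mod_cast hi
      rw [hn]
      nlinarith [min_le_right (1 : ℝ) (m - r)]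
  refine eLpNorm_lt_top_of_le_grid hq hFm hF (l := l) (θ := θ) (c := m - r) (A := A) hl0 hθ0.le hθ1
    (by linarith) hA fun ε hε ↦ ?_
  -- the coarse scale `t = ε l ^ (n + 1)` is chosen in `[1, l)` such that its grid passes through `ε`
  obtain ⟨n, hn1, hn2⟩ := exists_mem_Ioc_zpow (inv_pos.2 hε.1) hl
  have hε0 := hε.1
  have hn3 : ε * l ^ n < 1 := by
    have := mul_lt_mul_of_pos_left hn1 hε0
    rwa [mul_inv_cancel₀ hε0.ne'] at this
  have ht : ε * l ^ (n + 1) ∈ Ico 1 l := by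
    constructor
    · have := mul_le_mul_of_nonneg_left hn2 hε0.le
      rwa [mul_inv_cancel₀ hε0.ne'] at this
    · rw [zpow_add_one₀ hl0.ne', ← mul_assoc]
      exact mul_lt_of_lt_one_left hl0 hn3
  have hgrid (j : ℕ) : ε * l ^ (n + 1) * (l ^ (j + 1))⁻¹ = ε * l ^ (n - j) := by
    rw [mul_assoc, ← zpow_natCast, ← zpow_neg, ← zpow_add₀ hl0.ne']
    congr 2; push_cast; ring
  have hmem (j : ℕ) : ε * l ^ (n - j) ∈ Ioo (0 : ℝ) 1 := by
    refine ⟨by positivity, lt_of_le_of_lt ?_ hn3⟩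
    gcongr
    · exact hl.le
    · omega
  calc _ ≤ ENNReal.ofReal (ε ^ (-r)) * (A * ENNReal.ofReal (ε ^ m) + A * ∑' j : ℕ,
        ENNReal.ofReal (scaleGain M m ε (ε * l ^ (n - j))) * V (ε * l ^ (n - j))) := by
        gcongr
        have := hbound ε hε _ ht
        simp only [hgrid] at this
        exact this
    _ = A * ENNReal.ofReal (ε ^ (m - r)) + A * ∑' j : ℕ, ENNReal.ofReal (ε ^ (-r) *
        scaleGain M m ε (ε * l ^ (n - j))) * V (ε * l ^ (n - j)) := by
        have h1 : ε ^ (m - r) = ε ^ (-r) * ε ^ m := by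
          rw [← Real.rpow_natCast, ← Real.rpow_add hε0]; congr 1; ring
        have h0 : 0 ≤ ε ^ (-r) := Real.rpow_nonneg hε0.le _
        simp only [h1, ENNReal.ofReal_mul h0, mul_assoc, ENNReal.tsum_mul_left]
        ring
    _ ≤ A * ENNReal.ofReal (ε ^ (m - r)) + A * ∑' j : ℕ, (fun i : ℤ ↦ ENNReal.ofReal
        (θ ^ i.natAbs) * (Ioo (0 : ℝ) 1).indicator F (ε * l ^ i)) (n - j) := by
        gcongr with j
        dsimp only
        rw [indicator_of_mem (hmem j)]
        simp only [F]
        rw [← mul_assoc, ← ENNReal.ofReal_mul (by positivity)]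
        exact mul_le_mul_left (ENNReal.ofReal_le_ofReal (hgain ε hε0 _)) _
    _ ≤ _ := by
        gcongr
        exact ENNReal.tsum_comp_le_tsum_of_injective (f := fun j : ℕ ↦ n - (j : ℤ))
          (fun a b hab ↦ by simpa using hab) _

/-! ### Nets of convolutions -/

/-- The topology of the space of multilinear maps is that of the pointwise convergence on a basis. -/
theorem continuousOn_of_forall_basis {X : Type*} [TopologicalSpace X] {s : Set X} {n : ℕ}
    {F : X → Eucl d [×n]→L[ℝ] ℂ}
    (h : ∀ i : Fin n → Fin d, ContinuousOn (fun q ↦ F q fun j ↦ EuclideanSpace.single (i j) (1 : ℝ)) s) :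
    ContinuousOn F s := by
  let Φ : (Eucl d [×n]→L[ℝ] ℂ) →ₗ[ℝ] ((Fin n → Fin d) → ℂ) :=
    { toFun := fun A i ↦ A fun j ↦ EuclideanSpace.single (i j) (1 : ℝ)
      map_add' := fun _ _ ↦ rfl
      map_smul' := fun _ _ ↦ rfl }
  have hinj : Function.Injective Φ := by
    intro A B hAB
    refine ContinuousMultilinearMap.toMultilinearMap_injective ?_
    refine Module.Basis.ext_multilinear
      (fun _ ↦ (EuclideanSpace.basisFun (Fin d) ℝ).toBasis) fun v ↦ ?_
    simpa [Φ] using congrFun hAB v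
  have : FiniteDimensional ℝ (Eucl d [×n]→L[ℝ] ℂ) := Module.Finite.of_injective Φ hinj
  have hemb := LinearMap.isClosedEmbedding_of_injective (f := Φ) (LinearMap.ker_eq_bot.2 hinj)
  rw [hemb.isInducing.continuousOn_iff, continuousOn_pi]
  exact h

theorem IsOrderBound.isContNet_conv {u : 𝓢'(Eucl d, ℂ)} {K : Set (Eucl d)} {L : ℕ} {C : ℝ}
    (hu : IsOrderBound u K L C) (hK : IsCompact K) (f : 𝓢(Eucl d, ℂ)) (Ω : Opens (Eucl d)) :
    IsContNet Ω fun ε ↦ conv u (dilate ε f) where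
  smooth _ _ := (hu.contDiff_conv _).contDiffOn
  cont n := by
    refine continuousOn_of_forall_basis fun i ↦ ?_
    have h := (hu.continuousOn_conv_dilate hK
      (∂^{fun j ↦ EuclideanSpace.single (i j) (1 : ℝ)} f)).mono
      fun q (hq : q ∈ Ioo (0 : ℝ) 1 ×ˢ (Ω : Set (Eucl d))) ↦ ⟨hq.1.1, mem_univ _⟩
    have h2 : ContinuousOn (fun q : ℝ × Eucl d ↦ (q.1⁻¹ ^ n)) (Ioo (0 : ℝ) 1 ×ˢ (Ω : Set (Eucl d))) :=
      (continuousOn_fst.inv₀ fun q (hq : q ∈ Ioo (0 : ℝ) 1 ×ˢ (Ω : Set (Eucl d))) ↦ hq.1.1.ne').pow n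
    refine (h2.smul h).congr fun q hq ↦ ?_
    exact hu.iteratedFDeriv_conv_dilate f _ q.2 hq.1.1.ne'

/-- The product of a smooth net with a fixed test function. -/
theorem IsContNet.test_mul {f : ℝ → Eucl d → ℂ} (hf : IsContNet Ω f)
    (hs : ∀ ε ∈ Ioo (0 : ℝ) 1, ContDiff ℝ (⊤ : ℕ∞) (f ε)) (χ : 𝓓(Ω, ℂ)) :
    IsContNet Ω fun ε x ↦ χ x * f ε x where
  smooth ε hε := (χ.contDiff.mul (hs ε hε)).contDiffOn
  cont n := by
    intro q hq
    obtain ⟨A, hA0, hA⟩ := exists_bound_iteratedFDeriv_test χ n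
    set S := Ioo (0 : ℝ) 1 ×ˢ (Ω : Set (Eucl d))
    have hsq := hs q.1 hq.1
    have hg : ContDiff ℝ (⊤ : ℕ∞) fun x ↦ χ x * f q.1 x := χ.contDiff.mul hsq
    have hc : Continuous (iteratedFDeriv ℝ n fun x ↦ χ x * f q.1 x) :=
      hg.continuous_iteratedFDeriv (mod_cast le_top)
    have hd0 (j : ℕ) : Tendsto (fun z : ℝ × Eucl d ↦ ‖iteratedFDeriv ℝ j (f z.1) z.2 -
        iteratedFDeriv ℝ j (f q.1) z.2‖) (𝓝[S] q) (𝓝 0) := by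
      have h1 : Tendsto (fun z : ℝ × Eucl d ↦ iteratedFDeriv ℝ j (f z.1) z.2) (𝓝[S] q)
        (𝓝 (iteratedFDeriv ℝ j (f q.1) q.2)) := hf.cont j q hq
      have h2 : Tendsto (fun z : ℝ × Eucl d ↦ iteratedFDeriv ℝ j (f q.1) z.2) (𝓝[S] q)
        (𝓝 (iteratedFDeriv ℝ j (f q.1) q.2)) :=
        ((hsq.continuous_iteratedFDeriv (m := j) (mod_cast le_top)).comp continuous_snd).continuousWithinAt
      simpa using (h1.sub h2).norm
    have hd : Tendsto (fun z : ℝ × Eucl d ↦ iteratedFDeriv ℝ n (fun x ↦ χ x * f z.1 x) z.2 -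
        iteratedFDeriv ℝ n (fun x ↦ χ x * f q.1 x) z.2) (𝓝[S] q) (𝓝 0) := by
      rw [tendsto_zero_iff_norm_tendsto_zero]
      have hsum : Tendsto (fun z : ℝ × Eucl d ↦ 2 ^ n * (A * ∑ j ∈ Finset.range (n + 1),
          ‖iteratedFDeriv ℝ j (f z.1) z.2 - iteratedFDeriv ℝ j (f q.1) z.2‖)) (𝓝[S] q) (𝓝 0) := by
        have := ((tendsto_finsetSum (Finset.range (n + 1)) fun j _ ↦ hd0 j).const_mul A).const_mul
          (2 ^ n)
        simpa using this
      refine squeeze_zero' (.of_forall fun z ↦ norm_nonneg _) ?_ hsum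
      filter_upwards [self_mem_nhdsWithin] with z hz
      have hsz := hs z.1 hz.1
      have hat {h : Eucl d → ℂ} (hh : ContDiff ℝ (⊤ : ℕ∞) h) (j : ℕ) : ContDiffAt ℝ j h z.2 :=
        (hh.of_le (mod_cast le_top)).contDiffAt
      rw [← iteratedFDeriv_sub_apply (hat (χ.contDiff.mul hsz) n) (hat hg n)]
      have : (fun x ↦ χ x * f z.1 x) - (fun x ↦ χ x * f q.1 x) =
          fun x ↦ χ x * (f z.1 - f q.1) x := by ext x; simp [mul_sub]
      rw [this]
      refine norm_iteratedFDeriv_mul_le_two_pow χ.contDiff (hsz.sub hsq) (fun j hj ↦ hA j hj _)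
        fun j hj ↦ ?_
      rw [iteratedFDeriv_sub_apply (hat hsz j) (hat hsq j)]
      exact Finset.single_le_sum (f := fun j ↦ ‖iteratedFDeriv ℝ j (f z.1) z.2 -
        iteratedFDeriv ℝ j (f q.1) z.2‖) (fun _ _ ↦ norm_nonneg _) (Finset.mem_range.2 (by omega))
    have hfin := hd.add ((hc.comp continuous_snd).continuousWithinAt (s := S) (x := q)).tendsto
    rw [ContinuousWithinAt]
    simpa using hfin

theorem IsContNet.sum {ι : Type*} (s : Finset ι) {f : ι → ℝ → Eucl d → ℂ}
    (hf : ∀ i ∈ s, IsContNet Ω (f i)) : IsContNet Ω (∑ i ∈ s, f i) :=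
  Finset.sum_induction f (IsContNet Ω) (fun _ _ ↦ IsContNet.add) (.zero Ω) hf

theorem sobolevNorm_congr (k : ℕ) (p : ℝ≥0∞) {ω : Set (Eucl d)} (hω : IsOpen ω) {f g : Eucl d → ℂ}
    (h : ∀ x ∈ ω, f x = g x) : sobolevNorm k p ω f = sobolevNorm k p ω g := by
  refine iSup_congr fun n ↦ iSup_congr fun i ↦ eLpNorm_congr_ae ?_
  filter_upwards [ae_restrict_mem hω.measurableSet] with x hx
  have : f =ᶠ[𝓝 x] g := by
    filter_upwards [hω.mem_nhds hx] with z hz using h z hz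
  rw [(this.iteratedFDeriv ℝ n).eq_of_nhds]

theorem netNorm_congr (q p : ℝ≥0∞) (k : ℕ) (s : ℝ) {ω : Set (Eucl d)} (hω : IsOpen ω)
    {f g : ℝ → Eucl d → ℂ} (h : ∀ ε ∈ Ioo (0 : ℝ) 1, ∀ x ∈ ω, f ε x = g ε x) :
    netNorm q p k s ω f = netNorm q p k s ω g := by
  refine eLpNorm_congr_ae ?_
  filter_upwards [ae_logMeasure] with ε hε
  rw [sobolevNorm_congr k p hω (h ε hε)]

/-- A net which is `O(ε ^ a)` with its derivatives has a finite norm with any weight `s > -a`. -/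
theorem netNorm_lt_top_of_norm_le {q p : ℝ≥0∞} {k : ℕ} {s : ℝ} {ω : Set (Eucl d)}
    (hω : MeasurableSet ω) (hvol : volume ω < ∞) {f : ℝ → Eucl d → ℂ} {C a : ℝ} (has : 0 < a + s)
    (h : ∀ n ≤ k, ∀ ε ∈ Ioo (0 : ℝ) 1, ∀ x ∈ ω, ‖iteratedFDeriv ℝ n (f ε) x‖ ≤ C * ε ^ a) :
    netNorm q p k s ω f < ∞ := by
  set A := (volume ω) ^ p.toReal⁻¹
  have hA : A ≠ ∞ := ENNReal.rpow_ne_top_of_nonneg (by positivity) hvol.ne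
  have hbound : ∀ ε ∈ Ioo (0 : ℝ) 1, ENNReal.ofReal (ε ^ s) * sobolevNorm k p ω (f ε) ≤
      (A * ENNReal.ofReal C) * ENNReal.ofReal (ε ^ (a + s)) := by
    intro ε hε
    have hε0 := hε.1
    have h1 : sobolevNorm k p ω (f ε) ≤ A * ENNReal.ofReal (C * ε ^ a) := by
      refine iSup_le fun n ↦ iSup_le fun i ↦ ?_
      refine (eLpNorm_le_of_ae_bound (C := C * ε ^ a) ?_).trans (by simp [A])
      filter_upwards [ae_restrict_mem hω] with x hx
      refine (ContinuousMultilinearMap.le_opNorm _ _).trans ?_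
      simpa using h n (by omega) ε hε x hx
    calc _ ≤ ENNReal.ofReal (ε ^ s) * (A * ENNReal.ofReal (C * ε ^ a)) := by gcongr
      _ = _ := by
        rw [Real.rpow_add hε0, ENNReal.ofReal_mul (Real.rpow_nonneg hε0.le _), mul_comm C,
          ENNReal.ofReal_mul (Real.rpow_nonneg hε0.le _)]
        ring
  refine lt_of_le_of_lt (eLpNorm_mono_enorm_ae (g := fun ε : ℝ ↦
    (A * ENNReal.ofReal C) * ENNReal.ofReal (ε ^ (a + s))) ?_) ?_
  · filter_upwards [ae_logMeasure] with ε hε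
    simpa using hbound ε hε
  · exact (eLpNorm_const_mul_le (by finiteness) _ q).trans_lt
      (ENNReal.mul_lt_top (by finiteness) (eLpNorm_rpow_logMeasure_lt_top has q))

/-- The derivatives of `u * f_y` grow at most like a power of `1 / y`. -/
theorem IsOrderBound.exists_norm_iteratedFDeriv_conv_dilate_le {u : 𝓢'(Eucl d, ℂ)}
    {K : Set (Eucl d)} {L : ℕ} {C : ℝ} (hu : IsOrderBound u K L C) (f : 𝓢(Eucl d, ℂ)) (k : ℕ) :
    ∃ C', 0 ≤ C' ∧ ∀ n ≤ k, ∀ y ∈ Ioc (0 : ℝ) 1, ∀ x,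
      ‖iteratedFDeriv ℝ n (conv u (dilate y f)) x‖ ≤ C' * (y ^ (d + L + k))⁻¹ := by
  obtain ⟨A, hA0, hA⟩ := exists_bound_iteratedFDeriv f (L + k)
  refine ⟨C * A, mul_nonneg hu.1 hA0, fun n hn y hy x ↦ ?_⟩
  have hy0 := hy.1
  rw [mul_assoc]
  refine hu.norm_iteratedFDeriv_conv_le (by positivity) fun l hl z _ ↦ ?_
  rw [norm_iteratedFDeriv_dilate hy0, mul_comm]
  have := pow_le_pow_of_le_one hy0.le hy.2 (show d + (l + n) ≤ d + L + k by omega)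
  gcongr
  exact hA _ (by omega) _

/-- Away from the support of `u`, the functions `u * f_y` and their derivatives tend to zero faster than
any power of `y`. -/
theorem IsOrderBound.exists_norm_iteratedFDeriv_conv_dilate_le_pow {u : 𝓢'(Eucl d, ℂ)}
    {K : Set (Eucl d)} {L : ℕ} {C : ℝ} (hu : IsOrderBound u K L C) (f : 𝓢(Eucl d, ℂ)) {δ : ℝ}
    (hδ : 0 < δ) (k M : ℕ) :
    ∃ C', 0 ≤ C' ∧ ∀ n ≤ k, ∀ y ∈ Ioc (0 : ℝ) 1, ∀ x, (∀ z ∈ K, δ ≤ ‖x - z‖) →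
      ‖iteratedFDeriv ℝ n (conv u (dilate y f)) x‖ ≤ C' * y ^ M := by
  obtain ⟨A, hA0, hA⟩ := exists_decay f (d + L + k + M) (L + k)
  refine ⟨C * (A * (δ ^ (d + L + k + M))⁻¹), mul_nonneg hu.1 (by positivity),
    fun n hn y hy x hx ↦ ?_⟩
  have hy0 := hy.1
  rw [mul_assoc]
  refine hu.norm_iteratedFDeriv_conv_le (by positivity) fun l hl z hz ↦ ?_
  rw [norm_iteratedFDeriv_dilate hy0]
  have h1 := pow_le_pow_of_le_one hy0.le hy.2 (show d + (l + n) ≤ d + L + k by omega)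
  have h2 : y⁻¹ * δ ≤ 1 + ‖y⁻¹ • (x - z)‖ := by
    rw [norm_smul, norm_inv, Real.norm_of_nonneg hy0.le]
    have : y⁻¹ * δ ≤ y⁻¹ * ‖x - z‖ := by gcongr; exact hx z hz
    linarith
  calc _ ≤ (y ^ (d + L + k))⁻¹ * (A * ((y⁻¹ * δ) ^ (d + L + k + M))⁻¹) := by
        gcongr
        exact (hA _ (by omega) _).trans (by gcongr)
    _ = _ := by rw [mul_pow, inv_pow, pow_add y (d + L + k) M, pow_add δ]; field_simp

/-- The product of a test function with the convolution of a distribution whose support is disjoint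
from that of the test function is a negligible net. -/
theorem netNorm_test_mul_conv_lt_top (T : 𝓓'(Ω, ℂ)) {χ ρ : 𝓓(Ω, ℂ)}
    (h : Disjoint (tsupport χ) (tsupport ρ)) (φ : 𝓢(Eucl d, ℂ)) {ω : Set (Eucl d)}
    (hω : IsRelCompact ω Ω) (q p : ℝ≥0∞) (k : ℕ) (s : ℝ) :
    netNorm q p k s ω (fun ε x ↦ χ x * conv (localize T ρ) (dilate ε φ) x) < ∞ := by
  obtain ⟨L, C, hu⟩ := exists_isOrderBound_localize T ρ
  obtain ⟨δ, hδ, hδχ⟩ := χ.hasCompactSupport.isCompact.exists_thickening_subset_open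
    (isClosed_tsupport ρ).isOpen_compl h.subset_compl_right
  obtain ⟨A, hA0, hA⟩ := exists_bound_iteratedFDeriv_test χ k
  obtain ⟨M, hM⟩ := exists_nat_gt (-s)
  obtain ⟨B, hB0, hB⟩ := hu.exists_norm_iteratedFDeriv_conv_dilate_le_pow φ hδ k M
  have hvol : volume ω < ∞ :=
    (measure_mono subset_closure).trans_lt hω.isCompact_closure.measure_lt_top
  refine netNorm_lt_top_of_norm_le hω.isOpen.measurableSet hvol (C := 2 ^ k * (A * B))
    (a := M) (by linarith) fun n hn ε hε x _ ↦ ?_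
  have hε0 := hε.1
  rw [Real.rpow_natCast]
  by_cases hx : x ∈ tsupport χ
  · have hx' : ∀ z ∈ tsupport ρ, δ ≤ ‖x - z‖ := fun z hz ↦ by
      by_contra hcon
      refine hδχ (Metric.mem_thickening_iff.2 ⟨x, hx, ?_⟩) hz
      rw [dist_comm, dist_eq_norm]; linarith
    refine (norm_iteratedFDeriv_mul_le_two_pow χ.contDiff (hu.contDiff_conv _)
      (fun j hj ↦ hA j (hj.trans hn) x)
      (fun j hj ↦ hB j (hj.trans hn) ε ⟨hε.1, hε.2.le⟩ x hx')).trans ?_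
    have : (2 : ℝ) ^ n ≤ 2 ^ k := pow_le_pow_right₀ (by norm_num) hn
    calc _ ≤ (2 : ℝ) ^ k * (A * (B * ε ^ M)) := by gcongr
      _ = _ := by ring
  · have hsupp : tsupport (fun x ↦ χ x * conv (localize T ρ) (dilate ε φ) x) ⊆ tsupport χ :=
      tsupport_mul_subset_left
    rw [Function.notMem_support.1 fun h ↦ hx (hsupp (support_iteratedFDeriv_subset n h)), norm_zero]
    positivity

/-! ### The embedded net on relatively compact sets -/

namespace IsCutoffSequence

variable {θ : ℕ → 𝓓(Ω, ℂ)}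

theorem eventually_eq_one (hθ : IsCutoffSequence Ω θ) {n : ℕ} {x : Eucl d} (hx : x ∈ tsupport (θ n))
    {m : ℕ} (hm : n < m) : ∀ᶠ z in 𝓝 x, θ m z = 1 := by
  obtain ⟨k, rfl⟩ := Nat.exists_eq_add_of_lt hm
  induction k generalizing n x with
  | zero => exact (hθ.succ_eq_one n).filter_mono (nhds_le_nhdsSet hx)
  | succ k ih =>
    have h1 : θ (n + 1) x = 1 := ((hθ.succ_eq_one n).filter_mono (nhds_le_nhdsSet hx)).self_of_nhds
    have := ih (n := n + 1) (x := x) (subset_tsupport _ (by simp [h1])) (by omega)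
    rwa [show n + 1 + k + 1 = n + (k + 1) + 1 by ring] at this

theorem eq_one (hθ : IsCutoffSequence Ω θ) {n : ℕ} {x : Eucl d} (hx : x ∈ tsupport (θ n))
    {m : ℕ} (hm : n < m) : θ m x = 1 := (hθ.eventually_eq_one hx hm).self_of_nhds

theorem tsupport_mono (hθ : IsCutoffSequence Ω θ) {n m : ℕ} (hnm : n ≤ m) :
    tsupport (θ n) ⊆ tsupport (θ m) := by
  rcases hnm.eq_or_lt with rfl | h
  · exact subset_rfl
  · exact fun x hx ↦ subset_tsupport _ (by simp [hθ.eq_one hx h])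

end IsCutoffSequence

theorem sum_range_partition (N : ℕ) (x : Eucl d) :
    ∑ n ∈ Finset.range (N + 1), partition Ω n x = cutoff Ω N x := by
  induction N with
  | zero => simp [partition]
  | succ N ih => rw [Finset.sum_range_succ, ih]; simp [partition]

theorem tsupport_partition_subset (n : ℕ) : tsupport (partition Ω n) ⊆ tsupport (cutoff Ω n) := by
  rcases n with _ | n
  · rfl
  · refine closure_minimal (fun x hx ↦ ?_) (isClosed_tsupport _)
    by_contra h
    have h1 : x ∉ tsupport (cutoff Ω n) := fun h' ↦
      h ((isCutoffSequence_cutoff Ω).tsupport_mono n.le_succ h')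
    exact hx (by simp [partition, image_eq_zero_of_notMem_tsupport h,
      image_eq_zero_of_notMem_tsupport h1])

theorem localize_sub_apply (T : 𝓓'(Ω, ℂ)) (χ ρ : 𝓓(Ω, ℂ)) (g : 𝓢(Eucl d, ℂ)) :
    localize T (χ - ρ) g = localize T χ g - localize T ρ g := by
  have h : mulTest (χ - ρ) g = mulTest χ g - mulTest ρ g := by
    ext x; simp [mulTest_apply, sub_mul]
  simp only [localize_apply, evalC, h, map_sub]
  ring

/-- The net which, on the set where `cutoff Ω N` is one, is the difference between the net of the
embedded distribution `T` and `(cutoff Ω (N + 1) T) * φ_ε`. Each summand is the product of a test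
function and the convolution of `φ_ε` with a distribution of disjoint support. -/
noncomputable def embedDefect (φ : 𝓢(Eucl d, ℂ)) (T : 𝓓'(Ω, ℂ)) (N : ℕ) : ℝ → Eucl d → ℂ :=
  ∑ n ∈ Finset.range (N + 1), fun ε x ↦ partition Ω n x *
    conv (localize T (cutoff Ω (n + 1) - cutoff Ω (N + 1))) (dilate ε φ) x

theorem isContNet_conv_localize (T : 𝓓'(Ω, ℂ)) (ρ : 𝓓(Ω, ℂ)) (φ : 𝓢(Eucl d, ℂ)) (Ω' : Opens (Eucl d)) :
    IsContNet Ω' fun ε ↦ conv (localize T ρ) (dilate ε φ) := by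
  obtain ⟨L, C, hu⟩ := exists_isOrderBound_localize T ρ
  exact hu.isContNet_conv ρ.hasCompactSupport.isCompact φ Ω'

theorem contDiff_conv_localize (T : 𝓓'(Ω, ℂ)) (ρ : 𝓓(Ω, ℂ)) (f : 𝓢(Eucl d, ℂ)) :
    ContDiff ℝ (⊤ : ℕ∞) (conv (localize T ρ) f) := by
  obtain ⟨L, C, hu⟩ := exists_isOrderBound_localize T ρ
  exact hu.contDiff_conv f

theorem isContNet_test_mul_conv (T : 𝓓'(Ω, ℂ)) (χ ρ : 𝓓(Ω, ℂ)) (φ : 𝓢(Eucl d, ℂ)) :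
    IsContNet Ω fun ε x ↦ χ x * conv (localize T ρ) (dilate ε φ) x :=
  (isContNet_conv_localize T ρ φ Ω).test_mul (fun _ _ ↦ contDiff_conv_localize T ρ _) χ

theorem isContNet_embedDefect (φ : 𝓢(Eucl d, ℂ)) (T : 𝓓'(Ω, ℂ)) (N : ℕ) :
    IsContNet Ω (embedDefect φ T N) :=
  IsContNet.sum _ fun _ _ ↦ isContNet_test_mul_conv T _ _ φ

theorem netNorm_embedDefect_lt_top (φ : 𝓢(Eucl d, ℂ)) (T : 𝓓'(Ω, ℂ)) (N : ℕ) {ω : Set (Eucl d)}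
    (hω : IsRelCompact ω Ω) (q p : ℝ≥0∞) (k : ℕ) (s : ℝ) :
    netNorm q p k s ω (embedDefect φ T N) < ∞ := by
  have hθ := isCutoffSequence_cutoff Ω
  refine (Finset.sum_induction (s := Finset.range (N + 1))
    (fun n ε x ↦ partition Ω n x *
      conv (localize T (cutoff Ω (n + 1) - cutoff Ω (N + 1))) (dilate ε φ) x)
    (fun f : ℝ → Eucl d → ℂ ↦ IsContNet Ω f ∧ netNorm q p k s ω f < ∞)
    (fun f g hf hg ↦ ⟨hf.1.add hg.1, netNorm_add_lt_top hω hf.1 hg.1 hf.2 hg.2⟩)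
    ⟨.zero Ω, by simp [netNorm_zero]⟩ fun n hn ↦ ⟨isContNet_test_mul_conv T _ _ φ,
      netNorm_test_mul_conv_lt_top T ?_ φ hω q p k s⟩).2
  rw [Set.disjoint_left]
  intro x hx
  have hx' := tsupport_partition_subset n hx
  rw [notMem_tsupport_iff_eventuallyEq]
  filter_upwards [hθ.eventually_eq_one hx' n.lt_succ_self,
    hθ.eventually_eq_one hx' (m := N + 1) (by simpa using hn)] with z h1 h2
  have h1' : cutoff Ω (n + 1) z = 1 := h1
  simp [h1', h2]

theorem embedNet_eq_of_cutoff_eq_one (φ : 𝓢(Eucl d, ℂ)) (T : 𝓓'(Ω, ℂ)) {N : ℕ} {x : Eucl d}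
    (hx : cutoff Ω N x = 1) (ε : ℝ) : embedNet φ T ε x =
      conv (localize T (cutoff Ω (N + 1))) (dilate ε φ) x + embedDefect φ T N ε x := by
  have hθ := isCutoffSequence_cutoff Ω
  have hx' : x ∈ tsupport (cutoff Ω N) := subset_tsupport _ (by simp [hx])
  have hone (n : ℕ) (hn : N ≤ n) : cutoff Ω n x = 1 := by
    rcases hn.eq_or_lt with rfl | h
    · exact hx
    · exact hθ.eq_one hx' h
  rw [embedNet, finsum_eq_sum_of_support_subset (s := Finset.range (N + 1))]
  · have h1 (n : ℕ) : conv (localize T (cutoff Ω (n + 1))) (dilate ε φ) x =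
        conv (localize T (cutoff Ω (N + 1))) (dilate ε φ) x +
          conv (localize T (cutoff Ω (n + 1) - cutoff Ω (N + 1))) (dilate ε φ) x := by
      simp only [conv, localize_sub_apply]; ring
    simp only [embedDefect, Finset.sum_apply]
    rw [Finset.sum_congr rfl fun n _ ↦ by rw [h1 n, mul_add], Finset.sum_add_distrib,
      ← Finset.sum_mul, sum_range_partition, hx, one_mul]
  · intro n hn
    by_contra hcon
    have hN : N < n := by simpa using hcon
    obtain ⟨m, rfl⟩ : ∃ m, n = m + 1 := ⟨n - 1, by omega⟩
    exact hn (by simp [partition, hone (m + 1) (by omega), hone m (by omega)])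

theorem isContNet_embedNet (φ : 𝓢(Eucl d, ℂ)) (T : 𝓓'(Ω, ℂ)) : IsContNet Ω (embedNet φ T) := by
  have hloc (x : Eucl d) (hx : x ∈ Ω) : ∃ N, ∀ᶠ z in 𝓝 x, ∀ ε, embedNet φ T ε z =
      ((fun ε ↦ conv (localize T (cutoff Ω (N + 1))) (dilate ε φ)) + embedDefect φ T N) ε z := by
    obtain ⟨N, hN⟩ := (isCutoffSequence_cutoff Ω).exhausts {x} isCompact_singleton (by simpa using hx)
    rw [nhdsSet_singleton] at hN
    exact ⟨N, hN.mono fun z hz ε ↦ embedNet_eq_of_cutoff_eq_one φ T hz ε⟩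
  have hnet (N : ℕ) := (isContNet_conv_localize T (cutoff Ω (N + 1)) φ Ω).add
    (isContNet_embedDefect φ T N)
  refine ⟨fun ε hε x hx ↦ ?_, fun n z hz ↦ ?_⟩
  · obtain ⟨N, hN⟩ := hloc x hx
    exact ((hnet N).smooth ε hε x hx).congr_of_eventuallyEq
      (eventually_nhdsWithin_of_eventually_nhds (hN.mono fun z hz ↦ hz ε)) (hN.self_of_nhds ε)
  · obtain ⟨N, hN⟩ := hloc z.2 hz.2
    refine ((hnet N).cont n z hz).congr_of_eventuallyEq ?_ ?_
    · have h1 : ∀ᶠ w : ℝ × Eucl d in 𝓝 z, ∀ᶠ x in 𝓝 w.2, ∀ ε, embedNet φ T ε x =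
        ((fun ε ↦ conv (localize T (cutoff Ω (N + 1))) (dilate ε φ)) + embedDefect φ T N) ε x :=
        continuous_snd.continuousAt.eventually hN.eventually_nhds
      filter_upwards [eventually_nhdsWithin_of_eventually_nhds h1] with w hw
      exact (Filter.EventuallyEq.iteratedFDeriv ℝ (hw.mono fun x hx ↦ hx w.1) n).eq_of_nhds
    · exact (Filter.EventuallyEq.iteratedFDeriv ℝ (hN.mono fun x hx ↦ hx z.1) n).eq_of_nhds

/-- On a relatively compact set, the net of the embedded distribution `T` is equivalent to
`(ρ T) * φ_ε` for a cutoff `ρ`. -/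
theorem exists_netNorm_embedNet_iff (φ : 𝓢(Eucl d, ℂ)) (T : 𝓓'(Ω, ℂ)) {ω : Set (Eucl d)}
    (hω : IsRelCompact ω Ω) : ∃ ρ : 𝓓(Ω, ℂ), (∀ x ∈ closure ω, ρ x = 1) ∧
      (∃ ρ' : 𝓓(Ω, ℂ), ∀ x ∈ tsupport ρ, ρ' x = 1) ∧ ∀ (q p : ℝ≥0∞) (k : ℕ) (s : ℝ),
      (netNorm q p k s ω (embedNet φ T) < ∞ ↔
        netNorm q p k s ω (fun ε ↦ conv (localize T ρ) (dilate ε φ)) < ∞) := by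
  have hθ := isCutoffSequence_cutoff Ω
  obtain ⟨N, hN⟩ := hθ.exhausts _ hω.isCompact_closure hω.closure_subset
  have hN' (x) (hx : x ∈ closure ω) : cutoff Ω N x = 1 :=
    (hN.filter_mono (nhds_le_nhdsSet hx)).self_of_nhds
  refine ⟨cutoff Ω (N + 1), fun x hx ↦ hθ.eq_one (n := N)
    (subset_tsupport _ (by simp [hN' x hx])) N.lt_succ_self,
    ⟨cutoff Ω (N + 2), fun x hx ↦ hθ.eq_one hx (by omega)⟩, fun q p k s ↦ ?_⟩
  set f : ℝ → Eucl d → ℂ := fun ε ↦ conv (localize T (cutoff Ω (N + 1))) (dilate ε φ)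
  have hf : IsContNet Ω f := isContNet_conv_localize T _ φ Ω
  have hR := isContNet_embedDefect φ T N
  have hRn := netNorm_embedDefect_lt_top φ T N hω q p k s
  have heq : netNorm q p k s ω (embedNet φ T) = netNorm q p k s ω (f + embedDefect φ T N) :=
    netNorm_congr q p k s hω.isOpen fun ε _ x hx ↦
      embedNet_eq_of_cutoff_eq_one φ T (hN' x (subset_closure hx)) ε
  rw [heq]
  refine ⟨fun h ↦ ?_, fun h ↦ netNorm_add_lt_top hω hf hR h hRn⟩
  have := netNorm_add_lt_top hω (hf.add hR) (hR.smul (-1)) h (netNorm_smul_lt_top hω (-1) hR hRn)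
  simpa using this

theorem embedNet_mem_moderate (φ : 𝓢(Eucl d, ℂ)) (T : 𝓓'(Ω, ℂ)) (q p : ℝ≥0∞) :
    embedNet φ T ∈ moderate Ω q p := by
  refine ⟨isContNet_embedNet φ T, fun k ω hω ↦ ?_⟩
  obtain ⟨ρ, -, -, hρ⟩ := exists_netNorm_embedNet_iff φ T hω
  obtain ⟨L, C, hu⟩ := exists_isOrderBound_localize T ρ
  obtain ⟨B, hB0, hB⟩ := hu.exists_norm_iteratedFDeriv_conv_dilate_le φ k
  have hvol : volume ω < ∞ :=
    (measure_mono subset_closure).trans_lt hω.isCompact_closure.measure_lt_top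
  refine ⟨(d + L + k : ℕ) + 1, (hρ q p k _).2 ?_⟩
  refine netNorm_lt_top_of_norm_le hω.isOpen.measurableSet hvol (C := B)
    (a := -((d + L + k : ℕ) : ℝ)) (by linarith) fun n hn ε hε x _ ↦ ?_
  rw [Real.rpow_neg hε.1.le, Real.rpow_natCast]
  exact hB n hn ε ⟨hε.1, hε.2.le⟩ x

/-! ### Besov regularity and the growth of the embedded net -/

theorem sobolevNorm_zero_order (p : ℝ≥0∞) (ω : Set (Eucl d)) (u : Eucl d → ℂ) :
    sobolevNorm 0 p ω u = eLpNorm u p (volume.restrict ω) := by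
  refine le_antisymm (iSup_le fun n ↦ iSup_le fun i ↦ ?_) (le_iSup₂_of_le 0 Fin.elim0 ?_)
  · obtain ⟨n, hn⟩ := n
    obtain rfl : n = 0 := by omega
    simp
  · simp

theorem aemeasurable_eLpNorm_conv (T : 𝓓'(Ω, ℂ)) (ρ : 𝓓(Ω, ℂ)) (f : 𝓢(Eucl d, ℂ)) (p : ℝ≥0∞)
    {Ω' : Opens (Eucl d)} {ω : Set (Eucl d)} (hω : IsRelCompact ω Ω') :
    AEMeasurable (fun y ↦ eLpNorm (conv (localize T ρ) (dilate y f)) p (volume.restrict ω))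
      logMeasure := by
  simpa only [sobolevNorm_zero_order] using
    (isContNet_conv_localize T ρ f Ω').aemeasurable_sobolevNorm hω 0 p

/-- The derivatives of `(ρ T) * φ_ε` are the convolutions with the dilates of the derivatives of `φ`,
up to a power of `ε`. -/
theorem rpow_mul_eLpNorm_iteratedFDeriv_conv (T : 𝓓'(Ω, ℂ)) (ρ : 𝓓(Ω, ℂ)) (f : 𝓢(Eucl d, ℂ)) {n : ℕ}
    (v : Fin n → Eucl d) {ε : ℝ} (hε : 0 < ε) (s : ℝ) (p : ℝ≥0∞) (μ : Measure (Eucl d)) :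
    ENNReal.ofReal (ε ^ s) *
      eLpNorm (fun x ↦ iteratedFDeriv ℝ n (conv (localize T ρ) (dilate ε f)) x v) p μ =
    ENNReal.ofReal (ε ^ (s - n)) * eLpNorm (conv (localize T ρ) (dilate ε (∂^{v} f))) p μ := by
  obtain ⟨L, C, hu⟩ := exists_isOrderBound_localize T ρ
  have h : (fun x ↦ iteratedFDeriv ℝ n (conv (localize T ρ) (dilate ε f)) x v) =
      (ε⁻¹ ^ n) • conv (localize T ρ) (dilate ε (∂^{v} f)) :=
    funext fun x ↦ hu.iteratedFDeriv_conv_dilate f v x hε.ne'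
  rw [h, eLpNorm_const_smul, ← mul_assoc, ← ofReal_norm, Real.norm_of_nonneg (by positivity),
    ← ENNReal.ofReal_mul (by positivity), Real.rpow_sub hε, Real.rpow_natCast, inv_pow,
    div_eq_mul_inv]

/-- The norm of the net `(ρ T) * f_ε` is finite if this holds for the contribution of every derivative
of `f`. -/
theorem netNorm_conv_lt_top (T : 𝓓'(Ω, ℂ)) (ρ : 𝓓(Ω, ℂ)) (f : 𝓢(Eucl d, ℂ)) {ω : Set (Eucl d)}
    (hω : IsRelCompact ω Ω) {q p : ℝ≥0∞} (hq : 1 ≤ q) (k : ℕ) (s : ℝ)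
    (h : ∀ n ≤ k, ∀ v : Fin n → Eucl d, eLpNorm (fun ε : ℝ ↦ ENNReal.ofReal (ε ^ (s - n)) *
      eLpNorm (conv (localize T ρ) (dilate ε (∂^{v} f))) p (volume.restrict ω)) q logMeasure < ∞) :
    netNorm q p k s ω (fun ε ↦ conv (localize T ρ) (dilate ε f)) < ∞ := by
  set G : (Σ n : Fin (k + 1), (Fin n → Fin d)) → ℝ → ℝ≥0∞ := fun a ε ↦
    ENNReal.ofReal (ε ^ (s - (a.1 : ℕ))) * eLpNorm (conv (localize T ρ)
      (dilate ε (∂^{fun j ↦ EuclideanSpace.single (a.2 j) (1 : ℝ)} f))) p (volume.restrict ω)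
  have hG (a) : AEMeasurable (G a) logMeasure :=
    AEMeasurable.mul (by fun_prop) (aemeasurable_eLpNorm_conv T ρ _ p hω)
  have hle (ε : ℝ) : ∀ a, G a ε ≤ ∑ a, G a ε := by
    clear_value G
    exact fun a ↦ Finset.single_le_sum (f := fun a ↦ G a ε) (fun _ _ ↦ zero_le) (Finset.mem_univ a)
  have hsum : eLpNorm (∑ a, G a) q logMeasure < ∞ :=
    (eLpNorm_sum_le (fun a _ ↦ (hG a).aestronglyMeasurable) hq).trans_lt
      (ENNReal.sum_lt_top.2 fun a _ ↦ h a.1 (Nat.lt_succ_iff.1 a.1.2)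
        fun j ↦ EuclideanSpace.single (a.2 j) (1 : ℝ))
  refine lt_of_le_of_lt (eLpNorm_mono_enorm_ae ?_) hsum
  filter_upwards [ae_logMeasure] with ε hε
  simp only [enorm_eq_self, Finset.sum_apply, sobolevNorm, ENNReal.mul_iSup]
  refine iSup_le fun n ↦ iSup_le fun i ↦ ?_
  rw [rpow_mul_eLpNorm_iteratedFDeriv_conv T ρ f _ hε.1]
  exact hle ε ⟨n, i⟩

/-- The norm of the net `(ρ T) * f_ε` controls the contributions of the derivatives of `f` of the highest
order. -/
theorem eLpNorm_conv_le_netNorm (T : 𝓓'(Ω, ℂ)) (ρ : 𝓓(Ω, ℂ)) (f : 𝓢(Eucl d, ℂ)) (ω : Set (Eucl d))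
    (q p : ℝ≥0∞) (k : ℕ) (s : ℝ) (i : Fin k → Fin d) :
    eLpNorm (fun ε : ℝ ↦ ENNReal.ofReal (ε ^ (s - k)) * eLpNorm (conv (localize T ρ)
      (dilate ε (∂^{fun j ↦ EuclideanSpace.single (i j) (1 : ℝ)} f))) p (volume.restrict ω))
      q logMeasure ≤ netNorm q p k s ω (fun ε ↦ conv (localize T ρ) (dilate ε f)) := by
  refine eLpNorm_mono_enorm_ae ?_
  filter_upwards [ae_logMeasure] with ε hε
  simp only [enorm_eq_self]
  rw [← rpow_mul_eLpNorm_iteratedFDeriv_conv T ρ f _ hε.1]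
  gcongr
  exact le_iSup₂_of_le (Fin.last k) i le_rfl

/-- Local Besov regularity bounds the growth of the embedded net, by the transfer from `ψ₁` to the
derivatives of `φ`. -/
theorem netNorm_embedNet_lt_top_of_mem_besovLoc {p q : ℝ≥0∞} (hp : 1 ≤ p) (hq : 1 ≤ q)
    (φ : 𝓢(Eucl d, ℂ)) {r : ℝ} {φ₁ ψ₁ : 𝓢(Eucl d, ℂ)} (hpair : IsLPPair r φ₁ ψ₁) {k : ℕ} (hk : r < k)
    {T : 𝓓'(Ω, ℂ)} (hT : T ∈ besovLoc Ω p q r φ₁ ψ₁) {ω : Set (Eucl d)} (hω : IsRelCompact ω Ω) :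
    netNorm q p k (k - r) ω (embedNet φ T) < ∞ := by
  obtain ⟨ρ, -, ⟨ρ', hρ'⟩, hiff⟩ := exists_netNorm_embedNet_iff φ T hω
  refine (hiff q p k _).2 (netNorm_conv_lt_top T ρ φ hω hq k _ fun n hn v ↦ ?_)
  obtain ⟨σ, hσ, η, hη, -, hψ⟩ := hpair.nonvanishing
  obtain ⟨R, hR⟩ := ρ.hasCompactSupport.isCompact.isBounded.subset_ball (0 : Eucl d)
  have hball : IsRelCompact (Metric.ball (0 : Eucl d) R) (⊤ : Opens (Eucl d)) :=
    ⟨Metric.isOpen_ball, Metric.isBounded_ball.isCompact_closure, fun _ _ ↦ trivial⟩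
  have hfin : eLpNorm (fun y : ℝ ↦ ENNReal.ofReal (y ^ (-r)) *
      eLpNorm (conv (localize T ρ') (dilate y ψ₁)) p volume) q logMeasure < ∞ :=
    lt_of_le_of_lt le_add_self (hT ρ')
  have hnk : (n : ℝ) ≤ k := by exact_mod_cast hn
  have h := eLpNorm_conv_localize_lt_top T hρ' (ι := Unit) (ψ := fun _ ↦ ψ₁) hσ hη
    (fun ξ h1 h2 ↦ ⟨(), norm_pos_iff.1 (hψ ξ h1 h2)⟩)
    (hasVanishingMoments_iteratedLineDeriv φ v) (r := r - k + n) (by linarith)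
    Metric.isOpen_ball hR hp hq (fun _ ↦ aemeasurable_eLpNorm_conv T ρ' ψ₁ p hball) (fun _ ↦ by
      refine lt_of_le_of_lt (eLpNorm_mono_enorm_ae ?_) hfin
      filter_upwards [ae_logMeasure] with y hy
      simp only [enorm_eq_self]
      refine mul_le_mul' (ENNReal.ofReal_le_ofReal ?_) (eLpNorm_mono_measure _ Measure.restrict_le_self)
      exact Real.rpow_le_rpow_of_exponent_ge hy.1 hy.2.le (by linarith))
  refine lt_of_le_of_lt (eLpNorm_mono_enorm fun ε ↦ ?_) h
  simp only [enorm_eq_self]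
  rw [show (k : ℝ) - r - n = -(r - k + n) by ring]
  gcongr
  exact Measure.restrict_le_self

theorem fourier_iteratedLineDeriv_const (w : Eucl d) (f : 𝓢(Eucl d, ℂ)) (k : ℕ) (ξ : Eucl d) :
    FourierTransform.fourier (∂^{fun _ : Fin k ↦ w} f : 𝓢(Eucl d, ℂ)) ξ =
      ((2 * Real.pi * Complex.I) * (inner ℝ ξ w : ℂ)) ^ k * FourierTransform.fourier f ξ := by
  induction k with
  | zero => simp
  | succ k ih =>
    rw [LineDeriv.iteratedLineDerivOp_succ_left, fourier_lineDeriv]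
    have : Fin.tail (fun _ : Fin (k + 1) ↦ w) = fun _ : Fin k ↦ w := rfl
    rw [this, ih, pow_succ]; ring

/-- The moment condition `|α| ≤ ⌊r⌋` in the form of a strict inequality in `ℕ`; it is empty for `r < 0`. -/
theorem IsLPPair.hasVanishingMoments {r : ℝ} {φ₁ ψ₁ : 𝓢(Eucl d, ℂ)} (h : IsLPPair r φ₁ ψ₁) :
    HasVanishingMoments (⌊r⌋ + 1).toNat ψ₁ :=
  hasVanishingMoments_of_moment fun α hα ↦ h.moment_eq_zero α (by omega)

/-- The growth of the embedded net bounds the Besov norm, by the transfer from the derivatives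
`∂_i^k φ` to `ψ₁`. -/
theorem mem_besovLoc_of_netNorm_embedNet_lt_top {p q : ℝ≥0∞} (hp : 1 ≤ p) (hq : 1 ≤ q)
    {φ : 𝓢(Eucl d, ℂ)} (hφ : ∫ x, φ x = 1) {r : ℝ} {φ₁ ψ₁ : 𝓢(Eucl d, ℂ)}
    (hpair : IsLPPair r φ₁ ψ₁) {k : ℕ} {T : 𝓓'(Ω, ℂ)}
    (hT : ∀ ω : Set (Eucl d), IsRelCompact ω Ω → netNorm q p k (k - r) ω (embedNet φ T) < ∞) :
    T ∈ besovLoc Ω p q r φ₁ ψ₁ := by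
  intro χ
  refine ENNReal.add_lt_top.2 ⟨?_, ?_⟩
  · obtain ⟨L, C, hu⟩ := exists_isOrderBound_localize T χ
    obtain ⟨R, hR⟩ := χ.hasCompactSupport.isCompact.isBounded.subset_closedBall (0 : Eucl d)
    obtain ⟨E, hE0, hE⟩ := hu.exists_norm_conv_le_decay φ₁ (R := R)
      (fun z hz ↦ by simpa using hR hz) (d + 1)
    refine lt_of_le_of_lt (eLpNorm_mono_enorm (g := fun x : Eucl d ↦
      ENNReal.ofReal E * ENNReal.ofReal ((1 + ‖x‖) ^ (d + 1))⁻¹) fun x ↦ ?_)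
      ((eLpNorm_const_mul_le ENNReal.ofReal_ne_top _ p).trans_lt
        (ENNReal.mul_lt_top ENNReal.ofReal_lt_top (eLpNorm_inv_one_add_norm_pow_lt_top hp)))
    rw [enorm_eq_self, ← ofReal_norm, ← ENNReal.ofReal_mul hE0]
    exact ENNReal.ofReal_le_ofReal (hE x)
  obtain ⟨ω, hωo, hχω, hωΩ, hωc⟩ := exists_open_between_and_isCompact_closure
    χ.hasCompactSupport.isCompact Ω.isOpen χ.tsupport_subset
  have hω : IsRelCompact ω Ω := ⟨hωo, hωc, hωΩ⟩
  obtain ⟨ρ, hρ, -, hiff⟩ := exists_netNorm_embedNet_iff φ T hω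
  have hnet := (hiff q p k _).1 (hT ω hω)
  -- the Fourier transform of `φ` has no zero near the origin
  obtain ⟨σ, hσ, hσφ⟩ : ∃ σ > 0, ∀ ξ : Eucl d, ‖ξ‖ ≤ σ → FourierTransform.fourier φ ξ ≠ 0 := by
    have h0 : FourierTransform.fourier φ 0 ≠ 0 := by
      rw [← integral_eq_fourier_zero, hφ]; exact one_ne_zero
    have hc : Continuous (FourierTransform.fourier φ : 𝓢(Eucl d, ℂ)) := SchwartzMap.continuous _
    obtain ⟨σ, hσ, h⟩ := Metric.nhds_basis_closedBall.eventually_iff.1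
      (hc.continuousAt.eventually_ne h0)
    exact ⟨σ, hσ, fun ξ hξ ↦ h (by simpa using hξ)⟩
  refine eLpNorm_conv_localize_lt_top T (fun x hx ↦ hρ x (subset_closure (hχω hx))) (ι := Fin d)
    (ψ := fun i ↦ ∂^{fun _ : Fin k ↦ EuclideanSpace.single i (1 : ℝ)} φ) hσ (η := 1 / 2)
    (by norm_num) (fun ξ h1 h2 ↦ ?_) hpair.hasVanishingMoments ?_ hωo hχω hp hq
    (fun i ↦ aemeasurable_eLpNorm_conv T ρ _ p hω) fun i ↦ ?_
  · obtain ⟨i, hi⟩ : ∃ i, ξ i ≠ 0 := by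
      by_contra! hcon
      have : ξ = 0 := by ext i; exact hcon i
      rw [this, norm_zero] at h1
      linarith
    refine ⟨i, ?_⟩
    rw [fourier_iteratedLineDeriv_const]
    refine mul_ne_zero (pow_ne_zero _ ?_) (hσφ ξ h2)
    simpa [Real.pi_ne_zero, EuclideanSpace.inner_single_right] using hi
  · calc r < ⌊r⌋ + 1 := Int.lt_floor_add_one r
      _ = ((⌊r⌋ + 1 : ℤ) : ℝ) := by push_cast; rfl
      _ ≤ _ := by exact_mod_cast Int.self_le_toNat (⌊r⌋ + 1)
  · have := (eLpNorm_conv_le_netNorm T ρ φ ω q p k (k - r) fun _ ↦ i).trans_lt hnet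
    rwa [show (k : ℝ) - r - k = -r by ring] at this

end BesovColombeau

theorem mainTheorem5 (d : ℕ) (Ω : TopologicalSpace.Opens (Eucl d)) (p q : ℝ≥0∞)
    (hp : 1 ≤ p) (hq : 1 ≤ q) (φ : 𝓢(Eucl d, ℂ)) (hφ : IsMollifier φ)
    (r : ℝ) (φ₁ ψ₁ : 𝓢(Eucl d, ℂ)) (hpair : IsLPPair r φ₁ ψ₁) (k : ℕ) (hk : r < k) :
    embed (Ω := Ω) q p φ '' besovLoc Ω p q r φ₁ ψ₁ =
      besovGenFun Ω q p k (k - r) ∩ Set.range (embed (Ω := Ω) q p φ) := by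
  ext F
  constructor
  · rintro ⟨T, hT, rfl⟩
    have hmod := embedNet_mem_moderate φ T q p
    exact ⟨⟨⟨embedNet φ T, hmod, rfl⟩, embedNet φ T, ⟨hmod, fun ω hω ↦
      netNorm_embedNet_lt_top_of_mem_besovLoc hp hq φ hpair hk hT hω⟩, rfl⟩, T, rfl⟩
  · rintro ⟨⟨-, f, ⟨hf, hfω⟩, hfT⟩, T, rfl⟩
    refine ⟨T, mem_besovLoc_of_netNorm_embedNet_lt_top hp hq hφ.integral_eq_one hpair
      (k := k) fun ω hω ↦ ?_, rfl⟩
    have hneg : embedNet φ T - f ∈ negligible Ω q p := (Submodule.Quotient.eq _).1 hfT.symm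
    have := netNorm_add_lt_top hω hf.1 hneg.1 (hfω ω hω) (hneg.2 k ω hω _)
    simpa using this
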